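/- Let $\beta\in(0,\pi/2]$ and $\nu>0$, and write $\mathbb R^+=(0,\infty)$. Let $\mathring H^1_0(\mathbb R^+)$ be the completion of $C_c^\infty(\mathbb R^+)$ in the norm $\|u\|^2=\int_0^\infty|u'|^2\,dx$, identified with a space of continuous functions on $[0,\infty)$ vanishing at $0$, and let $\mathcal A$ be the set of all $\theta\in C([0,\infty))$ with $\theta-\beta\in\mathring H^1_0(\mathbb R^+)$. Let $\eta_\beta:\mathbb R\to[0,\beta]$ be any smooth function with $\eta_\beta=\beta$ on $(-\infty,0]$, $\eta_\beta=0$ on $[1,\infty)$ and $\eta_\beta'\le 0$. For $\theta\in\mathcal A$ put $$E_\beta(\theta)=\int_0^\infty\Big(\tfrac12|\theta'|^2+\tfrac12\sin^2\theta+\frac{\nu}{4\pi}\,\frac{\sin^2(\theta-\beta)-\sin^2(\eta_\beta-\beta)}{x}\Big)dx+\frac{\nu}{8\pi}J(\theta)-\frac{\nu}{8\pi}J(\eta_\beta)\in(-\infty,\infty],$$ $$J(\theta)=\int_0^\infty\!\!\int_0^\infty\frac{(\sin(\theta(x)-\beta)-\sin(\theta(y)-\beta))^2}{(x-y)^2}\,dx\,dy.$$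 Let $\theta\in\mathcal A$ be a minimizer of $E_\beta$ over $\mathcal A$. Then $\theta\in C^2(\mathbb R^+)\cap C^1([0,\infty))\cap W^{1,\infty}(\mathbb R^+)$, and for every $x>0$ the following principal-value integral (the limit as $\varepsilon\to0^+$ of the integrals over $\{y>0:|y-x|>\varepsilon\}$) exists and $$\theta''(x)=\sin\theta(x)\cos\theta(x)+\frac{\nu}{2\pi}\,\frac{\sin(\theta(x)-\beta)\cos(\theta(x)-\beta)}{x}+\frac{\nu}{2\pi}\cos(\theta(x)-\beta)\;\mathrm{p.v.}\!\!\int_0^\infty\frac{\sin(\theta(x)-\beta)-\sin(\theta(y)-\beta)}{(x-y)^2}\,dy.$$ Moreover $|\theta'(0)|=\sin\beta$ and $\lim_{x\to0^+}|\theta''(x)|=\infty$. -/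

import Mathlib

open MeasureTheory Set Filter Topology
open scoped ContDiff ENNReal

namespace EdgeWall

noncomputable section

/-- Lebesgue measure on the open half-line `ℝ⁺ = (0, ∞)`. -/
abbrev halfLine : Measure ℝ := volume.restrict (Ioi (0 : ℝ))

/-- `φ ∈ C_c^∞(ℝ⁺)`: smooth, with compact support contained in `(0, ∞)`. -/
structure IsTestFunction (φ : ℝ → ℝ) : Prop where
  smooth : ContDiff ℝ ∞ φ
  compact : HasCompactSupport φ
  support : tsupport φ ⊆ Ioi 0

/-- `g` is a weak derivative of `v` on `ℝ⁺`. -/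
structure HasWeakDeriv (v g : ℝ → ℝ) : Prop where
  locInt : LocallyIntegrableOn v (Ioi 0)
  locInt_deriv : LocallyIntegrableOn g (Ioi 0)
  integral_eq : ∀ φ : ℝ → ℝ, IsTestFunction φ →
    ∫ x in Ioi (0 : ℝ), v x * deriv φ x = -∫ x in Ioi (0 : ℝ), g x * φ x

open Classical in
/-- The weak derivative of `v` on `ℝ⁺` (a representative of it; it is unique up to null sets);
`0` if there is none. -/
def weakDeriv (v : ℝ → ℝ) : ℝ → ℝ :=
  if h : ∃ g, HasWeakDeriv v g then h.choose else 0

/-- The space `H̊¹₀(ℝ⁺)`, the completion of `C_c^∞(ℝ⁺)` in the norm `(∫₀^∞ |u'|²)^{1/2}`, realized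
as a space of functions on `[0, ∞)`: a Cauchy sequence `φ n` for this norm (that is, one whose
derivatives converge in `L²(ℝ⁺)`, to some `g`) is identified with its pointwise limit. -/
def MemHomSobolevZero (v : ℝ → ℝ) : Prop :=
  ∃ (φ : ℕ → ℝ → ℝ) (g : ℝ → ℝ), (∀ n, IsTestFunction (φ n)) ∧ MemLp g 2 halfLine ∧
    Tendsto (fun n => eLpNorm (fun x => deriv (φ n) x - g x) 2 halfLine) atTop (𝓝 0) ∧
    ∀ x, 0 ≤ x → Tendsto (fun n => φ n x) atTop (𝓝 (v x))

/-- The admissible class `𝒜`: continuous functions `θ` on `[0, ∞)` with `θ - β ∈ H̊¹₀(ℝ⁺)`.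
(Values of `θ` on `(-∞, 0)` are irrelevant everywhere.) -/
def Admissible (β : ℝ) (θ : ℝ → ℝ) : Prop :=
  ContinuousOn θ (Ici 0) ∧ MemHomSobolevZero (fun x => θ x - β)

/-- Smooth cutoff functions `η_β : ℝ → [0, β]`. -/
structure IsCutoff (β : ℝ) (η : ℝ → ℝ) : Prop where
  smooth : ContDiff ℝ ∞ η
  mem_Icc : ∀ x, η x ∈ Icc 0 β
  eq_left : ∀ x, x ≤ 0 → η x = β
  eq_right : ∀ x, 1 ≤ x → η x = 0
  deriv_nonpos : ∀ x, deriv η x ≤ 0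

/-- The Lebesgue integral over `ℝ⁺` with values in `[-∞, ∞]` (positive part minus negative part),
meaningful for functions whose negative part is integrable. -/
def extIntegral (f : ℝ → ℝ) : EReal :=
  ((∫⁻ x in Ioi (0 : ℝ), ENNReal.ofReal (f x) : ℝ≥0∞) : EReal) -
    ((∫⁻ x in Ioi (0 : ℝ), ENNReal.ofReal (-f x) : ℝ≥0∞) : EReal)

/-- The local part of the energy. -/
def localEnergy (β ν : ℝ) (η θ : ℝ → ℝ) : EReal :=
  extIntegral fun x =>
    1 / 2 * (weakDeriv θ x) ^ 2 + 1 / 2 * Real.sin (θ x) ^ 2 +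
      ν / (4 * Real.pi) * ((Real.sin (θ x - β) ^ 2 - Real.sin (η x - β) ^ 2) / x)

/-- The double integral over `ℝ⁺ × ℝ⁺` of
`(sin (θ(x) - β) - sin (θ(y) - β))² / (x - y)²`. -/
def nonlocalEnergy (β : ℝ) (θ : ℝ → ℝ) : ℝ≥0∞ :=
  ∫⁻ x in Ioi (0 : ℝ), ∫⁻ y in Ioi (0 : ℝ),
    ENNReal.ofReal ((Real.sin (θ x - β) - Real.sin (θ y - β)) ^ 2 / (x - y) ^ 2)

/-- The renormalized energy `E_β(θ) ∈ (-∞, ∞]`, for the cutoff `η`. -/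
def energy (β ν : ℝ) (η θ : ℝ → ℝ) : EReal :=
  localEnergy β ν η θ
    + ((ENNReal.ofReal (ν / (8 * Real.pi)) * nonlocalEnergy β θ : ℝ≥0∞) : EReal)
    - ((ENNReal.ofReal (ν / (8 * Real.pi)) * nonlocalEnergy β η : ℝ≥0∞) : EReal)

/-- `θ` minimizes the renormalized energy over the admissible class. -/
def IsMinimizer (β ν : ℝ) (η θ : ℝ → ℝ) : Prop :=
  Admissible β θ ∧ ∀ θ' : ℝ → ℝ, Admissible β θ' → energy β ν η θ ≤ energy β ν η θ'

/-- `v ∈ W^{1,∞}(ℝ⁺)`. -/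
def MemW1Infty (v : ℝ → ℝ) : Prop :=
  MemLp v ∞ halfLine ∧ ∃ g, HasWeakDeriv v g ∧ MemLp g ∞ halfLine

/-- The principal value integral over `(0, ∞)` of `f`, singular at `x`, exists and equals `I`. -/
def HasPrincipalValue (f : ℝ → ℝ) (x I : ℝ) : Prop :=
  (∀ ε, 0 < ε → IntegrableOn f {y | 0 < y ∧ ε < |y - x|}) ∧
    Tendsto (fun ε => ∫ y in {y | 0 < y ∧ ε < |y - x|}, f y) (𝓝[>] 0) (𝓝 I)

end

end EdgeWall

/-! Write θ = β + a with a(0) = 0 and a' = g in L², put u = sin a, extend u by zero to x ≤ 0, and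
let κ = ν/(2π). Since ∫_{y<0} (x-y)⁻² dy = 1/x, the weight 1/x in the energy is exactly the
interaction of the half-line with the region where u vanishes
(`IsTestPair.integral_bilinKernel_eq_add`). The first variation therefore becomes, in weak form, the
translation-invariant equation θ'' = sin θ cos θ + κ cos(a) Λu, where Λu(x) = ∫_0^∞ (2u(x) - u(x+z)
- u(x-z)) z⁻² dz (`IsProfile.weak_secondDiff`). The principal value of the theorem is Λu - u/x,
which restores the 1/x term.

Regularity. At first u is only Hölder of exponent 1/2, too little for Λu to converge. The part z ≤ 1
of Λ is applied instead to a primitive of u, one derivative being thrown on the test function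
(`IsTestPair.near_add_far`). The du Bois-Reymond lemma then writes g as a continuous function plus a
primitive. Together with g ∈ L² this bounds g, so u is Lipschitz, and a second pass makes g Hölder
of exponent 1/2 up to the edge (`IsProfile.exists_isRegularProfile`). Now Λu(x) converges for x > 0
with a bound O(x^(-1/2)) near 0, and the equation holds pointwise
(`IsRegularProfile.deriv_eq_primitive`, `IsRegularProfile.hasDerivAt_deriv`).

Slope at the edge. Multiplying by 2θ' and integrating over (0, b) gives [θ'² - sin² θ]_0^b = 2κ
∫_0^b u' Λu. The pairing of u' with Λu is antisymmetric under translation, so only a contribution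
across the point b survives. Hilbert's inequality bounds it by the L² norm of u' and its tail beyond
b, and it tends to 0 (`IsHolderEdge.tendsto_pairing`). As θ' and sin θ vanish at infinity, θ'(0)² =
sin² β.

Blow-up. The extended u has a corner at 0 of slope u'(0) = θ'(0) ≠ 0, whence Λu(x) = u'(0) log x +
O(1) (`IsHolderEdge.abs_nonlocalOp_sub_log_le`). The other term of the equation is bounded, so |θ''|
tends to infinity. -/

namespace EdgeWall

/-! ### Calculus of absolutely continuous functions on the line -/

/-- `f` is a primitive of the locally integrable function `f'` on `ℝ`. -/
structure IsPrim (f f' : ℝ → ℝ) : Prop where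
  locInt : LocallyIntegrable f'
  eq : ∀ x y, f y - f x = ∫ t in x..y, f' t

namespace IsPrim

variable {f f' g g' : ℝ → ℝ}

lemma intervalIntegrable_of_locallyIntegrable (h : LocallyIntegrable f') (x y : ℝ) :
    IntervalIntegrable f' volume x y :=
  (h.integrableOn_isCompact isCompact_uIcc).intervalIntegrable

lemma ii (h : IsPrim f f') (x y : ℝ) : IntervalIntegrable f' volume x y :=
  intervalIntegrable_of_locallyIntegrable h.locInt x y

lemma eq_add (h : IsPrim f f') (x : ℝ) : f = fun y => f x + ∫ t in x..y, f' t := by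
  ext y; rw [← h.eq x y]; ring

lemma ae_hasDerivAt (h : IsPrim f f') : ∀ᵐ x, HasDerivAt f (f' x) x := by
  filter_upwards [_root_.LocallyIntegrable.ae_hasDerivAt_integral h.locInt] with x hx
  rw [h.eq_add 0]
  exact (hx 0).const_add _

lemma continuous (h : IsPrim f f') : Continuous f := by
  rw [h.eq_add 0]
  exact continuous_const.add (intervalIntegral.continuous_primitive h.ii 0)

lemma ac (h : IsPrim f f') (x y : ℝ) : AbsolutelyContinuousOnInterval f x y := by
  rw [h.eq_add x]
  have h1 := (h.ii x y).absolutelyContinuousOnInterval_intervalIntegral (c := x) (by simp)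
  have h2 : AbsolutelyContinuousOnInterval (fun _ : ℝ => f x) x y :=
    LipschitzOnWith.absolutelyContinuousOnInterval (K := 0) (LipschitzWith.const (f x)).lipschitzOnWith
  exact h2.add h1

/-- The difference between `f` and the integral of `f'` is absolutely continuous with zero
derivative almost everywhere, hence constant. All product and chain rules below are reduced to this
criterion. -/
lemma of_ac (hf : ∀ x y, AbsolutelyContinuousOnInterval f x y) (h' : LocallyIntegrable f')
    (hd : ∀ᵐ x, HasDerivAt f (f' x) x) : IsPrim f f' := by
  refine ⟨h', fun x y => ?_⟩
  have h1 := (intervalIntegrable_of_locallyIntegrable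
    h' x y).absolutelyContinuousOnInterval_intervalIntegral (c := x) (by simp)
  have h2 : ∀ᵐ z, z ∈ uIcc x y → HasDerivAt (fun z => f z - ∫ t in x..z, f' t) 0 z := by
    filter_upwards [hd, _root_.LocallyIntegrable.ae_hasDerivAt_integral h'] with z hz hz' _
    have h3 := hz.sub (hz' x)
    rw [sub_self] at h3
    exact h3
  obtain ⟨C, hC⟩ := ((hf x y).sub h1).const_of_ae_hasDerivAt_zero h2
  have e1 := hC x (by simp)
  have e2 := hC y (by simp)
  simp at e1 e2
  linarith

lemma of_hasDerivAt (hd : ∀ x, HasDerivAt f (f' x) x) (hc : Continuous f') : IsPrim f f' :=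
  ⟨hc.locallyIntegrable, fun _ _ => (intervalIntegral.integral_eq_sub_of_hasDerivAt
    (fun z _ => hd z) (hc.intervalIntegrable _ _)).symm⟩

lemma mul (hf : IsPrim f f') (hg : IsPrim g g') :
    IsPrim (fun x => f x * g x) (fun x => f' x * g x + f x * g' x) := by
  refine of_ac (fun x y => (hf.ac x y).mul (hg.ac x y)) ?_ ?_
  · exact (LocallyIntegrable.mul_continuous hg.continuous hf.locInt).add
      (LocallyIntegrable.continuous_mul hf.continuous hg.locInt)
  · filter_upwards [hf.ae_hasDerivAt, hg.ae_hasDerivAt] with x h1 h2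
    exact h1.mul h2

/-- Absolute continuity only involves increments, so it passes to anything with smaller increments;
it is applied to the 1-Lipschitz compositions with sine and cosine. -/
lemma ac_of_dist_le (hf : IsPrim f f') (hg : ∀ x y, dist (g x) (g y) ≤ dist (f x) (f y))
    (x y : ℝ) : AbsolutelyContinuousOnInterval g x y := by
  rw [absolutelyContinuousOnInterval_iff]
  intro ε hε
  obtain ⟨δ, hδ, h⟩ := (absolutelyContinuousOnInterval_iff f x y).1 (hf.ac x y) ε hε
  exact ⟨δ, hδ, fun E hE hd => lt_of_le_of_lt (Finset.sum_le_sum fun i _ => hg _ _) (h E hE hd)⟩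

lemma sin (hf : IsPrim f f') :
    IsPrim (fun x => Real.sin (f x)) (fun x => Real.cos (f x) * f' x) := by
  refine of_ac (hf.ac_of_dist_le fun _ _ => ?_) ?_ ?_
  · simpa [Real.dist_eq] using Real.abs_sin_sub_sin_le _ _
  · exact LocallyIntegrable.continuous_mul (Real.continuous_cos.comp hf.continuous) hf.locInt
  · filter_upwards [hf.ae_hasDerivAt] with x h1 using h1.sin

lemma cos (hf : IsPrim f f') :
    IsPrim (fun x => Real.cos (f x)) (fun x => -Real.sin (f x) * f' x) := by
  refine of_ac (hf.ac_of_dist_le fun _ _ => ?_) ?_ ?_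
  · simpa [Real.dist_eq] using Real.abs_cos_sub_cos_le _ _
  · exact LocallyIntegrable.continuous_mul
      (Real.continuous_sin.neg.comp hf.continuous) hf.locInt
  · filter_upwards [hf.ae_hasDerivAt] with x h1 using h1.cos

lemma congr_deriv (hf : IsPrim f f') (h : f' =ᵐ[volume] g') : IsPrim f g' := by
  refine ⟨?_, fun x y => ?_⟩
  · exact hf.locInt.mono (hf.locInt.aestronglyMeasurable.congr h)
      (by filter_upwards [h] with x hx; rw [hx])
  · rw [hf.eq]
    exact intervalIntegral.integral_congr_ae (by filter_upwards [h] with x hx _ using hx)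

/-- A function with compact support has an almost everywhere vanishing derivative elsewhere. -/
lemma ae_deriv_eq_zero {s : Set ℝ} (hf : IsPrim f f') (hs : IsOpen s) (h0 : ∀ x ∈ s, f x = 0) :
    ∀ᵐ x, x ∈ s → f' x = 0 := by
  filter_upwards [hf.ae_hasDerivAt] with x hx hxs
  have : HasDerivAt f 0 x :=
    (hasDerivAt_const x (0 : ℝ)).congr_of_eventuallyEq
      (by filter_upwards [hs.mem_nhds hxs] with y hy using h0 y hy)
  exact hx.unique this

lemma integral_mul_deriv (hf : IsPrim f f') (hg : IsPrim g g') {A B : ℝ} (hAB : A ≤ B)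
    (h0 : ∀ x, x ∉ Icc A B → f x = 0) :
    ∫ x, f x * g' x = -∫ x, f' x * g x := by
  -- The hypothesis says nothing at the endpoints themselves; continuity from outside supplies the
  -- zero boundary values.
  have hA : f A = 0 := by
    have : Tendsto f (𝓝[<] A) (𝓝 (f A)) := hf.continuous.continuousAt.mono_left nhdsWithin_le_nhds
    refine tendsto_nhds_unique this (tendsto_const_nhds.congr' ?_)
    filter_upwards [self_mem_nhdsWithin] with x hx
    exact (h0 x (fun h => absurd h.1 (not_le.2 hx))).symm
  have hB : f B = 0 := by
    have : Tendsto f (𝓝[>] B) (𝓝 (f B)) := hf.continuous.continuousAt.mono_left nhdsWithin_le_nhds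
    refine tendsto_nhds_unique this (tendsto_const_nhds.congr' ?_)
    filter_upwards [self_mem_nhdsWithin] with x hx
    exact (h0 x (fun h => absurd h.2 (not_le.2 hx))).symm
  have h1 : ∫ x, f x * g' x = ∫ x in A..B, f x * g' x := by
    rw [intervalIntegral.integral_of_le hAB, ← integral_Icc_eq_integral_Ioc,
      setIntegral_eq_integral_of_forall_compl_eq_zero]
    intro x hx; rw [h0 x hx, zero_mul]
  have hz := hf.ae_deriv_eq_zero isClosed_Icc.isOpen_compl h0
  have h2 : ∫ x, f' x * g x = ∫ x in A..B, f' x * g x := by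
    rw [intervalIntegral.integral_of_le hAB, ← integral_Icc_eq_integral_Ioc,
      setIntegral_eq_integral_of_ae_compl_eq_zero]
    filter_upwards [hz] with x hx hx'
    rw [hx hx', zero_mul]
  have h3 := (hf.mul hg).eq A B
  rw [intervalIntegral.integral_add] at h3
  · rw [h1, h2]; simp only [hA, hB] at h3; linarith
  · exact (hf.ii A B).mul_continuousOn hg.continuous.continuousOn
  · exact (hg.ii A B).continuousOn_mul hf.continuous.continuousOn

end IsPrim

/-- Cauchy-Schwarz inequality for the integral over an interval. -/
lemma sq_intervalIntegral_le {g : ℝ → ℝ} {x y : ℝ} (hxy : x ≤ y)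
    (hg : IntervalIntegrable g volume x y)
    (hg2 : IntervalIntegrable (fun t => g t ^ 2) volume x y) :
    (∫ t in x..y, g t) ^ 2 ≤ (y - x) * ∫ t in x..y, g t ^ 2 := by
  rcases hxy.eq_or_lt with rfl | hlt
  · simp
  set I := ∫ t in x..y, g t
  have h0 : 0 ≤ ∫ t in x..y, ((y - x) ^ 2 * g t ^ 2 - (2 * (y - x) * I) * g t + I ^ 2) := by
    refine intervalIntegral.integral_nonneg hxy fun t _ => ?_
    nlinarith [sq_nonneg ((y - x) * g t - I)]
  rw [intervalIntegral.integral_add ((hg2.const_mul _).sub (hg.const_mul _)) (by simp),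
    intervalIntegral.integral_sub (hg2.const_mul _) (hg.const_mul _),
    intervalIntegral.integral_const_mul, intervalIntegral.integral_const_mul,
    intervalIntegral.integral_const, smul_eq_mul] at h0
  change 0 ≤ (y - x) ^ 2 * (∫ t in x..y, g t ^ 2) - 2 * (y - x) * I * I + (y - x) * I ^ 2 at h0
  have h1 : 0 < y - x := sub_pos.2 hlt
  have h2 : 0 ≤ (y - x) * ((y - x) * (∫ t in x..y, g t ^ 2) - I ^ 2) := by nlinarith
  nlinarith [nonneg_of_mul_nonneg_right h2 h1]

lemma locallyIntegrable_of_memLp_two {g : ℝ → ℝ} (hg : MemLp g 2 volume) : LocallyIntegrable g :=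
  hg.locallyIntegrable (by norm_num)

/-- A primitive of an `L²` function is Hölder continuous with exponent `1/2`. -/
lemma IsPrim.abs_sub_le_sqrt {f g : ℝ → ℝ} (h : IsPrim f g) (hg : MemLp g 2 volume) (x y : ℝ) :
    |f x - f y| ≤ √(∫ t, g t ^ 2) * √|x - y| := by
  wlog hxy : y ≤ x generalizing x y
  · rw [abs_sub_comm, abs_sub_comm x]; exact this y x (le_of_not_ge hxy)
  rw [← Real.sqrt_mul (integral_nonneg fun t => sq_nonneg _), ← Real.sqrt_sq_eq_abs, h.eq y x]
  refine Real.sqrt_le_sqrt ?_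
  have h2 := hg.integrable_sq
  refine (sq_intervalIntegral_le hxy (h.ii y x) h2.intervalIntegrable).trans ?_
  rw [abs_of_nonneg (sub_nonneg.2 hxy), mul_comm]
  refine mul_le_mul_of_nonneg_right ?_ (sub_nonneg.2 hxy)
  rw [intervalIntegral.integral_of_le hxy]
  exact setIntegral_le_integral h2 (Eventually.of_forall fun t => sq_nonneg _)

/-! ### Test functions, weak derivatives and the du Bois-Reymond lemma -/

namespace IsTestFunction

variable {φ ψ : ℝ → ℝ}

lemma exists_Icc (h : IsTestFunction φ) :
    ∃ A B, 0 < A ∧ A ≤ B ∧ ∀ x, x ∉ Icc A B → φ x = 0 := by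
  rcases (tsupport φ).eq_empty_or_nonempty with he | hne
  · exact ⟨1, 1, one_pos, le_rfl, fun x _ => image_eq_zero_of_notMem_tsupport (by simp [he])⟩
  obtain ⟨A, hA, hA'⟩ := h.compact.isCompact.exists_isLeast hne
  obtain ⟨B, hB, hB'⟩ := h.compact.isCompact.exists_isGreatest hne
  refine ⟨A, B, h.support hA, hA' hB, fun x hx => image_eq_zero_of_notMem_tsupport fun hx' => ?_⟩
  exact hx ⟨hA' hx', hB' hx'⟩

lemma eq_zero (h : IsTestFunction φ) {x : ℝ} (hx : x ≤ 0) : φ x = 0 :=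
  image_eq_zero_of_notMem_tsupport fun hx' => absurd (h.support hx') (not_lt.2 hx)

lemma deriv_eq_zero (h : IsTestFunction φ) {x : ℝ} (hx : x ≤ 0) : deriv φ x = 0 :=
  image_eq_zero_of_notMem_tsupport fun hx' =>
    absurd (h.support (tsupport_deriv_subset hx')) (not_lt.2 hx)

lemma continuous (h : IsTestFunction φ) : Continuous φ := h.smooth.continuous

lemma continuous_deriv (h : IsTestFunction φ) : Continuous (deriv φ) :=
  h.smooth.continuous_deriv (by simp)

lemma hasDerivAt (h : IsTestFunction φ) (x : ℝ) : HasDerivAt φ (deriv φ x) x :=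
  (h.smooth.differentiable (by simp) x).hasDerivAt

lemma isPrim (h : IsTestFunction φ) : IsPrim φ (deriv φ) :=
  IsPrim.of_hasDerivAt h.hasDerivAt h.continuous_deriv

lemma of_Icc (hs : ContDiff ℝ ∞ φ) {A B : ℝ} (hA : 0 < A) (h0 : ∀ x, x ∉ Icc A B → φ x = 0) :
    IsTestFunction φ := by
  have h1 : tsupport φ ⊆ Icc A B := closure_minimal
    (fun x hx => by by_contra h; exact hx (h0 x h)) isClosed_Icc
  exact ⟨hs, isCompact_Icc.of_isClosed_subset (isClosed_tsupport φ) h1,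
    h1.trans fun x hx => lt_of_lt_of_le hA hx.1⟩

lemma setIntegral_mul (h : IsTestFunction φ) (f : ℝ → ℝ) :
    ∫ x in Ioi (0 : ℝ), f x * φ x = ∫ x, f x * φ x :=
  setIntegral_eq_integral_of_forall_compl_eq_zero fun x hx => by
    rw [h.eq_zero (not_lt.1 hx), mul_zero]

lemma setIntegral_mul_deriv (h : IsTestFunction φ) (f : ℝ → ℝ) :
    ∫ x in Ioi (0 : ℝ), f x * deriv φ x = ∫ x, f x * deriv φ x :=
  setIntegral_eq_integral_of_forall_compl_eq_zero fun x hx => by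
    rw [h.deriv_eq_zero (not_lt.1 hx), mul_zero]

lemma integrable_mul (h : IsTestFunction φ) {f : ℝ → ℝ} (hf : LocallyIntegrableOn f (Ioi 0)) :
    Integrable fun x => f x * φ x := by
  obtain ⟨A, B, hA, _, h0⟩ := h.exists_Icc
  have h1 : IntegrableOn f (Icc A B) :=
    hf.integrableOn_compact_subset (fun x hx => lt_of_lt_of_le hA hx.1) isCompact_Icc
  have h2 := h1.mul_continuousOn h.continuous.continuousOn isCompact_Icc
  exact h2.integrable_of_forall_notMem_eq_zero fun x hx => by rw [h0 x hx, mul_zero]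

/-- A test function of total integral zero is the derivative of a test function: its primitive from
the left vanishes on both sides of the support. Subtracting a multiple of a fixed ψ arranges the
zero integral. -/
lemma sub_const_mul (h : IsTestFunction φ) (h' : IsTestFunction ψ) (m : ℝ)
    (hm : ∫ x, φ x = m * ∫ x, ψ x) :
    ∃ χ, IsTestFunction χ ∧ ∀ x, deriv χ x = φ x - m * ψ x := by
  obtain ⟨A, B, hA, hAB, h0⟩ := h.exists_Icc
  obtain ⟨A', B', hA', hAB', h0'⟩ := h'.exists_Icc
  set f : ℝ → ℝ := fun x => φ x - m * ψ x with hf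
  have hfs : ContDiff ℝ ∞ f := h.smooth.sub (contDiff_const.mul h'.smooth)
  set C := min A A'
  set D := max B B'
  have hCD : C ≤ D := (min_le_left _ _).trans (hAB.trans (le_max_left _ _))
  have hf0 : ∀ x, x ∉ Icc C D → f x = 0 := by
    intro x hx
    have h1 : x ∉ Icc A B := fun hx' => hx ⟨(min_le_left _ _).trans hx'.1,
      hx'.2.trans (le_max_left _ _)⟩
    have h2 : x ∉ Icc A' B' := fun hx' => hx ⟨(min_le_right _ _).trans hx'.1,
      hx'.2.trans (le_max_right _ _)⟩
    simp [hf, h0 x h1, h0' x h2]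
  set χ : ℝ → ℝ := fun x => ∫ t in C..x, f t with hχ
  have hd : ∀ x, HasDerivAt χ (f x) x := fun x =>
    intervalIntegral.integral_hasDerivAt_right (hfs.continuous.intervalIntegrable _ _)
      (hfs.continuous.stronglyMeasurableAtFilter _ _) hfs.continuous.continuousAt
  have hd' : deriv χ = f := funext fun x => (hd x).deriv
  have htot : ∫ x, f x = 0 := by
    have i1 : Integrable φ := h.continuous.integrable_of_hasCompactSupport h.compact
    have i2 : Integrable ψ := h'.continuous.integrable_of_hasCompactSupport h'.compact
    rw [hf, integral_sub i1 (i2.const_mul m), integral_const_mul, hm, sub_self]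
  refine ⟨χ, of_Icc (A := C) (B := D) ?_ (lt_min hA hA') ?_, fun x => (hd x).deriv⟩
  · refine contDiff_infty_iff_deriv.2 ⟨fun x => (hd x).differentiableAt, ?_⟩
    rw [hd']; exact hfs
  · intro x hx
    rcases lt_or_ge x C with hlt | hge
    · rw [hχ]
      refine intervalIntegral.integral_zero_ae (Eventually.of_forall fun t ht => ?_)
      rw [uIoc_comm, uIoc_of_le hlt.le] at ht
      -- The endpoint C belongs to the half-open interval of integration; there f vanishes by
      -- continuity from the left.
      rcases ht.2.eq_or_lt with rfl | hlt'
      · have hc : Tendsto f (𝓝[<] C) (𝓝 (f C)) :=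
          hfs.continuous.continuousAt.mono_left nhdsWithin_le_nhds
        refine tendsto_nhds_unique hc (tendsto_const_nhds.congr' ?_)
        filter_upwards [self_mem_nhdsWithin] with s hs
        exact (hf0 s fun h => absurd h.1 (not_le.2 hs)).symm
      · exact hf0 t fun h => absurd h.1 (not_le.2 hlt')
    · have hgt : D < x := by by_contra hle; exact hx ⟨hge, not_lt.1 hle⟩
      have : χ x = ∫ t, f t := by
        rw [hχ]; simp only
        rw [intervalIntegral.integral_of_le hge, ← integral_Icc_eq_integral_Ioc,
          setIntegral_eq_integral_of_forall_compl_eq_zero]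
        intro t ht
        exact hf0 t fun h => ht ⟨h.1, h.2.trans hgt.le⟩
      rw [this, htot]

end IsTestFunction

lemma exists_isTestFunction_integral_eq_one : ∃ ψ, IsTestFunction ψ ∧ ∫ x, ψ x = 1 := by
  let b : ContDiffBump (2 : ℝ) := ⟨1 / 2, 1, by norm_num, by norm_num⟩
  refine ⟨b.normed volume, IsTestFunction.of_Icc (A := 1) (B := 3) b.contDiff_normed one_pos ?_,
    b.integral_normed⟩
  intro x hx
  have : x ∉ Function.support (b.normed volume) := by
    rw [b.support_normed_eq, Metric.mem_ball, Real.dist_eq]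
    intro h
    rw [abs_lt] at h
    have h1 : b.rOut = 1 := rfl
    rw [h1] at h
    exact hx ⟨by linarith, by linarith⟩
  simpa using this

lemma eq_zero_of_integral_mul_test {f : ℝ → ℝ} (hf : LocallyIntegrableOn f (Ioi 0))
    (h : ∀ φ, IsTestFunction φ → ∫ x, f x * φ x = 0) : f =ᵐ[halfLine] 0 := by
  have h1 := isOpen_Ioi.ae_eq_zero_of_integral_contDiff_smul_eq_zero hf fun φ h1 h2 h3 => by
    rw [← h φ ⟨h1, h2, h3⟩]
    exact integral_congr_ae (Eventually.of_forall fun x => by simp [mul_comm])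
  exact (ae_restrict_iff' measurableSet_Ioi).2 h1

/-- The du Bois-Reymond lemma on the half-line. -/
lemma duBoisReymond {f r : ℝ → ℝ} (hf : LocallyIntegrable f) (hr : LocallyIntegrable r)
    (h : ∀ φ, IsTestFunction φ → (∫ x, f x * deriv φ x) + ∫ x, r x * φ x = 0) :
    ∃ C, f =ᵐ[halfLine] fun x => C + ∫ t in (0 : ℝ)..x, r t := by
  set R : ℝ → ℝ := fun x => ∫ t in (0 : ℝ)..x, r t with hR
  have hRr : IsPrim R r := ⟨hr, fun x y => by
    rw [hR]
    exact intervalIntegral.integral_interval_sub_left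
      (IsPrim.intervalIntegrable_of_locallyIntegrable hr _ _)
      (IsPrim.intervalIntegrable_of_locallyIntegrable hr _ _)⟩
  obtain ⟨ψ, hψ, hψ1⟩ := exists_isTestFunction_integral_eq_one
  have hloc : LocallyIntegrable (fun x => f x - R x) :=
    hf.sub hRr.continuous.locallyIntegrable
  -- Moving r onto φ' by parts turns the hypothesis into orthogonality of f - R to all derivatives
  -- of test functions.
  have key : ∀ φ, IsTestFunction φ → ∫ x, (f x - R x) * deriv φ x = 0 := by
    intro φ hφ
    obtain ⟨A, B, _, hAB, h0⟩ := hφ.exists_Icc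
    have h1 := hφ.isPrim.integral_mul_deriv hRr hAB h0
    have h2 := h φ hφ
    have c1 : HasCompactSupport (deriv φ) := hφ.compact.deriv
    have i1 : Integrable fun x => f x * deriv φ x := by
      simpa using hf.integrable_smul_right_of_hasCompactSupport hφ.continuous_deriv c1
    have i2 : Integrable fun x => R x * deriv φ x :=
      (hRr.continuous.mul hφ.continuous_deriv).integrable_of_hasCompactSupport c1.mul_left
    simp only [sub_mul]
    rw [integral_sub i1 i2]
    have e1 : ∫ x, φ x * r x = ∫ x, r x * φ x := by simp only [mul_comm]
    have e2 : ∫ x, deriv φ x * R x = ∫ x, R x * deriv φ x := by simp only [mul_comm]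
    linarith
  -- Since ψ has mass one, this is the only value the constant can take.
  set C := ∫ x, (f x - R x) * ψ x
  have hz : (fun x => f x - R x - C) =ᵐ[halfLine] 0 := by
    refine eq_zero_of_integral_mul_test ?_ fun φ hφ => ?_
    · exact (hloc.sub (locallyIntegrable_const C)).locallyIntegrableOn _
    obtain ⟨χ, hχ, hχd⟩ := hφ.sub_const_mul hψ (∫ x, φ x) (by rw [hψ1, mul_one])
    have h1 := key χ hχ
    simp only [hχd, mul_sub] at h1
    have i1 := hφ.integrable_mul (hloc.locallyIntegrableOn (Ioi 0))
    have i2 := hψ.integrable_mul (hloc.locallyIntegrableOn (Ioi 0))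
    have i3 : Integrable φ := hφ.continuous.integrable_of_hasCompactSupport hφ.compact
    have e : ∀ x, (f x - R x) * ((∫ x, φ x) * ψ x) = (∫ x, φ x) * ((f x - R x) * ψ x) :=
      fun x => by ring
    simp only [e] at h1
    rw [integral_sub i1 (i2.const_mul _), integral_const_mul] at h1
    simp only [sub_mul _ C]
    rw [integral_sub i1 (i3.const_mul _), integral_const_mul]
    linarith
  refine ⟨C, ?_⟩
  filter_upwards [hz] with x hx
  simp only [Pi.zero_apply] at hx
  linarith

lemma HasWeakDeriv.ae_eq {v g₁ g₂ : ℝ → ℝ} (h₁ : HasWeakDeriv v g₁) (h₂ : HasWeakDeriv v g₂) :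
    g₁ =ᵐ[halfLine] g₂ := by
  have h : (fun x => g₁ x - g₂ x) =ᵐ[halfLine] 0 := by
    refine eq_zero_of_integral_mul_test (h₁.locInt_deriv.sub h₂.locInt_deriv) fun φ hφ => ?_
    simp only [sub_mul]
    rw [integral_sub (hφ.integrable_mul h₁.locInt_deriv) (hφ.integrable_mul h₂.locInt_deriv),
      ← hφ.setIntegral_mul, ← hφ.setIntegral_mul]
    linarith [h₁.integral_eq φ hφ, h₂.integral_eq φ hφ]
  filter_upwards [h] with x hx using sub_eq_zero.1 hx

lemma IsPrim.hasWeakDeriv {f g v : ℝ → ℝ} (h : IsPrim f g) (hv : ∀ x, 0 < x → v x = f x) :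
    HasWeakDeriv v g := by
  refine ⟨?_, h.locInt.locallyIntegrableOn _, fun φ hφ => ?_⟩
  · exact (h.continuous.continuousOn.congr fun x hx => hv x hx).locallyIntegrableOn
      measurableSet_Ioi
  · obtain ⟨A, B, _, hAB, h0⟩ := hφ.exists_Icc
    rw [setIntegral_congr_fun measurableSet_Ioi
      (fun x hx => by simp only [hv x hx] : EqOn _ (fun x => f x * deriv φ x) (Ioi 0)),
      hφ.setIntegral_mul_deriv, hφ.setIntegral_mul]
    have h1 := hφ.isPrim.integral_mul_deriv h hAB h0
    have e1 : ∫ x, φ x * g x = ∫ x, g x * φ x := by simp only [mul_comm]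
    have e2 : ∫ x, deriv φ x * f x = ∫ x, f x * deriv φ x := by simp only [mul_comm]
    linarith

lemma HasWeakDeriv.weakDeriv_ae_eq {v g : ℝ → ℝ} (h : HasWeakDeriv v g) :
    weakDeriv v =ᵐ[halfLine] g := by
  have hex : ∃ g, HasWeakDeriv v g := ⟨g, h⟩
  rw [weakDeriv, dif_pos hex]
  exact hex.choose_spec.ae_eq h

/-- Elements of the homogeneous Sobolev space are primitives of `L²` functions. -/
lemma MemHomSobolevZero.exists_isPrim {v : ℝ → ℝ} (h : MemHomSobolevZero v) :
    ∃ a g, IsPrim a g ∧ MemLp g 2 volume ∧ (∀ x, x ≤ 0 → a x = 0) ∧ (∀ x, x ≤ 0 → g x = 0) ∧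
      ∀ x, 0 ≤ x → v x = a x := by
  obtain ⟨φ, g₀, hφ, hg₀, hlim, hv⟩ := h
  -- Extending the derivative by zero yields a primitive on the whole line that vanishes for x ≤ 0;
  -- the nonlocal part relies on this extension.
  set g := (Ioi (0 : ℝ)).indicator g₀ with hg
  have hg2 : MemLp g 2 volume := (memLp_indicator_iff_restrict measurableSet_Ioi).2 hg₀
  have hgl := locallyIntegrable_of_memLp_two hg2
  have hg0 : ∀ x, x ≤ 0 → g x = 0 := fun x hx => indicator_of_notMem (not_lt.2 hx) _
  refine ⟨fun x => ∫ t in (0 : ℝ)..x, g t, g, ⟨hgl, fun x y => ?_⟩, hg2, fun x hx => ?_, hg0,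
    fun x hx => ?_⟩
  · exact intervalIntegral.integral_interval_sub_left
      (IsPrim.intervalIntegrable_of_locallyIntegrable hgl _ _)
      (IsPrim.intervalIntegrable_of_locallyIntegrable hgl _ _)
  · refine intervalIntegral.integral_zero_ae (Eventually.of_forall fun t ht => ?_)
    rw [uIoc_comm, uIoc_of_le hx] at ht
    exact hg0 t ht.2
  · refine tendsto_nhds_unique (hv x hx) ?_
    have e : ∀ n, φ n x = ∫ t in Ioc 0 x, deriv (φ n) t := fun n => by
      rw [← intervalIntegral.integral_of_le hx, ← (hφ n).isPrim.eq 0 x, (hφ n).eq_zero le_rfl,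
        sub_zero]
    have e2 : ∫ t in (0 : ℝ)..x, g t = ∫ t in Ioc 0 x, g₀ t := by
      rw [intervalIntegral.integral_of_le hx]
      exact setIntegral_congr_fun measurableSet_Ioc fun t ht => indicator_of_mem ht.1 _
    simp only [e, e2]
    have hsub : Ioc 0 x ⊆ Ioi (0 : ℝ) := fun t ht => ht.1
    have hr : volume.restrict (Ioc 0 x) ≤ halfLine := Measure.restrict_mono hsub le_rfl
    have i0 : Integrable g₀ (volume.restrict (Ioc 0 x)) :=
      (hg₀.mono_measure hr).integrable (by norm_num)
    refine tendsto_integral_of_L1' g₀ i0.aestronglyMeasurable (Eventually.of_forall fun n =>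
      ((hφ n).continuous_deriv.integrableOn_Icc.mono_set Ioc_subset_Icc_self)) ?_
    -- On the bounded interval (0, x] convergence in L² implies convergence in L¹, at the cost of a
    -- factor √x.
    have hb : ∀ n, eLpNorm (deriv (φ n) - g₀) 1 (volume.restrict (Ioc 0 x)) ≤
        eLpNorm (fun t => deriv (φ n) t - g₀ t) 2 halfLine * ENNReal.ofReal x ^ (1 / 2 : ℝ) := by
      intro n
      have hm : AEStronglyMeasurable (deriv (φ n) - g₀) (volume.restrict (Ioc 0 x)) :=
        (hφ n).continuous_deriv.aestronglyMeasurable.sub i0.aestronglyMeasurable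
      refine (eLpNorm_le_eLpNorm_mul_rpow_measure_univ (p := 1) (q := 2) (by norm_num) hm).trans ?_
      refine mul_le_mul' (eLpNorm_mono_measure _ hr) (le_of_eq ?_)
      simp
      norm_num
    refine tendsto_of_tendsto_of_tendsto_of_le_of_le tendsto_const_nhds ?_ (fun _ => zero_le) hb
    have := ENNReal.Tendsto.mul_const (b := ENNReal.ofReal x ^ (1 / 2 : ℝ)) hlim
      (Or.inr (ENNReal.rpow_ne_top_of_nonneg (by norm_num) ENNReal.ofReal_ne_top))
    simpa using this

/-! ### The energy as a real number, and a competitor of finite energy -/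

/-- The integrand of the Gagliardo seminorm of order `1/2`. -/
noncomputable def quadKernel (u : ℝ → ℝ) (p : ℝ × ℝ) : ℝ := (u p.1 - u p.2) ^ 2 / (p.1 - p.2) ^ 2

lemma quadKernel_nonneg (u : ℝ → ℝ) (p : ℝ × ℝ) : 0 ≤ quadKernel u p := by
  unfold quadKernel; positivity

lemma measurable_quadKernel {u : ℝ → ℝ} (hu : Continuous u) : Measurable (quadKernel u) := by
  unfold quadKernel
  have := hu.measurable
  fun_prop

/-- The density of the local part of the energy of `β + a`, where `a' = g`. -/
noncomputable def locDensity (β ν : ℝ) (η a g : ℝ → ℝ) (x : ℝ) : ℝ :=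
  1 / 2 * g x ^ 2 + 1 / 2 * Real.sin (a x + β) ^ 2 +
    ν / (4 * Real.pi) * ((Real.sin (a x) ^ 2 - Real.sin (η x - β) ^ 2) / x)

/-- Convolution integrands serve as majorants for the double integrals away from the diagonal: one
factor localizes a point, the other decays in the distance. -/
lemma integrable_mul_comp_sub {f k : ℝ → ℝ} (hf : Integrable f) (hk : Integrable k) :
    Integrable (fun p : ℝ × ℝ => f p.2 * k (p.1 - p.2)) (volume.prod volume) := by
  simpa using hf.convolution_integrand (ContinuousLinearMap.mul ℝ ℝ) hk

lemma integrable_mul_comp_sub' {f k : ℝ → ℝ} (hf : Integrable f) (hk : Integrable k) :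
    Integrable (fun p : ℝ × ℝ => f p.1 * k (p.2 - p.1)) (volume.prod volume) := by
  simpa [Function.comp_def] using (integrable_mul_comp_sub hf hk).swap

lemma halfLine_prod_le : halfLine.prod halfLine ≤ (volume : Measure (ℝ × ℝ)) := by
  rw [halfLine, Measure.prod_restrict]
  exact Measure.restrict_le_self

/-- The kernel is at most min(L², 4/d²) at distance d, hence at most (L²+4)/(1+d²). It vanishes when
both points lie beyond R, so one of the points may be confined to (0, R]. -/
lemma integrable_quadKernel_of_lipschitz {u : ℝ → ℝ} {L R : ℝ} (hu : Continuous u)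
    (hL : ∀ x y, |u x - u y| ≤ L * |x - y|) (hb : ∀ x y, |u x - u y| ≤ 2)
    (hR : ∀ x, R ≤ x → u x = u R) : Integrable (quadKernel u) (halfLine.prod halfLine) := by
  set k : ℝ → ℝ := fun z => (L ^ 2 + 4) * (1 + z ^ 2)⁻¹ with hk
  have hki : Integrable k := integrable_inv_one_add_sq.const_mul _
  set f : ℝ → ℝ := (Ioc 0 R).indicator 1 with hf
  have hfi : Integrable f := by
    rw [hf, integrable_indicator_iff measurableSet_Ioc]
    exact (integrableOn_const (by simp) : IntegrableOn (fun _ => (1 : ℝ)) (Ioc 0 R))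
  have h1 := ((integrable_mul_comp_sub hfi hki).add
    (integrable_mul_comp_sub' hfi hki)).mono_measure halfLine_prod_le
  refine h1.mono' (measurable_quadKernel hu).aestronglyMeasurable ?_
  rw [halfLine, Measure.prod_restrict]
  refine (ae_restrict_iff' (measurableSet_Ioi.prod measurableSet_Ioi)).2
    (Eventually.of_forall fun ⟨x, y⟩ ⟨hx, hy⟩ => ?_)
  simp only [mem_Ioi] at hx hy
  rw [Real.norm_of_nonneg (quadKernel_nonneg _ _)]
  simp only [Pi.add_apply, quadKernel]
  have hfn : ∀ t, 0 ≤ f t := fun t => indicator_nonneg (fun _ _ => by simp) _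
  have hkn : ∀ t, 0 ≤ k t := fun t => by rw [hk]; positivity
  have hmain : (u x - u y) ^ 2 / (x - y) ^ 2 ≤ k (x - y) := by
    rcases eq_or_ne x y with rfl | hne
    · simp only [sub_self]; norm_num; exact hkn 0
    have hd : 0 < (x - y) ^ 2 := by have := sub_ne_zero.2 hne; positivity
    rw [hk]; simp only
    rw [div_le_iff₀ hd, mul_assoc, inv_mul_eq_div, ← mul_div_assoc, le_div_iff₀ (by positivity)]
    have e1 : (u x - u y) ^ 2 ≤ L ^ 2 * (x - y) ^ 2 := by
      rw [← sq_abs, ← sq_abs (x - y), ← mul_pow]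
      exact pow_le_pow_left₀ (abs_nonneg _) (hL x y) 2
    have e2 : (u x - u y) ^ 2 ≤ 4 := by
      rw [← sq_abs]
      nlinarith [hb x y, abs_nonneg (u x - u y)]
    nlinarith
  have hksymm : k (y - x) = k (x - y) := by
    simp only [hk]; congr 3; ring
  rw [hksymm]
  by_cases hxR : x ≤ R
  · have : f x = 1 := by rw [hf, indicator_of_mem (by exact ⟨hx, hxR⟩)]; rfl
    rw [this, one_mul]
    nlinarith [mul_nonneg (hfn y) (hkn (x - y))]
  by_cases hyR : y ≤ R
  · have : f y = 1 := by rw [hf, indicator_of_mem (by exact ⟨hy, hyR⟩)]; rfl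
    rw [this, one_mul]
    nlinarith [mul_nonneg (hfn x) (hkn (x - y))]
  rw [hR x (not_le.1 hxR).le, hR y (not_le.1 hyR).le]
  simp only [sub_self]
  have := mul_nonneg (hfn x) (hkn (x - y))
  have := mul_nonneg (hfn y) (hkn (x - y))
  norm_num
  linarith

lemma nonlocalEnergy_eq {β : ℝ} {θ a : ℝ → ℝ} (ha : Continuous a)
    (hθ : ∀ x, 0 < x → θ x = β + a x) :
    nonlocalEnergy β θ =
      ∫⁻ p, ENNReal.ofReal (quadKernel (fun x => Real.sin (a x)) p) ∂(halfLine.prod halfLine) := by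
  have hm := measurable_quadKernel (Real.continuous_sin.comp ha)
  rw [lintegral_prod _ (by exact hm.ennreal_ofReal.aemeasurable)]
  refine setLIntegral_congr_fun measurableSet_Ioi fun x hx => ?_
  refine setLIntegral_congr_fun measurableSet_Ioi fun y hy => ?_
  simp only [quadKernel, hθ x hx, hθ y hy, add_sub_cancel_left]

lemma localEnergy_eq {β ν : ℝ} {η θ a g : ℝ → ℝ} (ha : IsPrim a g)
    (hθ : ∀ x, 0 < x → θ x = β + a x) :
    localEnergy β ν η θ = extIntegral (locDensity β ν η a g) := by
  have hw : weakDeriv θ =ᵐ[halfLine] g := by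
    have : IsPrim (fun x => β + a x) g :=
      ⟨ha.locInt, fun x y => by rw [← ha.eq]; ring⟩
    exact (this.hasWeakDeriv hθ).weakDeriv_ae_eq
  have he : (fun x => 1 / 2 * (weakDeriv θ x) ^ 2 + 1 / 2 * Real.sin (θ x) ^ 2 +
      ν / (4 * Real.pi) * ((Real.sin (θ x - β) ^ 2 - Real.sin (η x - β) ^ 2) / x))
      =ᵐ[halfLine] locDensity β ν η a g := by
    filter_upwards [hw, ae_restrict_mem measurableSet_Ioi] with x hx hx0
    rw [locDensity, hx, hθ x hx0, add_sub_cancel_left, add_comm β]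
  unfold localEnergy extIntegral
  have e1 := lintegral_congr_ae (he.fun_comp ENNReal.ofReal)
  have e2 := lintegral_congr_ae (he.fun_comp fun t => ENNReal.ofReal (-t))
  exact congrArg₂ (fun s t : ℝ≥0∞ => (s : EReal) - (t : EReal)) e1 e2

lemma extIntegral_eq {f : ℝ → ℝ} (hf : Integrable f halfLine) :
    extIntegral f = ((∫ x in Ioi (0 : ℝ), f x : ℝ) : EReal) := by
  have h1 : ∫⁻ x in Ioi (0 : ℝ), ENNReal.ofReal (f x) ≠ ⊤ := hf.lintegral_lt_top.ne
  have h2 : ∫⁻ x in Ioi (0 : ℝ), ENNReal.ofReal (-f x) ≠ ⊤ := hf.neg.lintegral_lt_top.ne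
  rw [extIntegral, integral_eq_lintegral_pos_part_sub_lintegral_neg_part hf, EReal.coe_sub,
    EReal.coe_ennreal_toReal h1, EReal.coe_ennreal_toReal h2]

lemma integrable_of_extIntegral_ne_top {f : ℝ → ℝ} (hm : AEStronglyMeasurable f halfLine)
    (hneg : ∫⁻ x in Ioi (0 : ℝ), ENNReal.ofReal (-f x) ≠ ⊤) (h : extIntegral f ≠ ⊤) :
    Integrable f halfLine := by
  have hpos : ∫⁻ x in Ioi (0 : ℝ), ENNReal.ofReal (f x) ≠ ⊤ := by
    intro htop
    apply h
    rw [extIntegral, htop, ← EReal.coe_ennreal_toReal hneg, EReal.coe_ennreal_top]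
    exact EReal.top_sub_coe _
  refine ⟨hm, ?_⟩
  rw [hasFiniteIntegral_iff_norm]
  have e : ∀ x, ENNReal.ofReal ‖f x‖ ≤ ENNReal.ofReal (f x) + ENNReal.ofReal (-f x) := by
    intro x
    rcases le_total 0 (f x) with h0 | h0
    · rw [Real.norm_of_nonneg h0]; exact le_self_add
    · rw [Real.norm_of_nonpos h0]; exact le_add_self
  refine (lintegral_mono e).trans_lt ?_
  rw [lintegral_add_left' hm.aemeasurable.ennreal_ofReal]
  exact ENNReal.add_lt_top.2 ⟨hpos.lt_top, hneg.lt_top⟩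

lemma extIntegral_ne_bot {f : ℝ → ℝ} 
    (hneg : ∫⁻ x in Ioi (0 : ℝ), ENNReal.ofReal (-f x) ≠ ⊤) : extIntegral f ≠ ⊥ := by
  rw [extIntegral, ← EReal.coe_ennreal_toReal hneg]
  intro h
  rw [sub_eq_add_neg, EReal.add_eq_bot_iff, ← EReal.coe_neg] at h
  rcases h with h | h
  · simp at h
  · exact EReal.coe_ne_bot _ h

/-- For x ≥ 1 the cutoff is zero, and the numerator over x becomes sin² a - sin² β. The factor
sin(a+β) = sin θ found here lets the anisotropy term sin² θ absorb it. -/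
lemma sin_sq_sub_sin_sq_eq (a β : ℝ) :
    Real.sin a ^ 2 - Real.sin β ^ 2 = Real.sin (a + β) * Real.sin (a - β) := by
  rw [Real.sin_add, Real.sin_sub]
  nlinarith [Real.sin_sq_add_cos_sq a, Real.sin_sq_add_cos_sq β]

namespace IsCutoff

variable {β : ℝ} {η : ℝ → ℝ}

lemma continuous (h : IsCutoff β η) : Continuous η := h.smooth.continuous

lemma continuous_deriv (h : IsCutoff β η) : Continuous (deriv η) :=
  h.smooth.continuous_deriv (by simp)

lemma hasDerivAt (h : IsCutoff β η) (x : ℝ) : HasDerivAt η (deriv η x) x :=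
  (h.smooth.differentiable (by simp) x).hasDerivAt

lemma deriv_eq_zero (h : IsCutoff β η) {x : ℝ} (hx : x ∉ Icc 0 1) : deriv η x = 0 := by
  rcases lt_or_ge x 0 with h0 | h0
  · have : η =ᶠ[𝓝 x] fun _ => β := by
      filter_upwards [Iio_mem_nhds h0] with y hy using h.eq_left y (le_of_lt hy)
    rw [this.deriv_eq, deriv_const]
  · have h1 : 1 < x := by by_contra h1; exact hx ⟨h0, not_lt.1 h1⟩
    have : η =ᶠ[𝓝 x] fun _ => 0 := by
      filter_upwards [Ioi_mem_nhds h1] with y hy using h.eq_right y (le_of_lt hy)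
    rw [this.deriv_eq, deriv_const]

lemma hasCompactSupport_deriv (h : IsCutoff β η) : HasCompactSupport (deriv η) :=
  HasCompactSupport.intro isCompact_Icc fun _ hx => h.deriv_eq_zero hx

lemma exists_lipschitz (h : IsCutoff β η) : ∃ L, 0 ≤ L ∧ ∀ x y, |η x - η y| ≤ L * |x - y| := by
  obtain ⟨L, hL⟩ := h.continuous_deriv.bounded_above_of_compact_support h.hasCompactSupport_deriv
  refine ⟨L, (norm_nonneg _).trans (hL 0), fun x y => ?_⟩
  have := Convex.norm_image_sub_le_of_norm_deriv_le (f := η) (s := univ) (x := y) (y := x)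
    (fun z _ => (h.hasDerivAt z).differentiableAt) (fun z _ => hL z) convex_univ trivial trivial
  simpa [Real.norm_eq_abs] using this

/-- The shift s = 0 is needed for the renormalizing constant, s = 1 for the competitor. -/
lemma integrable_quadKernel (h : IsCutoff β η) (s : ℝ) :
    Integrable (quadKernel fun x => Real.sin (η (x - s) - β)) (halfLine.prod halfLine) := by
  obtain ⟨L, _, hL⟩ := h.exists_lipschitz
  have hc := h.continuous
  refine integrable_quadKernel_of_lipschitz (L := L) (R := 1 + s) (by fun_prop) (fun x y => ?_)
    (fun x y => ?_) (fun x hx => ?_)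
  · refine (Real.abs_sin_sub_sin_le _ _).trans ?_
    simpa using hL (x - s) (y - s)
  · refine (abs_sub _ _).trans ?_
    have h1 := Real.abs_sin_le_one (η (x - s) - β)
    have h2 := Real.abs_sin_le_one (η (y - s) - β)
    linarith
  · rw [h.eq_right _ (by linarith), h.eq_right _ (by linarith)]

end IsCutoff

/-- A lower bound for the local density. -/
lemma exists_locDensity_lower_bound {β ν : ℝ} {η : ℝ → ℝ} (hν : 0 < ν) (hη : IsCutoff β η) :
    ∃ m : ℝ → ℝ, Integrable m halfLine ∧ (∀ x, 0 < x → 0 ≤ m x) ∧ ∀ a g : ℝ → ℝ, ∀ x, 0 < x →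
      1 / 2 * g x ^ 2 + (Ioi (1 : ℝ)).indicator (fun x => 1 / 4 * Real.sin (a x + β) ^ 2) x - m x ≤
        locDensity β ν η a g x := by
  obtain ⟨L, hL0, hL⟩ := hη.exists_lipschitz
  set k := ν / (4 * Real.pi) with hk
  have hk0 : 0 < k := by positivity
  -- On (0, 1] the Lipschitz bound gives sin²(η-β)/x ≤ L²x ≤ L². Beyond 1, Young's inequality k|s|/x
  -- ≤ s²/4 + k²/x² with s = sin θ spends half of the term s²/2 and leaves a quarter of sin² θ.
  refine ⟨fun x => (Ioc (0 : ℝ) 1).indicator (fun _ => k * L ^ 2) x +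
    (Ioi (1 : ℝ)).indicator (fun x => k ^ 2 * x ^ (-2 : ℝ)) x, ?_, fun x hx => ?_,
    fun a g x hx => ?_⟩
  · refine Integrable.mono_measure ?_ Measure.restrict_le_self
    refine Integrable.add ?_ ?_
    · rw [integrable_indicator_iff measurableSet_Ioc]
      exact integrableOn_const (by simp)
    · rw [integrable_indicator_iff measurableSet_Ioi]
      exact (integrableOn_Ioi_rpow_of_lt (by norm_num) one_pos).const_mul _
  · refine add_nonneg (indicator_nonneg (fun _ _ => by positivity) _)
      (indicator_nonneg (fun y hy => ?_) _)
    have : (0 : ℝ) < y := lt_trans one_pos hy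
    positivity
  · rw [locDensity, ← hk]
    beta_reduce
    rcases le_or_gt x 1 with h1 | h1
    · rw [indicator_of_notMem (by simp [h1]), indicator_of_mem (by exact ⟨hx, h1⟩),
        indicator_of_notMem (by simp [h1])]
      have e1 : Real.sin (η x - β) ^ 2 / x ≤ L ^ 2 := by
        rw [div_le_iff₀ hx]
        have e2 : |Real.sin (η x - β)| ≤ L * x := by
          refine (Real.abs_sin_le_abs).trans ?_
          have := hL x 0
          rwa [hη.eq_left 0 le_rfl, sub_zero, abs_of_pos hx] at this
        have e3 : Real.sin (η x - β) ^ 2 ≤ (L * x) ^ 2 := by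
          rw [← sq_abs]; exact pow_le_pow_left₀ (abs_nonneg _) e2 2
        nlinarith [mul_nonneg (sq_nonneg L) hx.le]
      have e4 : 0 ≤ Real.sin (a x) ^ 2 / x := by positivity
      rw [sub_div]
      have e5 : 0 ≤ Real.sin (a x + β) ^ 2 := sq_nonneg _
      nlinarith
    · rw [indicator_of_mem (by exact h1), indicator_of_notMem (by simp [h1]),
        indicator_of_mem (by exact h1), hη.eq_right x h1.le, zero_sub, Real.sin_neg, neg_sq,
        sin_sq_sub_sin_sq_eq, Real.rpow_neg hx.le]
      norm_cast
      set s := Real.sin (a x + β)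
      have e1 : -(|s| / x) ≤ s * Real.sin (a x - β) / x := by
        rw [← neg_div]
        refine div_le_div_of_nonneg_right ?_ hx.le
        have := neg_abs_le (s * Real.sin (a x - β))
        rw [abs_mul] at this
        nlinarith [Real.abs_sin_le_one (a x - β), abs_nonneg s]
      have e2 : k * (|s| / x) ≤ 1 / 4 * s ^ 2 + k ^ 2 * (x ^ 2)⁻¹ := by
        have : 0 ≤ (1 / 2 * |s| - k * x⁻¹) ^ 2 := sq_nonneg _
        rw [div_eq_mul_inv, ← inv_pow]
        nlinarith [sq_abs s]
      nlinarith

lemma aestronglyMeasurable_locDensity {β ν : ℝ} {η a g : ℝ → ℝ} (hη : IsCutoff β η)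
    (ha : IsPrim a g) : AEStronglyMeasurable (locDensity β ν η a g) halfLine := by
  have h1 : AEMeasurable g halfLine :=
    ha.locInt.aestronglyMeasurable.aemeasurable.mono_measure Measure.restrict_le_self
  have h2 := ha.continuous.measurable
  have h3 := hη.continuous.measurable
  unfold locDensity
  refine AEMeasurable.aestronglyMeasurable ?_
  refine ((h1.pow_const 2).const_mul _).add (Measurable.aemeasurable ?_) |>.add
    (Measurable.aemeasurable ?_)
  all_goals fun_prop

lemma lintegral_neg_locDensity_ne_top {β ν : ℝ} {η : ℝ → ℝ} (hν : 0 < ν)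
    (hη : IsCutoff β η) (a g : ℝ → ℝ) :
    ∫⁻ x in Ioi (0 : ℝ), ENNReal.ofReal (-locDensity β ν η a g x) ≠ ⊤ := by
  obtain ⟨m, hm, _, hb⟩ := exists_locDensity_lower_bound hν hη
  refine ((setLIntegral_mono' measurableSet_Ioi fun x hx => ENNReal.ofReal_le_ofReal ?_).trans_lt
    hm.lintegral_lt_top).ne
  have h1 := hb a g x hx
  have h2 : 0 ≤ (Ioi (1 : ℝ)).indicator (fun x => 1 / 4 * Real.sin (a x + β) ^ 2) x :=
    indicator_nonneg (fun _ _ => by positivity) _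
  nlinarith [sq_nonneg (g x)]

lemma integrable_sin_sq_of_locDensity {β ν : ℝ} {η a g : ℝ → ℝ} (hν : 0 < ν)
    (hη : IsCutoff β η) (ha : Continuous a) (h : Integrable (locDensity β ν η a g) halfLine) :
    IntegrableOn (fun x => Real.sin (a x + β) ^ 2) (Ioi 0) := by
  obtain ⟨m, hm, _, hb⟩ := exists_locDensity_lower_bound hν hη
  have hc : Continuous fun x => Real.sin (a x + β) ^ 2 := by fun_prop
  rw [← Ioc_union_Ioi_eq_Ioi (zero_le_one (α := ℝ))]
  refine IntegrableOn.union (hc.integrableOn_Icc.mono_set Ioc_subset_Icc_self) ?_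
  have h0 : Integrable (fun x => 4 * (locDensity β ν η a g x + m x)) halfLine :=
    (Integrable.add h hm).const_mul 4
  have h1 : IntegrableOn (fun x => 4 * (locDensity β ν η a g x + m x)) (Ioi 1) :=
    IntegrableOn.mono_set h0 (Ioi_subset_Ioi zero_le_one)
  refine h1.mono' hc.aestronglyMeasurable ?_
  filter_upwards [ae_restrict_mem measurableSet_Ioi] with x hx
  have h2 := hb a g x (lt_trans one_pos hx)
  rw [indicator_of_mem hx] at h2
  rw [Real.norm_of_nonneg (sq_nonneg _)]
  nlinarith [sq_nonneg (g x)]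

/-- The energy as a real number. -/
noncomputable def realEnergy (β ν : ℝ) (η a g : ℝ → ℝ) : ℝ :=
  (∫ x in Ioi (0 : ℝ), locDensity β ν η a g x) +
    ν / (8 * Real.pi) *
      (∫ p, quadKernel (fun x => Real.sin (a x)) p ∂(halfLine.prod halfLine)) -
    ν / (8 * Real.pi) *
      (∫ p, quadKernel (fun x => Real.sin (η x - β)) p ∂(halfLine.prod halfLine))

lemma coe_ofReal_mul_lintegral_quadKernel {c : ℝ} (hc : 0 ≤ c) {u : ℝ → ℝ}
    (h : Integrable (quadKernel u) (halfLine.prod halfLine)) :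
    ((ENNReal.ofReal c *
      (∫⁻ p, ENNReal.ofReal (quadKernel u p) ∂(halfLine.prod halfLine)) : ℝ≥0∞) : EReal) =
      ((c * ∫ p, quadKernel u p ∂(halfLine.prod halfLine) : ℝ) : EReal) := by
  rw [← ofReal_integral_eq_lintegral_ofReal h (Eventually.of_forall (quadKernel_nonneg u)),
    ← ENNReal.ofReal_mul hc, EReal.coe_ennreal_ofReal, max_eq_left]
  exact mul_nonneg hc (integral_nonneg (quadKernel_nonneg u))

lemma nonlocalEnergy_cutoff {β : ℝ} {η : ℝ → ℝ} (hη : IsCutoff β η) :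
    nonlocalEnergy β η = ∫⁻ p, ENNReal.ofReal (quadKernel (fun x => Real.sin (η x - β)) p)
      ∂(halfLine.prod halfLine) :=
  nonlocalEnergy_eq (a := fun x => η x - β) (hη.continuous.sub continuous_const)
    fun x _ => by ring

lemma energy_eq_realEnergy {β ν : ℝ} {η θ a g : ℝ → ℝ} (hν : 0 < ν) (hη : IsCutoff β η)
    (ha : IsPrim a g) (hθ : ∀ x, 0 < x → θ x = β + a x)
    (h1 : Integrable (locDensity β ν η a g) halfLine)
    (h2 : Integrable (quadKernel fun x => Real.sin (a x)) (halfLine.prod halfLine)) :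
    energy β ν η θ = (realEnergy β ν η a g : EReal) := by
  have hc : 0 ≤ ν / (8 * Real.pi) := by positivity
  have h3 : Integrable (quadKernel fun x => Real.sin (η x - β)) (halfLine.prod halfLine) := by
    simpa using hη.integrable_quadKernel 0
  rw [energy, localEnergy_eq ha hθ, extIntegral_eq h1, nonlocalEnergy_eq ha.continuous hθ,
    nonlocalEnergy_cutoff hη, coe_ofReal_mul_lintegral_quadKernel hc h2,
    coe_ofReal_mul_lintegral_quadKernel hc h3, realEnergy, EReal.coe_sub, EReal.coe_add]

/-- No cancellation of infinities can occur: the negative part of the local density is integrable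
and the double integral of the cutoff is finite, so a finite total forces each remaining part to be
finite. -/
lemma integrable_of_energy_lt_top {β ν : ℝ} {η θ a g : ℝ → ℝ} (hν : 0 < ν) (hη : IsCutoff β η)
    (ha : IsPrim a g) (hθ : ∀ x, 0 < x → θ x = β + a x) (h : energy β ν η θ < ⊤) :
    Integrable (locDensity β ν η a g) halfLine ∧
      Integrable (quadKernel fun x => Real.sin (a x)) (halfLine.prod halfLine) := by
  have hc : 0 < ν / (8 * Real.pi) := by positivity
  have h3 : Integrable (quadKernel fun x => Real.sin (η x - β)) (halfLine.prod halfLine) := by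
    simpa using hη.integrable_quadKernel 0
  have hneg := lintegral_neg_locDensity_ne_top hν hη a g
  have hbot := extIntegral_ne_bot hneg
  rw [energy, localEnergy_eq ha hθ, nonlocalEnergy_eq ha.continuous hθ,
    nonlocalEnergy_cutoff hη, coe_ofReal_mul_lintegral_quadKernel hc.le h3] at h
  set Q := ∫⁻ p, ENNReal.ofReal (quadKernel (fun x => Real.sin (a x)) p)
    ∂(halfLine.prod halfLine) with hQ
  have hsum : extIntegral (locDensity β ν η a g) +
      ((ENNReal.ofReal (ν / (8 * Real.pi)) * Q : ℝ≥0∞) : EReal) ≠ ⊤ := by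
    intro htop
    rw [htop, EReal.top_sub_coe] at h
    exact lt_irrefl _ h
  have hQbot : ((ENNReal.ofReal (ν / (8 * Real.pi)) * Q : ℝ≥0∞) : EReal) ≠ ⊥ :=
    EReal.coe_ennreal_ne_bot _
  constructor
  · refine integrable_of_extIntegral_ne_top (aestronglyMeasurable_locDensity hη ha) hneg ?_
    intro htop
    rw [htop, EReal.top_add_of_ne_bot hQbot] at hsum
    exact hsum rfl
  · have hQtop : Q ≠ ⊤ := by
      intro htop
      rw [htop, ENNReal.mul_top (by simpa using hc), EReal.coe_ennreal_top,
        EReal.add_top_of_ne_bot hbot] at hsum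
      exact hsum rfl
    refine ⟨(measurable_quadKernel
      (Real.continuous_sin.comp ha.continuous)).aestronglyMeasurable, ?_⟩
    rw [hasFiniteIntegral_iff_ofReal (Eventually.of_forall (quadKernel_nonneg _))]
    exact hQtop.lt_top

/-- The shift by one makes η(·-1) - β vanish on [0, 1], so only infinity has to be cut off, where
the function equals the constant -β. Multiplication by b(x/N) changes the derivative by O(1/N) on a
set of length 4N, an error O(N^(-1/2)) in L². -/
lemma IsCutoff.memHomSobolevZero_shift {β : ℝ} {η : ℝ → ℝ} (h : IsCutoff β η) :
    MemHomSobolevZero fun x => η (x - 1) - β := by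
  obtain ⟨b, hbs, hbo, hbi⟩ : ∃ b : ℝ → ℝ, ContDiff ℝ ∞ b ∧ (∀ x : ℝ, 2 ≤ |x| → b x = 0) ∧
      ∀ x : ℝ, |x| ≤ 1 → b x = 1 := by
    let b : ContDiffBump (0 : ℝ) := ⟨1, 2, by norm_num, by norm_num⟩
    exact ⟨b, b.contDiff, fun x hx => b.zero_of_le_dist (by simpa [Real.dist_eq] using hx),
      fun x hx => b.one_of_mem_closedBall (by simpa [Real.dist_eq] using hx)⟩
  have hbd : ∀ x, HasDerivAt b (deriv b x) x := fun x =>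
    (hbs.differentiable (by simp) x).hasDerivAt
  have hbdo : ∀ x : ℝ, 2 < |x| → deriv b x = 0 := fun x hx => by
    have : b =ᶠ[𝓝 x] fun _ => 0 := by
      filter_upwards [continuous_abs.isOpen_preimage _ isOpen_Ioi |>.mem_nhds hx] with y hy
      exact hbo y (le_of_lt hy)
    rw [this.deriv_eq, deriv_const]
  obtain ⟨M, hM⟩ := (hbs.continuous_deriv (by simp)).bounded_above_of_compact_support
    (HasCompactSupport.intro (isCompact_Icc (a := (-2 : ℝ)) (b := 2)) fun x hx =>
      hbdo x (by by_contra h; exact hx (abs_le.1 (not_lt.1 h))))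
  have hM0 : 0 ≤ M := (norm_nonneg _).trans (hM 0)
  have hb01 : ∀ x, |η x - β| ≤ |β| := fun x => by
    have := h.mem_Icc x
    rw [abs_le]
    have h1 := le_abs_self β
    constructor <;> linarith [this.1, this.2]
  -- With N ≥ 2 the plateau of b(x/N) contains [1, 2], the support of the derivative of the shifted
  -- cutoff.
  set N : ℕ → ℝ := fun n => (n : ℝ) + 2 with hN
  have hN0 : ∀ n, 0 < N n := fun n => by positivity
  have hN2 : ∀ n, 2 ≤ N n := fun n => by simp [hN]
  have hdη : ∀ x, HasDerivAt (fun x => η (x - 1) - β) (deriv η (x - 1)) x := fun x =>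
    ((h.hasDerivAt (x - 1)).comp_sub_const x 1).sub_const β
  have hd : ∀ n x, HasDerivAt (fun x => (η (x - 1) - β) * b (x / N n))
      (deriv η (x - 1) * b (x / N n) + (η (x - 1) - β) * (deriv b (x / N n) * (1 / N n))) x :=
    fun n x => (hdη x).mul ((hbd (x / N n)).comp x ((hasDerivAt_id x).div_const (N n)))
  refine ⟨fun n x => (η (x - 1) - β) * b (x / N n), fun x => deriv η (x - 1), fun n => ?_, ?_, ?_,
    fun x _ => ?_⟩
  · refine IsTestFunction.of_Icc (A := 1) (B := 2 * N n) ?_ one_pos fun x hx => ?_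
    · exact ((h.smooth.comp (contDiff_id.sub contDiff_const)).sub contDiff_const).mul
        (hbs.comp (contDiff_id.div_const _))
    · by_cases hx1 : x < 1
      · simp [h.eq_left (x - 1) (by linarith)]
      · have : 2 * N n < x := by by_contra h2; exact hx ⟨not_lt.1 hx1, not_lt.1 h2⟩
        have hx2 : 2 ≤ |x / N n| :=
          le_trans ((le_div_iff₀ (hN0 n)).2 this.le) (le_abs_self _)
        simp [hbo _ hx2]
  · have hc : Continuous fun x => deriv η (x - 1) :=
      h.continuous_deriv.comp (continuous_id.sub continuous_const)
    refine (hc.memLp_of_hasCompactSupport ?_).mono_measure Measure.restrict_le_self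
    exact HasCompactSupport.intro (isCompact_Icc (a := (1 : ℝ)) (b := 2)) fun x hx =>
      h.deriv_eq_zero fun hx' => hx ⟨by linarith [hx'.1], by linarith [hx'.2]⟩
  · have hpt : ∀ n x, ‖deriv (fun x => (η (x - 1) - β) * b (x / N n)) x - deriv η (x - 1)‖ ≤
        ‖(Icc (-(2 * N n)) (2 * N n)).indicator (fun _ => |β| * M / N n) x‖ := by
      intro n x
      rw [(hd n x).deriv]
      have e1 : deriv η (x - 1) * b (x / N n) - deriv η (x - 1) = 0 := by
        by_cases hx : x - 1 ∈ Icc (0 : ℝ) 1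
        · rw [hbi, mul_one, sub_self]
          rw [abs_div, abs_of_pos (hN0 n), div_le_one (hN0 n), abs_of_nonneg (by linarith [hx.1])]
          linarith [hx.2, hN2 n]
        · rw [h.deriv_eq_zero hx]; ring
      rw [add_sub_right_comm, e1, zero_add]
      by_cases hx : x ∈ Icc (-(2 * N n)) (2 * N n)
      · rw [indicator_of_mem hx, norm_mul, norm_mul]
        refine le_trans ?_ (le_abs_self _)
        rw [Real.norm_eq_abs (1 / N n), abs_of_pos (by have := hN0 n; positivity), mul_one_div,
          ← mul_div_assoc]
        refine div_le_div_of_nonneg_right ?_ (hN0 n).le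
        exact mul_le_mul (hb01 _) (hM _) (norm_nonneg _) (abs_nonneg _)
      · rw [indicator_of_notMem hx, hbdo]
        · simp
        · rw [abs_div, abs_of_pos (hN0 n), lt_div_iff₀ (hN0 n)]
          by_contra h2
          exact hx (abs_le.1 (not_lt.1 h2))
    have hle : ∀ n, eLpNorm (fun x => deriv (fun x => (η (x - 1) - β) * b (x / N n)) x -
        deriv η (x - 1)) 2 halfLine ≤ ENNReal.ofReal (|β| * M / N n * √(4 * N n)) := by
      intro n
      refine (eLpNorm_mono (hpt n)).trans ((eLpNorm_mono_measure _ Measure.restrict_le_self).trans ?_)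
      rw [eLpNorm_indicator_const measurableSet_Icc (by norm_num) (by norm_num), Real.volume_Icc,
        Real.enorm_eq_ofReal (by have := hN0 n; positivity),
        ENNReal.ofReal_rpow_of_nonneg (by linarith [hN0 n]) (by norm_num),
        ← ENNReal.ofReal_mul (by have := hN0 n; positivity)]
      refine ENNReal.ofReal_le_ofReal (le_of_eq ?_)
      rw [Real.sqrt_eq_rpow]
      norm_num
      left; congr 1; ring
    refine tendsto_of_tendsto_of_tendsto_of_le_of_le tendsto_const_nhds ?_ (fun _ => zero_le) hle
    have e : ∀ n, |β| * M / N n * √(4 * N n) = 2 * |β| * M * (√(N n))⁻¹ := by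
      intro n
      have h4 : √(4 : ℝ) = 2 := by
        rw [show (4 : ℝ) = 2 ^ 2 by norm_num]; exact Real.sqrt_sq (by norm_num)
      have h5 := Real.mul_self_sqrt (hN0 n).le
      have h6 : √(N n) ≠ 0 := (Real.sqrt_pos.2 (hN0 n)).ne'
      rw [Real.sqrt_mul (by norm_num), h4]
      have h7 := (hN0 n).ne'
      field_simp
      rw [pow_two, h5]
    simp only [e]
    rw [← ENNReal.ofReal_zero]
    refine ENNReal.tendsto_ofReal ?_
    have hNt : Tendsto N atTop atTop :=
      tendsto_atTop_add_const_right _ _ tendsto_natCast_atTop_atTop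
    simpa using (tendsto_inv_atTop_zero.comp (Real.tendsto_sqrt_atTop.comp hNt)).const_mul
      (2 * |β| * M)
  · refine tendsto_const_nhds.congr' ?_
    filter_upwards [eventually_ge_atTop ⌈|x|⌉₊] with n hn
    have : |x| ≤ n := (Nat.le_ceil _).trans (by exact_mod_cast hn)
    rw [hbi, mul_one]
    rw [abs_div, abs_of_pos (hN0 n), div_le_one (hN0 n)]
    simp only [hN]; linarith

lemma IsCutoff.admissible_shift {β : ℝ} {η : ℝ → ℝ} (h : IsCutoff β η) :
    Admissible β fun x => η (x - 1) :=
  ⟨(h.continuous.comp (continuous_id.sub continuous_const)).continuousOn,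
    h.memHomSobolevZero_shift⟩

/-- One finite competitor makes the energy of every minimizer finite. Here the local density is
bounded on (0, 2], because both squared sines are O(x) at the edge, and it vanishes identically
beyond 2. -/
lemma IsCutoff.energy_shift_lt_top {β ν : ℝ} {η : ℝ → ℝ} (hν : 0 < ν) (h : IsCutoff β η) :
    energy β ν η (fun x => η (x - 1)) < ⊤ := by
  have hp : IsPrim (fun x => η (x - 1) - β) fun x => deriv η (x - 1) :=
    IsPrim.of_hasDerivAt (fun x => ((h.hasDerivAt (x - 1)).comp_sub_const x 1).sub_const β)
      (h.continuous_deriv.comp (continuous_id.sub continuous_const))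
  rw [energy_eq_realEnergy hν h hp (fun x _ => by ring) ?_ (h.integrable_quadKernel 1)]
  · exact EReal.coe_lt_top _
  obtain ⟨L, _, hL⟩ := h.exists_lipschitz
  obtain ⟨D, hD⟩ := h.continuous_deriv.bounded_above_of_compact_support h.hasCompactSupport_deriv
  have hD0 : 0 ≤ D := (norm_nonneg _).trans (hD 0)
  set c := D ^ 2 + 1 + |ν / (4 * Real.pi)| * (2 * L) with hc
  have hi : Integrable ((Icc (0 : ℝ) 2).indicator fun _ => c) halfLine := by
    refine Integrable.mono_measure ?_ Measure.restrict_le_self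
    rw [integrable_indicator_iff measurableSet_Icc]
    exact integrableOn_const (by simp)
  refine hi.mono' (aestronglyMeasurable_locDensity h hp) ?_
  filter_upwards [ae_restrict_mem measurableSet_Ioi] with x hx
  have hx0 : (0 : ℝ) < x := hx
  rw [locDensity]
  simp only [sub_add_cancel]
  by_cases hx2 : x ≤ 2
  · rw [indicator_of_mem (by exact ⟨hx0.le, hx2⟩)]
    have e1 : ‖1 / 2 * deriv η (x - 1) ^ 2‖ ≤ D ^ 2 := by
      rw [Real.norm_of_nonneg (by positivity), ← sq_abs]
      have := pow_le_pow_left₀ (abs_nonneg _) (hD (x - 1)) 2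
      have h2 := sq_nonneg D
      rw [Real.norm_eq_abs] at this
      linarith [sq_nonneg (|deriv η (x - 1)|)]
    have e2 : ‖1 / 2 * Real.sin (η (x - 1)) ^ 2‖ ≤ 1 := by
      rw [Real.norm_of_nonneg (by positivity)]
      nlinarith [Real.sin_sq_le_one (η (x - 1))]
    have e3 : ‖(Real.sin (η (x - 1) - β) ^ 2 - Real.sin (η x - β) ^ 2) / x‖ ≤ 2 * L := by
      have hs : ∀ y, 0 ≤ y → |Real.sin (η y - β)| ≤ L * y ∧ |Real.sin (η y - β)| ≤ 1 := by
        intro y hy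
        refine ⟨(Real.abs_sin_le_abs).trans ?_, Real.abs_sin_le_one _⟩
        have := hL y 0
        rwa [h.eq_left 0 le_rfl, sub_zero, abs_of_nonneg hy] at this
      have hs1 : |Real.sin (η (x - 1) - β)| ≤ L * x ∧ |Real.sin (η (x - 1) - β)| ≤ 1 := by
        rcases le_total 1 x with h1 | h1
        · obtain ⟨k1, k2⟩ := hs (x - 1) (by linarith)
          refine ⟨k1.trans ?_, k2⟩
          have hL0 : 0 ≤ L := by
            have := (abs_nonneg _).trans (hL 1 0); simpa using this
          nlinarith
        · rw [h.eq_left (x - 1) (by linarith)]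
          have := (abs_nonneg _).trans (hs x hx0.le).1
          simpa using this
      have hsq : ∀ s : ℝ, |s| ≤ L * x ∧ |s| ≤ 1 → s ^ 2 ≤ L * x := fun s hs => by
        rw [← sq_abs]; nlinarith [abs_nonneg s]
      rw [norm_div, Real.norm_of_nonneg hx0.le, div_le_iff₀ hx0, Real.norm_eq_abs, abs_le]
      have k1 := hsq _ hs1
      have k2 := hsq _ (hs x hx0.le)
      constructor <;> nlinarith [sq_nonneg (Real.sin (η (x - 1) - β)), sq_nonneg (Real.sin (η x - β))]
    refine (norm_add_le _ _).trans (add_le_add ((norm_add_le _ _).trans (add_le_add e1 e2)) ?_)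
    rw [norm_mul, Real.norm_eq_abs]
    exact mul_le_mul_of_nonneg_left e3 (abs_nonneg _)
  · rw [indicator_of_notMem (fun hx' => hx2 hx'.2),
      h.deriv_eq_zero (fun hx' => hx2 (by linarith [hx'.2])), h.eq_right (x - 1) (by linarith),
      h.eq_right x (by linarith)]
    simp

/-! ### Profiles of minimizers and integrability of the variation kernels -/

/-- Structure of a minimizer: `θ = β + a` on the half-line, where `a' = g ∈ L²`, and the parts of
its energy are finite. -/
structure IsProfile (β ν : ℝ) (η θ a g : ℝ → ℝ) : Prop where
  prim : IsPrim a g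
  memLp : MemLp g 2 volume
  eq_zero : ∀ x, x ≤ 0 → a x = 0
  deriv_eq_zero : ∀ x, x ≤ 0 → g x = 0
  eq_add : ∀ x, 0 ≤ x → θ x = β + a x
  integrable_loc : Integrable (locDensity β ν η a g) halfLine
  integrable_quad : Integrable (quadKernel fun x => Real.sin (a x)) (halfLine.prod halfLine)

lemma IsMinimizer.exists_isProfile {β ν : ℝ} {η θ : ℝ → ℝ} (hν : 0 < ν) (hη : IsCutoff β η)
    (h : IsMinimizer β ν η θ) : ∃ a g, IsProfile β ν η θ a g := by
  obtain ⟨a, g, hp, hg, ha0, hg0, he⟩ := h.1.2.exists_isPrim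
  have he' : ∀ x, 0 ≤ x → θ x = β + a x := fun x hx => by linarith [he x hx]
  obtain ⟨h1, h2⟩ := integrable_of_energy_lt_top hν hη hp (fun x hx => he' x hx.le)
    ((h.2 _ hη.admissible_shift).trans_lt (hη.energy_shift_lt_top hν))
  exact ⟨a, g, hp, hg, ha0, hg0, he', h1, h2⟩

lemma Admissible.add_test {β : ℝ} {θ φ : ℝ → ℝ} (h : Admissible β θ) (hφ : IsTestFunction φ)
    (t : ℝ) : Admissible β fun x => θ x + t * φ x := by
  refine ⟨h.1.add (continuous_const.mul hφ.continuous).continuousOn, ?_⟩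
  obtain ⟨φ', g, h1, h2, h3, h4⟩ := h.2
  have htφ : MemLp (fun x => t * deriv φ x) 2 halfLine :=
    ((continuous_const.mul hφ.continuous_deriv).memLp_of_hasCompactSupport
      hφ.compact.deriv.mul_left).mono_measure Measure.restrict_le_self
  have hd : ∀ n x, deriv (fun x => φ' n x + t * φ x) x = deriv (φ' n) x + t * deriv φ x :=
    fun n x => (((h1 n).hasDerivAt x).add ((hφ.hasDerivAt x).const_mul t)).deriv
  refine ⟨fun n x => φ' n x + t * φ x, fun x => g x + t * deriv φ x, fun n => ?_, h2.add htφ, ?_,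
    fun x hx => ?_⟩
  · refine ⟨(h1 n).smooth.add (contDiff_const.mul hφ.smooth), (h1 n).compact.add
      (hφ.compact.mul_left), (tsupport_add _ _).trans (union_subset (h1 n).support
      ((closure_mono fun x hx => ?_).trans hφ.support))⟩
    rw [Function.mem_support] at hx ⊢
    exact right_ne_zero_of_mul hx
  · simpa only [hd, add_sub_add_right_eq_sub] using h3
  · have := (h4 x hx).add_const (t * φ x)
    rwa [← add_sub_right_comm] at this

/-- By Cauchy-Schwarz the squared increment is at most z ∫_0^z g(y+s)² ds; after integration in y
each s contributes the same amount ‖g‖². -/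
lemma lintegral_sq_translate_sub_le {f g : ℝ → ℝ} (h : IsPrim f g) (hg : MemLp g 2 volume)
    (z : ℝ) : ∫⁻ y, ENNReal.ofReal ((f (y + z) - f y) ^ 2) ≤
      ENNReal.ofReal (z ^ 2 * ∫ t, g t ^ 2) := by
  wlog hz : 0 ≤ z generalizing z
  · have h1 := this (-z) (by linarith)
    rw [neg_sq] at h1
    rw [← lintegral_add_right_eq_self _ (-z)]
    refine (lintegral_mono fun y => le_of_eq ?_).trans h1
    rw [neg_add_cancel_right]; congr 1; ring
  -- The exchange of the two integrations needs joint measurability of g(y+s), so g is replaced by a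
  -- strongly measurable representative.
  wlog hm : StronglyMeasurable g generalizing g
  · have hmk := hg.1.ae_eq_mk
    have h1 := this (h.congr_deriv hmk) (hg.ae_eq hmk) hg.1.stronglyMeasurable_mk
    have h2 : ∫ t, g t ^ 2 = ∫ t, hg.1.mk g t ^ 2 := by
      refine integral_congr_ae ?_
      filter_upwards [hmk] with t ht
      exact congrArg (· ^ 2) ht
    rwa [h2]
  have h2 := hg.integrable_sq
  have hgm := hm.measurable
  have hpt : ∀ y, ENNReal.ofReal ((f (y + z) - f y) ^ 2) ≤
      ENNReal.ofReal z * ∫⁻ s in Ioc 0 z, ENNReal.ofReal (g (y + s) ^ 2) := by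
    intro y
    have hi : IntegrableOn (fun s => g (y + s) ^ 2) (Ioc 0 z) :=
      (h2.comp_add_left y).integrableOn
    rw [← ofReal_integral_eq_lintegral_ofReal hi (Eventually.of_forall fun s => sq_nonneg _),
      ← ENNReal.ofReal_mul hz, h.eq y]
    refine ENNReal.ofReal_le_ofReal ?_
    refine (sq_intervalIntegral_le (by linarith) (h.ii _ _) h2.intervalIntegrable).trans ?_
    rw [add_sub_cancel_left, ← intervalIntegral.integral_of_le hz,
      intervalIntegral.integral_comp_add_left (fun s => g s ^ 2), add_zero]
  refine (lintegral_mono hpt).trans ?_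
  rw [lintegral_const_mul' _ _ ENNReal.ofReal_ne_top, lintegral_lintegral_swap (by fun_prop)]
  have e : ∀ s, ∫⁻ y, ENNReal.ofReal (g (y + s) ^ 2) = ENNReal.ofReal (∫ t, g t ^ 2) := by
    intro s
    rw [lintegral_add_right_eq_self (fun y => ENNReal.ofReal (g y ^ 2)) s,
      ofReal_integral_eq_lintegral_ofReal h2 (Eventually.of_forall fun s => sq_nonneg _)]
  simp only [e]
  rw [lintegral_const, Measure.restrict_apply_univ, Real.volume_Ioc, sub_zero, mul_comm, mul_assoc,
    ← ENNReal.ofReal_mul hz, ← ENNReal.ofReal_mul (integral_nonneg fun t => sq_nonneg _)]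
  exact ENNReal.ofReal_le_ofReal (le_of_eq (by ring))

/-- The strip around the diagonal. -/
def strip : Set (ℝ × ℝ) := {p | |p.1 - p.2| < 1}

lemma measurableSet_strip : MeasurableSet strip :=
  measurableSet_lt (by fun_prop) measurable_const

/-- Slice the strip by z = x - y: the translation estimate cancels the factor z⁻², so each slice
with |z| < 1 contributes at most ‖g‖². No decay of f itself is required. -/
lemma integrable_strip_quadKernel {f g : ℝ → ℝ} (h : IsPrim f g) (hg : MemLp g 2 volume) :
    Integrable (strip.indicator (quadKernel f)) (volume.prod volume) := by
  have hm : Measurable (strip.indicator (quadKernel f)) :=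
    (measurable_quadKernel h.continuous).indicator measurableSet_strip
  refine ⟨hm.aestronglyMeasurable, ?_⟩
  rw [hasFiniteIntegral_iff_ofReal (Eventually.of_forall
    (indicator_nonneg fun p _ => quadKernel_nonneg f p)),
    lintegral_prod_symm' _ (by exact hm.ennreal_ofReal)]
  have e : ∀ y, ∫⁻ x, ENNReal.ofReal (strip.indicator (quadKernel f) (x, y)) =
      ∫⁻ z, ENNReal.ofReal (strip.indicator (quadKernel f) (y + z, y)) := fun y =>
    (lintegral_add_left_eq_self (fun x => ENNReal.ofReal (strip.indicator (quadKernel f) (x, y)))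
      y).symm
  simp only [e]
  have hm2 : Measurable (Function.uncurry fun y z =>
      ENNReal.ofReal (strip.indicator (quadKernel f) (y + z, y))) :=
    (hm.comp (by fun_prop : Measurable fun q : ℝ × ℝ => (q.1 + q.2, q.1))).ennreal_ofReal
  rw [lintegral_lintegral_swap hm2.aemeasurable]
  set N := ∫ t, g t ^ 2
  have hb : ∀ z, ∫⁻ y, ENNReal.ofReal (strip.indicator (quadKernel f) (y + z, y)) ≤
      (Ioo (-1 : ℝ) 1).indicator (fun _ => ENNReal.ofReal N) z := by
    intro z
    by_cases hz : z ∈ Ioo (-1 : ℝ) 1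
    · rw [indicator_of_mem hz]
      rcases eq_or_ne z 0 with rfl | hz0
      · have : ∀ y, strip.indicator (quadKernel f) (y + 0, y) = 0 := fun y => by
          simp [indicator, quadKernel]
        simp only [this, ENNReal.ofReal_zero, lintegral_zero, zero_le]
      have hz2 : 0 < z ^ 2 := by positivity
      have e2 : ∀ y, ENNReal.ofReal (strip.indicator (quadKernel f) (y + z, y)) =
          ENNReal.ofReal ((z ^ 2)⁻¹) * ENNReal.ofReal ((f (y + z) - f y) ^ 2) := by
        intro y
        rw [indicator_of_mem (by
          simpa only [strip, mem_ofPred_eq, add_sub_cancel_left, abs_lt, mem_Ioo] using hz),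
          ← ENNReal.ofReal_mul (by positivity), quadKernel]
        simp only [add_sub_cancel_left]
        congr 1; rw [div_eq_inv_mul]
      simp only [e2]
      rw [lintegral_const_mul' _ _ ENNReal.ofReal_ne_top]
      refine (mul_le_mul_right (lintegral_sq_translate_sub_le h hg z) _).trans ?_
      rw [← ENNReal.ofReal_mul (by positivity), inv_mul_cancel_left₀ hz2.ne']
    · rw [indicator_of_notMem hz]
      have : ∀ y, strip.indicator (quadKernel f) (y + z, y) = 0 := fun y =>
        indicator_of_notMem (by
          simpa only [strip, mem_ofPred_eq, add_sub_cancel_left, abs_lt, mem_Ioo] using hz) _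
      simp [this]
  refine (lintegral_mono hb).trans_lt ?_
  rw [lintegral_indicator measurableSet_Ioo, lintegral_const]
  simp [ENNReal.mul_lt_top_iff]

/-- The far-field kernel `z⁻²` on `|z| ≥ 1`. -/
noncomputable def farKernel (z : ℝ) : ℝ := if |z| < 1 then 0 else (z ^ 2)⁻¹

lemma farKernel_nonneg (z : ℝ) : 0 ≤ farKernel z := by
  unfold farKernel; split_ifs <;> positivity

lemma farKernel_neg (z : ℝ) : farKernel (-z) = farKernel z := by
  simp [farKernel]

lemma integrable_farKernel : Integrable farKernel := by
  refine (integrable_inv_one_add_sq.const_mul 2).mono' ?_ (Eventually.of_forall fun z => ?_)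
  · refine Measurable.aestronglyMeasurable ?_
    exact Measurable.ite (measurableSet_lt (by fun_prop) measurable_const) measurable_const
      (by fun_prop)
  · rw [Real.norm_of_nonneg (farKernel_nonneg z), farKernel]
    split_ifs with h
    · positivity
    · have h1 : 1 ≤ z ^ 2 := by
        rw [← sq_abs]; nlinarith [not_lt.1 h]
      rw [← div_eq_mul_inv, inv_eq_one_div, div_le_div_iff₀ (by linarith) (by positivity)]
      linarith

/-- Bound for the increments of variations in the direction of `φ`. -/
noncomputable def variationKernel (a φ : ℝ → ℝ) (p : ℝ × ℝ) : ℝ :=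
  |φ p.1 - φ p.2| + |φ p.2| * min 2 |a p.1 - a p.2|

lemma variationKernel_nonneg (a φ : ℝ → ℝ) (p : ℝ × ℝ) : 0 ≤ variationKernel a φ p := by
  unfold variationKernel; positivity

lemma IsTestFunction.exists_bound {φ : ℝ → ℝ} (h : IsTestFunction φ) :
    ∃ M, 0 ≤ M ∧ ∀ x, |φ x| ≤ M := by
  obtain ⟨M, hM⟩ := h.continuous.bounded_above_of_compact_support h.compact
  exact ⟨M, (norm_nonneg _).trans (hM 0), hM⟩

lemma IsTestFunction.memLp_deriv {φ : ℝ → ℝ} (h : IsTestFunction φ) :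
    MemLp (deriv φ) 2 volume :=
  h.continuous_deriv.memLp_of_hasCompactSupport h.compact.deriv

lemma IsTestFunction.integrable_sq {φ : ℝ → ℝ} (h : IsTestFunction φ) :
    Integrable fun x => φ x ^ 2 :=
  (h.continuous.memLp_of_hasCompactSupport (p := 2) h.compact).integrable_sq

lemma continuous_variationKernel {a φ : ℝ → ℝ} (ha : Continuous a) (hφ : Continuous φ) :
    Continuous (variationKernel a φ) := by
  unfold variationKernel; fun_prop

/-- Near the diagonal the kernel is controlled by the Gagliardo integrands of φ and a, away from it
by φ² times z⁻². The truncation at 2 in the kernel is what makes the second regime work, since a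
need not be bounded a priori. -/
lemma integrable_variationKernel {a g φ : ℝ → ℝ} (h : IsPrim a g) (hg : MemLp g 2 volume)
    (hφ : IsTestFunction φ) :
    Integrable (fun p : ℝ × ℝ => variationKernel a φ p ^ 2 / (p.1 - p.2) ^ 2)
      (volume.prod volume) := by
  obtain ⟨M, hM0, hM⟩ := hφ.exists_bound
  have i1 := (integrable_strip_quadKernel hφ.isPrim hφ.memLp_deriv).const_mul 2
  have i2 := (integrable_strip_quadKernel h hg).const_mul (2 * M ^ 2)
  have i3 := (integrable_mul_comp_sub hφ.integrable_sq integrable_farKernel).const_mul 12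
  have i4 := (integrable_mul_comp_sub' hφ.integrable_sq integrable_farKernel).const_mul 4
  refine (((i1.add i2).add i3).add i4).mono' ?_ (Eventually.of_forall fun ⟨x, y⟩ => ?_)
  · have := (continuous_variationKernel h.continuous hφ.continuous).measurable
    exact Measurable.aestronglyMeasurable (by fun_prop)
  · rw [Real.norm_of_nonneg (by positivity)]
    simp only [Pi.add_apply]
    rw [← neg_sub x y, farKernel_neg]
    simp only [variationKernel]
    set P := |φ x - φ y|
    set m := min 2 |a x - a y|
    have hm0 : 0 ≤ m := by positivity
    have hsq : (P + |φ y| * m) ^ 2 ≤ 2 * P ^ 2 + 2 * (φ y ^ 2 * m ^ 2) := by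
      have : (|φ y| * m) ^ 2 = φ y ^ 2 * m ^ 2 := by rw [mul_pow, sq_abs]
      nlinarith [sq_nonneg (P - |φ y| * m)]
    have hd0 : 0 ≤ ((x - y) ^ 2)⁻¹ := by positivity
    by_cases hs : |x - y| < 1
    · rw [indicator_of_mem (by exact hs), indicator_of_mem (by exact hs), farKernel, if_pos hs,
        mul_zero, mul_zero, mul_zero, mul_zero, add_zero, add_zero]
      simp only [quadKernel, div_eq_mul_inv]
      have e1 : m ^ 2 ≤ (a x - a y) ^ 2 := by
        rw [← sq_abs (a x - a y)]; exact pow_le_pow_left₀ hm0 (min_le_right _ _) 2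
      have e2 : φ y ^ 2 ≤ M ^ 2 := by
        rw [← sq_abs]; exact pow_le_pow_left₀ (abs_nonneg _) (hM y) 2
      have e3 : φ y ^ 2 * m ^ 2 ≤ M ^ 2 * (a x - a y) ^ 2 :=
        mul_le_mul e2 e1 (sq_nonneg _) (sq_nonneg _)
      have e4 : P ^ 2 = (φ x - φ y) ^ 2 := sq_abs _
      calc _ ≤ (2 * (φ x - φ y) ^ 2 + 2 * (M ^ 2 * (a x - a y) ^ 2)) * ((x - y) ^ 2)⁻¹ :=
            mul_le_mul_of_nonneg_right (by rw [← e4]; linarith) hd0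
        _ = _ := by ring
    · rw [indicator_of_notMem (by exact hs), indicator_of_notMem (by exact hs), farKernel,
        if_neg hs]
      simp only [div_eq_mul_inv]
      have e1 : m ^ 2 ≤ 4 := by
        nlinarith [min_le_left 2 |a x - a y|]
      have e4 : P ^ 2 = (φ x - φ y) ^ 2 := sq_abs _
      have e5 : φ y ^ 2 * m ^ 2 ≤ 4 * φ y ^ 2 := by nlinarith [sq_nonneg (φ y)]
      have e6 : P ^ 2 ≤ 2 * φ x ^ 2 + 2 * φ y ^ 2 := by
        rw [e4]; nlinarith [sq_nonneg (φ x + φ y)]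
      calc _ ≤ (4 * φ x ^ 2 + 12 * φ y ^ 2) * ((x - y) ^ 2)⁻¹ :=
            mul_le_mul_of_nonneg_right (by linarith) hd0
        _ = _ := by ring

/-! ### Second-order Taylor estimates -/

lemma abs_sin_sub_self_le (y : ℝ) : |Real.sin y - y| ≤ 2 * y ^ 2 := by
  wlog hy : 0 ≤ y generalizing y
  · have := this (-y) (by linarith)
    rw [Real.sin_neg, neg_sq] at this
    rw [← abs_neg]
    exact (congrArg _ (by ring)).trans_le this
  rcases eq_or_lt_of_le hy with rfl | hy'
  · simp
  have h1 := Real.sin_lt hy'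
  rw [abs_of_nonpos (by linarith)]
  rcases le_or_gt y 1 with h | h
  · have := Real.sin_gt_sub_cube hy'
    nlinarith [mul_nonneg (sq_nonneg y) (sub_nonneg.2 h)]
  · have := Real.neg_one_le_sin y
    nlinarith

lemma abs_cos_sub_one_le (y : ℝ) : |Real.cos y - 1| ≤ y ^ 2 / 2 := by
  rw [abs_of_nonpos (by linarith [Real.cos_le_one y])]
  linarith [Real.one_sub_sq_div_two_le_cos (x := y)]

lemma abs_sin_sq_taylor_le (s h : ℝ) :
    |Real.sin (s + h) ^ 2 - Real.sin s ^ 2 - 2 * h * (Real.sin s * Real.cos s)| ≤ 5 * h ^ 2 := by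
  have e : Real.sin (s + h) ^ 2 - Real.sin s ^ 2 - 2 * h * (Real.sin s * Real.cos s) =
      Real.cos (2 * s) * Real.sin h ^ 2 + Real.sin (2 * s) * ((Real.sin (2 * h) - 2 * h) / 2) := by
    rw [Real.sin_add, Real.cos_two_mul, Real.sin_two_mul, Real.sin_two_mul]
    have h1 := Real.sin_sq_add_cos_sq s
    have h2 := Real.sin_sq_add_cos_sq h
    have h3 : Real.cos h ^ 2 = 1 - Real.sin h ^ 2 := by linarith
    have h4 : Real.cos s ^ 2 = 1 - Real.sin s ^ 2 := by linarith
    ring_nf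
    rw [h3, h4]; ring
  rw [e]
  refine (abs_add_le _ _).trans ?_
  rw [abs_mul, abs_mul]
  have h1 := abs_sin_sub_self_le (2 * h)
  have h2 : |Real.sin h ^ 2| ≤ h ^ 2 := by
    rw [abs_of_nonneg (sq_nonneg _), ← sq_abs, ← sq_abs h]
    exact pow_le_pow_left₀ (abs_nonneg _) Real.abs_sin_le_abs 2
  have h3 : |(Real.sin (2 * h) - 2 * h) / 2| ≤ 4 * h ^ 2 := by
    rw [abs_div, abs_two]; linarith
  have h4 := mul_le_mul (Real.abs_cos_le_one (2 * s)) h2 (abs_nonneg _) zero_le_one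
  have h5 := mul_le_mul (Real.abs_sin_le_one (2 * s)) h3 (abs_nonneg _) zero_le_one
  linarith

lemma abs_cos_sub_cos_le_mul {h k : ℝ} : |Real.cos h - Real.cos k| ≤ |h + k| * |h - k| / 2 := by
  rw [Real.cos_sub_cos, abs_mul, abs_mul, abs_neg, abs_two]
  have h1 : |Real.sin ((h + k) / 2)| ≤ |h + k| / 2 := by
    refine Real.abs_sin_le_abs.trans ?_
    rw [abs_div, abs_two]
  have h2 : |Real.sin ((h - k) / 2)| ≤ |h - k| / 2 := by
    refine Real.abs_sin_le_abs.trans ?_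
    rw [abs_div, abs_two]
  have := mul_le_mul h1 h2 (abs_nonneg _) (by positivity)
  linarith

/-- The increment of the remainder sin y - y must carry a factor that vanishes with h - k, as it is
later divided by the squared distance of two points. The sum-to-product formula displays this
factor. -/
lemma abs_sin_remainder_sub_le (h k : ℝ) :
    |(Real.sin h - h) - (Real.sin k - k)| ≤ (h - k) ^ 2 + |h - k| * ((h + k) ^ 2 / 8) := by
  have e : (Real.sin h - h) - (Real.sin k - k) =
      2 * ((Real.sin ((h - k) / 2) - (h - k) / 2) * Real.cos ((h + k) / 2)) +
        (h - k) * (Real.cos ((h + k) / 2) - 1) := by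
    have := Real.sin_sub_sin h k
    linarith
  rw [e]
  refine (abs_add_le _ _).trans ?_
  rw [abs_mul, abs_mul, abs_mul, abs_two]
  have h1 := abs_sin_sub_self_le ((h - k) / 2)
  have h2 := abs_cos_sub_one_le ((h + k) / 2)
  have h3 := mul_le_mul h1 (Real.abs_cos_le_one ((h + k) / 2)) (abs_nonneg _) (by positivity)
  have h4 := mul_le_mul_of_nonneg_left h2 (abs_nonneg (h - k))
  nlinarith

/-- Pointwise second-order expansion of increments of `sin (a + t φ)`. -/
lemma abs_increment_taylor_le {M t a b p q : ℝ} (ht : |t| ≤ 1) (hp : |p| ≤ M)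
    (hq : |q| ≤ M) :
    |(Real.sin (a + t * p) - Real.sin (b + t * q)) - (Real.sin a - Real.sin b) -
      t * (Real.cos a * p - Real.cos b * q)| ≤
      t ^ 2 * ((4 * M + M ^ 2) * (|p - q| + |q| * min 2 |a - b|)) := by
  have hM : 0 ≤ M := (abs_nonneg p).trans hp
  set m := min 2 |a - b| with hm
  have hm0 : 0 ≤ m := by positivity
  have ht0 := abs_nonneg t
  have hsab : |Real.sin a - Real.sin b| ≤ m := by
    refine le_min ?_ (Real.abs_sin_sub_sin_le a b)
    refine (abs_sub _ _).trans ?_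
    linarith [Real.abs_sin_le_one a, Real.abs_sin_le_one b]
  have hcab : |Real.cos a - Real.cos b| ≤ m := by
    refine le_min ?_ (Real.abs_cos_sub_cos_le a b)
    refine (abs_sub _ _).trans ?_
    linarith [Real.abs_cos_le_one a, Real.abs_cos_le_one b]
  -- Every summand contains a difference, of the two increments or of the two base points; this
  -- produces the factors |p - q| and |q| min(2, |a - b|) of the bound. Adding the coefficients
  -- gives at most 3M + M² and 3M, covered by the common constant 4M + M².
  have e : (Real.sin (a + t * p) - Real.sin (b + t * q)) - (Real.sin a - Real.sin b) -
      t * (Real.cos a * p - Real.cos b * q) =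
      Real.sin a * (Real.cos (t * p) - Real.cos (t * q)) +
      (Real.sin a - Real.sin b) * (Real.cos (t * q) - 1) +
      Real.cos a * ((Real.sin (t * p) - t * p) - (Real.sin (t * q) - t * q)) +
      (Real.cos a - Real.cos b) * (Real.sin (t * q) - t * q) := by
    rw [Real.sin_add, Real.sin_add]; ring
  have t2 : |t| ^ 2 = t ^ 2 := sq_abs t
  have b1 : |Real.cos (t * p) - Real.cos (t * q)| ≤ t ^ 2 * (M * |p - q|) := by
    refine abs_cos_sub_cos_le_mul.trans ?_
    rw [← mul_add, ← mul_sub, abs_mul, abs_mul, ← t2]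
    have h1 : |p + q| ≤ 2 * M := (abs_add_le _ _).trans (by linarith)
    have := mul_le_mul_of_nonneg_right h1 (abs_nonneg (p - q))
    nlinarith [mul_le_mul_of_nonneg_left this (sq_nonneg |t|)]
  have qM : q ^ 2 ≤ M * |q| := by
    rw [← sq_abs, pow_two]; exact mul_le_mul_of_nonneg_right hq (abs_nonneg _)
  have b2 : |Real.cos (t * q) - 1| ≤ t ^ 2 * (M * |q|) := by
    refine (abs_cos_sub_one_le _).trans ?_
    rw [mul_pow]
    nlinarith [mul_le_mul_of_nonneg_left qM (sq_nonneg t), sq_nonneg (t * q)]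
  have b4 : |Real.sin (t * q) - t * q| ≤ t ^ 2 * (2 * M * |q|) := by
    refine (abs_sin_sub_self_le _).trans ?_
    rw [mul_pow]
    nlinarith [mul_le_mul_of_nonneg_left qM (sq_nonneg t)]
  have b3 : |(Real.sin (t * p) - t * p) - (Real.sin (t * q) - t * q)| ≤
      t ^ 2 * ((2 * M + M ^ 2) * |p - q|) := by
    refine (abs_sin_remainder_sub_le _ _).trans ?_
    rw [← mul_sub, ← mul_add, mul_pow, mul_pow, abs_mul]
    have h1 : (p - q) ^ 2 ≤ 2 * M * |p - q| := by
      rw [← sq_abs, pow_two]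
      exact mul_le_mul_of_nonneg_right ((abs_sub _ _).trans (by linarith)) (abs_nonneg _)
    have h2 : (p + q) ^ 2 ≤ 4 * M ^ 2 := by
      rw [← sq_abs]
      have := (abs_add_le p q).trans (add_le_add hp hq)
      nlinarith [abs_nonneg (p + q)]
    have h3 : |t| * |p - q| * (t ^ 2 * (p + q) ^ 2 / 8) ≤ t ^ 2 * (M ^ 2 * |p - q|) := by
      have h4 : |t| * |p - q| ≤ |p - q| := mul_le_of_le_one_left (abs_nonneg _) ht
      have h5 : t ^ 2 * (p + q) ^ 2 / 8 ≤ t ^ 2 * M ^ 2 := by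
        nlinarith [mul_le_mul_of_nonneg_left h2 (sq_nonneg t), mul_nonneg (sq_nonneg t) (sq_nonneg M)]
      have := mul_le_mul h4 h5 (by positivity) (abs_nonneg _)
      linarith
    nlinarith [mul_le_mul_of_nonneg_left h1 (sq_nonneg t)]
  rw [e]
  refine (abs_add_le _ _).trans ((add_le_add_left ((abs_add_le _ _).trans
    (add_le_add_left (abs_add_le _ _) _)) _).trans ?_)
  simp only [abs_mul]
  have c1 := mul_le_mul (Real.abs_sin_le_one a) b1 (abs_nonneg _) zero_le_one
  have c2 := mul_le_mul hsab b2 (abs_nonneg _) hm0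
  have c3 := mul_le_mul (Real.abs_cos_le_one a) b3 (abs_nonneg _) zero_le_one
  have c4 := mul_le_mul hcab b4 (abs_nonneg _) hm0
  have c5 : 0 ≤ t ^ 2 * (|q| * m) * (M + M ^ 2) := by positivity
  have c6 : 0 ≤ t ^ 2 * |p - q| * M := by positivity
  nlinarith

/-- First-order expansion of an integral with a quadratic error term. -/
lemma integral_taylor {α : Type*} [MeasurableSpace α] {μ : Measure α} {f₀ f₁ r f : α → ℝ} {t : ℝ}
    (h₀ : Integrable f₀ μ) (h₁ : Integrable f₁ μ) (hr : Integrable r μ)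
    (hm : AEStronglyMeasurable f μ) (h : ∀ᵐ x ∂μ, |f x - f₀ x - t * f₁ x| ≤ t ^ 2 * r x) :
    Integrable f μ ∧ ∫ x, f x ∂μ ≤ ∫ x, f₀ x ∂μ + t * ∫ x, f₁ x ∂μ + t ^ 2 * ∫ x, r x ∂μ := by
  have hd : Integrable (fun x => f x - f₀ x - t * f₁ x) μ :=
    (hr.const_mul (t ^ 2)).mono' ((hm.sub h₀.1).sub (h₁.const_mul t).1) (by simpa using h)
  have hf : Integrable f μ := by
    refine ((hd.add h₀).add (h₁.const_mul t)).congr (Eventually.of_forall fun x => ?_)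
    simp only [Pi.add_apply]; ring
  refine ⟨hf, ?_⟩
  have e : ∫ x, (f₀ x + t * f₁ x + t ^ 2 * r x) ∂μ =
      ∫ x, f₀ x ∂μ + t * ∫ x, f₁ x ∂μ + t ^ 2 * ∫ x, r x ∂μ := by
    have h₂ : Integrable (fun x => f₀ x + t * f₁ x) μ := h₀.add (h₁.const_mul t)
    rw [integral_add h₂ (hr.const_mul _), integral_add h₀ (h₁.const_mul t),
      integral_const_mul, integral_const_mul]
  rw [← e]
  refine integral_mono_ae hf ((h₀.add (h₁.const_mul t)).add (hr.const_mul _)) ?_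
  filter_upwards [h] with x hx
  linarith [le_abs_self (f x - f₀ x - t * f₁ x)]

/-! ### The first variation -/

/-- The kernel of the bilinear form associated with `quadKernel`. -/
noncomputable def bilinKernel (u w : ℝ → ℝ) (p : ℝ × ℝ) : ℝ :=
  (u p.1 - u p.2) * (w p.1 - w p.2) / (p.1 - p.2) ^ 2

/-- The density of the local part of the first variation. -/
noncomputable def locVariation (β ν : ℝ) (a g φ : ℝ → ℝ) (x : ℝ) : ℝ :=
  g x * deriv φ x + Real.sin (a x + β) * Real.cos (a x + β) * φ x +
    ν / (2 * Real.pi) * (Real.sin (a x) * Real.cos (a x) * (φ x / x))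

lemma IsTestFunction.exists_abs_div_le {φ : ℝ → ℝ} (h : IsTestFunction φ) :
    ∃ c, 0 ≤ c ∧ ∀ x, |φ x / x| ≤ c * |φ x| := by
  obtain ⟨A, B, hA, _, h0⟩ := h.exists_Icc
  refine ⟨A⁻¹, by positivity, fun x => ?_⟩
  by_cases hx : x ∈ Icc A B
  · have hx0 : 0 < x := hA.trans_le hx.1
    rw [abs_div, abs_of_pos hx0, div_eq_inv_mul]
    exact mul_le_mul_of_nonneg_right (inv_anti₀ hA hx.1) (abs_nonneg _)
  · simp [h0 x hx]

lemma integrable_locVariation {β ν : ℝ} {a g φ : ℝ → ℝ} (h : IsPrim a g) (hφ : IsTestFunction φ) :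
    Integrable (locVariation β ν a g φ) := by
  obtain ⟨c, hc, hφc⟩ := hφ.exists_abs_div_le
  have ha := h.continuous
  have iφ : Integrable φ := hφ.continuous.integrable_of_hasCompactSupport hφ.compact
  refine (Integrable.add ?_ ?_).add ?_
  · simpa using h.locInt.integrable_smul_right_of_hasCompactSupport hφ.continuous_deriv
      hφ.compact.deriv
  · exact (Continuous.mul (by fun_prop) hφ.continuous).integrable_of_hasCompactSupport
      hφ.compact.mul_left
  · refine Integrable.const_mul ?_ _
    refine (iφ.norm.const_mul c).mono' ?_ (Eventually.of_forall fun x => ?_)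
    · have h1 := ha.measurable
      have h2 := hφ.continuous.measurable
      exact Measurable.aestronglyMeasurable (by fun_prop)
    · rw [norm_mul, norm_mul, Real.norm_eq_abs (φ x / x)]
      have h1 := mul_le_mul (Real.abs_sin_le_one (a x)) (Real.abs_cos_le_one (a x))
        (abs_nonneg _) zero_le_one
      have h2 := mul_le_mul h1 (hφc x) (abs_nonneg _) (by norm_num)
      simpa only [one_mul, Real.norm_eq_abs] using h2

lemma IsPrim.add_test {a g φ : ℝ → ℝ} (h : IsPrim a g) (hφ : IsTestFunction φ) (t : ℝ) :
    IsPrim (fun x => a x + t * φ x) (fun x => g x + t * deriv φ x) := by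
  have h1 := (hφ.continuous_deriv.intervalIntegrable (μ := volume))
  refine ⟨h.locInt.add (continuous_const.mul hφ.continuous_deriv).locallyIntegrable,
    fun x y => ?_⟩
  rw [intervalIntegral.integral_add (h.ii x y) ((h1 x y).const_mul t),
    intervalIntegral.integral_const_mul, ← h.eq, ← hφ.isPrim.eq]
  ring

/-- With D and W the increments of the sine before and after the variation and Z the first-order
change, the remainder of the square is 2D(W - D - tZ) + (W - D)². Young's inequality separates D²
from K², both integrable after division by the squared distance. -/
lemma abs_bilinear_taylor_le {D W Z K t C : ℝ} (hC : 0 ≤ C) (ht : |t| ≤ 1) (hK : 0 ≤ K)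
    (h1 : |W - D - t * Z| ≤ t ^ 2 * (C * K)) (h2 : |Z| ≤ K) :
    |W ^ 2 - D ^ 2 - t * (2 * (D * Z))| ≤ t ^ 2 * (C * D ^ 2 + (C + (1 + C) ^ 2) * K ^ 2) := by
  have ht0 := abs_nonneg t
  have t2 : |t| ^ 2 = t ^ 2 := sq_abs t
  have e : W ^ 2 - D ^ 2 - t * (2 * (D * Z)) = 2 * D * (W - D - t * Z) + (W - D) ^ 2 := by ring
  have hW : |W - D| ≤ |t| * ((1 + C) * K) := by
    have : W - D = (W - D - t * Z) + t * Z := by ring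
    rw [this]
    refine (abs_add_le _ _).trans ?_
    rw [abs_mul]
    have h3 : t ^ 2 * (C * K) ≤ |t| * (C * K) := by
      rw [← t2]; exact mul_le_mul_of_nonneg_right (by nlinarith) (by positivity)
    nlinarith [mul_le_mul_of_nonneg_left h2 ht0]
  have hW2 : (W - D) ^ 2 ≤ t ^ 2 * ((1 + C) ^ 2 * K ^ 2) := by
    rw [← sq_abs]
    refine (pow_le_pow_left₀ (abs_nonneg _) hW 2).trans (le_of_eq ?_)
    rw [mul_pow, mul_pow, t2]
  rw [e]
  refine (abs_add_le _ _).trans ?_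
  rw [abs_of_nonneg (sq_nonneg (W - D)), abs_mul, abs_mul, abs_two]
  have h3 : 2 * |D| * |W - D - t * Z| ≤ t ^ 2 * (C * D ^ 2 + C * K ^ 2) := by
    have h4 := mul_le_mul_of_nonneg_left h1 (by positivity : 0 ≤ 2 * |D|)
    have h5 : 2 * |D| * K ≤ D ^ 2 + K ^ 2 := by
      nlinarith [sq_nonneg (|D| - K), sq_abs D]
    have h6 := mul_le_mul_of_nonneg_left h5 (by positivity : 0 ≤ t ^ 2 * C)
    nlinarith
  nlinarith

/-- For L ≠ 0 the choice t = -L/M with M = 2(|C| + |L|) satisfies |t| ≤ 1 and gives the value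
(L²/M²)(C - M) < 0. -/
lemma eq_zero_of_linear_le_quadratic {L C : ℝ} (h : ∀ t, |t| ≤ 1 → 0 ≤ t * L + t ^ 2 * C) :
    L = 0 := by
  by_contra hL
  set M := 2 * (|C| + |L|) with hM
  have hL' := abs_pos.2 hL
  have hM0 : 0 < M := by have := abs_nonneg C; positivity
  have h1 := h (-L / M) (by
    rw [abs_div, abs_neg, abs_of_pos hM0, div_le_one hM0]; linarith [abs_nonneg C])
  have e : -L / M * L + (-L / M) ^ 2 * C = L ^ 2 / M ^ 2 * (C - M) := by field_simp; ring
  rw [e] at h1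
  have h2 : 0 < L ^ 2 / M ^ 2 := by positivity
  have h3 : C - M < 0 := by linarith [le_abs_self C, abs_nonneg C]
  nlinarith

/-- The Euler-Lagrange equation of a minimizer in weak form. -/
theorem IsProfile.weak_eulerLagrange {β ν : ℝ} {η θ a g φ : ℝ → ℝ} (hν : 0 < ν)
    (hη : IsCutoff β η) (hmin : IsMinimizer β ν η θ) (h : IsProfile β ν η θ a g)
    (hφ : IsTestFunction φ) :
    (∫ x, locVariation β ν a g φ x) + ν / (4 * Real.pi) *
      (∫ p, bilinKernel (fun x => Real.sin (a x)) (fun x => Real.cos (a x) * φ x) p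
        ∂(halfLine.prod halfLine)) = 0 := by
  obtain ⟨M, hM0, hM⟩ := hφ.exists_bound
  obtain ⟨c, hc, hφc⟩ := hφ.exists_abs_div_le
  have ha := h.prim.continuous
  set C := 4 * M + M ^ 2 with hC
  have hC0 : 0 ≤ C := by positivity
  set u : ℝ → ℝ := fun x => Real.sin (a x) with hu
  set w : ℝ → ℝ := fun x => Real.cos (a x) * φ x with hw
  set k := |ν / (4 * Real.pi)| with hk
  have hk0 : 0 ≤ k := abs_nonneg _
  set K := variationKernel a φ with hK
  have iK : Integrable (fun p : ℝ × ℝ => K p ^ 2 / (p.1 - p.2) ^ 2) (halfLine.prod halfLine) :=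
    (integrable_variationKernel h.prim h.memLp hφ).mono_measure halfLine_prod_le
  have hZ : ∀ p, |w p.1 - w p.2| ≤ K p := by
    intro p
    have e : w p.1 - w p.2 =
        Real.cos (a p.1) * (φ p.1 - φ p.2) + φ p.2 * (Real.cos (a p.1) - Real.cos (a p.2)) := by
      simp only [hw]; ring
    rw [e]
    refine (abs_add_le _ _).trans (add_le_add ?_ ?_)
    · rw [abs_mul]; exact mul_le_of_le_one_left (abs_nonneg _) (Real.abs_cos_le_one _)
    · rw [abs_mul]
      refine mul_le_mul_of_nonneg_left (le_min ?_ (Real.abs_cos_sub_cos_le _ _)) (abs_nonneg _)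
      refine (abs_sub _ _).trans ?_
      linarith [Real.abs_cos_le_one (a p.1), Real.abs_cos_le_one (a p.2)]
  have mB : Measurable (bilinKernel u w) := by
    have h1 := ha.measurable
    have h2 := hφ.continuous.measurable
    unfold bilinKernel; fun_prop
  have iB : Integrable (bilinKernel u w) (halfLine.prod halfLine) := by
    refine (h.integrable_quad.add iK).mono' mB.aestronglyMeasurable
      (Eventually.of_forall fun p => ?_)
    simp only [Pi.add_apply, quadKernel, bilinKernel]
    rw [norm_div, Real.norm_of_nonneg (sq_nonneg (p.1 - p.2)), ← add_div]
    refine div_le_div_of_nonneg_right ?_ (sq_nonneg _)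
    rw [norm_mul, Real.norm_eq_abs, Real.norm_eq_abs]
    have := hZ p
    nlinarith [sq_abs (u p.1 - u p.2), sq_nonneg (|u p.1 - u p.2| - K p),
      abs_nonneg (u p.1 - u p.2), mul_le_mul_of_nonneg_left this (abs_nonneg (u p.1 - u p.2)),
      sq_nonneg (u p.1 - u p.2), sq_nonneg (K p)]
  have iV : Integrable (locVariation β ν a g φ) halfLine :=
    (integrable_locVariation h.prim hφ).mono_measure Measure.restrict_le_self
  set r₁ : ℝ → ℝ := fun x => deriv φ x ^ 2 + 5 * φ x ^ 2 + k * (5 * c * M) * |φ x|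
    with hr₁
  have ir₁ : Integrable r₁ halfLine := by
    refine Integrable.mono_measure ?_ Measure.restrict_le_self
    exact (hφ.memLp_deriv.integrable_sq.add (hφ.integrable_sq.const_mul _)).add
      ((hφ.continuous.integrable_of_hasCompactSupport hφ.compact).abs.const_mul _)
  set r₂ : ℝ × ℝ → ℝ := fun p => C * quadKernel u p + (C + (1 + C) ^ 2) *
    (K p ^ 2 / (p.1 - p.2) ^ 2) with hr₂
  have ir₂ : Integrable r₂ (halfLine.prod halfLine) :=
    (h.integrable_quad.const_mul _).add (iK.const_mul _)
  have loc : ∀ t : ℝ, |t| ≤ 1 → _ := fun t ht => integral_taylor (t := t) h.integrable_loc iV ir₁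
    (aestronglyMeasurable_locDensity hη (h.prim.add_test hφ t))
    (Eventually.of_forall fun x => by
      set s := t * φ x with hs
      have e : locDensity β ν η (fun x => a x + t * φ x) (fun x => g x + t * deriv φ x) x -
          locDensity β ν η a g x - t * locVariation β ν a g φ x =
          1 / 2 * (t ^ 2 * deriv φ x ^ 2) +
          1 / 2 * (Real.sin (a x + β + s) ^ 2 - Real.sin (a x + β) ^ 2 -
            2 * s * (Real.sin (a x + β) * Real.cos (a x + β))) +
          ν / (4 * Real.pi) * ((Real.sin (a x + s) ^ 2 - Real.sin (a x) ^ 2 -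
            2 * s * (Real.sin (a x) * Real.cos (a x))) / x) := by
        simp only [locDensity, locVariation, ← hs]
        rw [add_right_comm (a x) s β]
        have hpi := Real.pi_pos.ne'
        rw [hs]
        field_simp
        ring
      rw [e]
      have b1 := abs_sin_sq_taylor_le (a x + β) s
      have b2 := abs_sin_sq_taylor_le (a x) s
      have b3 : |(Real.sin (a x + s) ^ 2 - Real.sin (a x) ^ 2 -
            2 * s * (Real.sin (a x) * Real.cos (a x))) / x| ≤ t ^ 2 * (5 * c * M * |φ x|) := by
        rw [abs_div]
        refine (div_le_div_of_nonneg_right b2 (abs_nonneg _)).trans ?_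
        have h1 := hφc x
        rw [abs_div] at h1
        have h2 : 5 * s ^ 2 / |x| = t ^ 2 * (5 * |φ x| * (|φ x| / |x|)) := by
          rw [hs, mul_pow, ← sq_abs (φ x)]; ring
        rw [h2]
        refine mul_le_mul_of_nonneg_left ?_ (sq_nonneg t)
        have h3 := mul_le_mul_of_nonneg_left h1 (by positivity : 0 ≤ 5 * |φ x|)
        have h4 := mul_le_mul_of_nonneg_left (hM x) (by positivity : 0 ≤ 5 * c * |φ x|)
        linarith
      refine (abs_add_le _ _).trans ((add_le_add_left (abs_add_le _ _) _).trans ?_)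
      rw [abs_mul (1 / 2), abs_mul (1 / 2), abs_mul (ν / (4 * Real.pi)), abs_of_nonneg (by norm_num : (0 : ℝ) ≤ 1 / 2),
        abs_of_nonneg (by positivity : 0 ≤ t ^ 2 * deriv φ x ^ 2), ← hk]
      have b4 := mul_le_mul_of_nonneg_left b3 hk0
      have b5 : s ^ 2 = t ^ 2 * φ x ^ 2 := by rw [hs, mul_pow]
      rw [b5] at b1
      have b6 : 0 ≤ t ^ 2 * deriv φ x ^ 2 := by positivity
      have b7 : 0 ≤ t ^ 2 * φ x ^ 2 := by positivity
      simp only [hr₁]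
      linarith)
  have nonloc : ∀ t : ℝ, |t| ≤ 1 → _ := fun t ht => integral_taylor (t := t) h.integrable_quad
    (iB.const_mul 2) ir₂ (measurable_quadKernel (u := fun x => Real.sin (a x + t * φ x))
      (Real.continuous_sin.comp (ha.add (continuous_const.mul hφ.continuous)))).aestronglyMeasurable
    (Eventually.of_forall fun p => by
      simp only [quadKernel, bilinKernel, hr₂]
      have h1 := abs_increment_taylor_le (M := M) (t := t) (a := a p.1) (b := a p.2) ht
        (hM p.1) (hM p.2)
      have h2 := abs_bilinear_taylor_le hC0 ht (variationKernel_nonneg a φ p) h1 (hZ p)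
      set W := Real.sin (a p.1 + t * φ p.1) - Real.sin (a p.2 + t * φ p.2)
      set D := Real.sin (a p.1) - Real.sin (a p.2)
      have e1 : W ^ 2 / (p.1 - p.2) ^ 2 - D ^ 2 / (p.1 - p.2) ^ 2 -
          t * (2 * (D * (w p.1 - w p.2) / (p.1 - p.2) ^ 2)) =
          (W ^ 2 - D ^ 2 - t * (2 * (D * (w p.1 - w p.2)))) / (p.1 - p.2) ^ 2 := by ring
      have e2 : t ^ 2 * (C * (D ^ 2 / (p.1 - p.2) ^ 2) +
          (C + (1 + C) ^ 2) * (K p ^ 2 / (p.1 - p.2) ^ 2)) =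
          (t ^ 2 * (C * D ^ 2 + (C + (1 + C) ^ 2) * K p ^ 2)) / (p.1 - p.2) ^ 2 := by ring
      rw [e1, e2, abs_div, abs_of_nonneg (sq_nonneg (p.1 - p.2))]
      exact div_le_div_of_nonneg_right h2 (sq_nonneg _))
  have hpos : 0 ≤ ν / (8 * Real.pi) := by positivity
  have hV : ∫ x, locVariation β ν a g φ x = ∫ x in Ioi (0 : ℝ), locVariation β ν a g φ x := by
    rw [setIntegral_eq_integral_of_forall_compl_eq_zero]
    intro x hx
    simp [locVariation, hφ.eq_zero (not_lt.1 hx), hφ.deriv_eq_zero (not_lt.1 hx)]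
  -- The two Taylor bounds hold for all |t| ≤ 1, so comparing the energy at θ + tφ with its minimum
  -- leaves a nonnegative expression in t: a linear term plus a quadratic error.
  refine eq_zero_of_linear_le_quadratic (C := (∫ x in Ioi (0 : ℝ), r₁ x) +
    ν / (8 * Real.pi) * ∫ p, r₂ p ∂(halfLine.prod halfLine)) fun t ht => ?_
  obtain ⟨l1, l2⟩ := loc t ht
  obtain ⟨n1, n2⟩ := nonloc t ht
  have hE := hmin.2 _ (hmin.1.add_test hφ t)
  rw [energy_eq_realEnergy hν hη h.prim (fun x hx => h.eq_add x hx.le) h.integrable_loc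
    h.integrable_quad, energy_eq_realEnergy hν hη (h.prim.add_test hφ t)
    (fun x hx => by rw [h.eq_add x hx.le]; ring) l1 n1, EReal.coe_le_coe_iff, realEnergy,
    realEnergy] at hE
  rw [integral_const_mul] at n2
  have n3 := mul_le_mul_of_nonneg_left n2 hpos
  -- The factor 2 is the one produced by differentiating the squared increment.
  have e8 : ν / (4 * Real.pi) = 2 * (ν / (8 * Real.pi)) := by field_simp; norm_num
  rw [hV, e8]
  simp only [hu] at *
  nlinarith

/-! ### Extension by zero and the second-difference form of the nonlocal term -/

/-- The symmetric second difference `2 f(x) - f(x + z) - f(x - z)`. -/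
def secondDiff (f : ℝ → ℝ) (z x : ℝ) : ℝ := 2 * f x - f (x + z) - f (x - z)

lemma secondDiff_abs (f : ℝ → ℝ) (z x : ℝ) : secondDiff f |z| x = secondDiff f z x := by
  rcases abs_choice z with h | h <;> rw [h]
  unfold secondDiff; rw [sub_neg_eq_add, ← sub_eq_add_neg]; ring

/-- An admissible pair for the bilinear form: `u` vanishes on the negative half-line and `w` is
compactly supported in the positive one. -/
structure IsTestPair (u u' w w' : ℝ → ℝ) (A B : ℝ) : Prop where
  prim : IsPrim u u'
  memLp : MemLp u' 2 volume
  abs_le : ∀ x, |u x| ≤ 1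
  eq_zero : ∀ x, x ≤ 0 → u x = 0
  prim_test : IsPrim w w'
  memLp_test : MemLp w' 2 volume
  pos : 0 < A
  le : A ≤ B
  test_eq_zero : ∀ x, x ∉ Icc A B → w x = 0

namespace IsTestPair

variable {u u' w w' : ℝ → ℝ} {A B : ℝ}

lemma hasCompactSupport (h : IsTestPair u u' w w' A B) : HasCompactSupport w :=
  HasCompactSupport.intro isCompact_Icc h.test_eq_zero

lemma integrable_test (h : IsTestPair u u' w w' A B) : Integrable w :=
  h.prim_test.continuous.integrable_of_hasCompactSupport h.hasCompactSupport

lemma measurable_bilinKernel (h : IsTestPair u u' w w' A B) : Measurable (bilinKernel u w) := by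
  have h1 := h.prim.continuous.measurable
  have h2 := h.prim_test.continuous.measurable
  unfold bilinKernel; fun_prop

/-- Near the diagonal the product is dominated by the two Gagliardo integrands, far from it by |w|
z⁻² because |u| ≤ 1. -/
lemma integrable_bilinKernel (h : IsTestPair u u' w w' A B) :
    Integrable (bilinKernel u w) (volume.prod volume) := by
  have i1 := integrable_strip_quadKernel h.prim h.memLp
  have i2 := integrable_strip_quadKernel h.prim_test h.memLp_test
  have i3 := (integrable_mul_comp_sub h.integrable_test.abs integrable_farKernel).const_mul 2
  have i4 := (integrable_mul_comp_sub' h.integrable_test.abs integrable_farKernel).const_mul 2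
  refine (((i1.add i2).add i3).add i4).mono' h.measurable_bilinKernel.aestronglyMeasurable
    (Eventually.of_forall fun ⟨x, y⟩ => ?_)
  simp only [Pi.add_apply]
  rw [← neg_sub x y, farKernel_neg, bilinKernel, norm_div, norm_mul,
    Real.norm_of_nonneg (sq_nonneg _)]
  simp only [Real.norm_eq_abs]
  by_cases hs : |x - y| < 1
  · rw [indicator_of_mem (by exact hs), indicator_of_mem (by exact hs), farKernel, if_pos hs]
    simp only [quadKernel, mul_zero, add_zero]
    rw [← add_div]
    refine div_le_div_of_nonneg_right ?_ (sq_nonneg _)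
    have h1 := sq_abs (u x - u y)
    have h2 := sq_abs (w x - w y)
    nlinarith [sq_nonneg (|u x - u y| - |w x - w y|)]
  · rw [indicator_of_notMem (by exact hs), indicator_of_notMem (by exact hs), farKernel, if_neg hs,
      zero_add, zero_add, div_eq_mul_inv]
    have hd0 : 0 ≤ ((x - y) ^ 2)⁻¹ := by positivity
    have h1 : |u x - u y| ≤ 2 := (abs_sub _ _).trans (by linarith [h.abs_le x, h.abs_le y])
    have h2 : |w x - w y| ≤ |w x| + |w y| := abs_sub _ _
    have h3 := mul_le_mul h1 h2 (abs_nonneg _) (by norm_num)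
    have h4 := mul_le_mul_of_nonneg_right h3 hd0
    linarith

/-- This integral identifies the weight 1/x of the energy with the interaction of x with the whole
negative half-line. -/
lemma integral_Iic_inv_sq {x : ℝ} (hx : 0 < x) :
    ∫ y in Iic (0 : ℝ), ((x - y) ^ 2)⁻¹ = x⁻¹ := by
  have h1 : ∫ y in Iic (0 : ℝ), ((x - y) ^ 2)⁻¹ = ∫ y in Ioi (0 : ℝ), ((x + y) ^ 2)⁻¹ := by
    rw [← neg_zero, ← integral_comp_neg_Iic, neg_zero]
    simp only [← sub_eq_add_neg]
  have h2 : ∫ y in Ioi (0 : ℝ), ((x + y) ^ 2)⁻¹ = ∫ y in Ioi x, (y ^ 2)⁻¹ := by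
    have := (measurePreserving_add_left volume x).setIntegral_preimage_emb
      (measurableEmbedding_addLeft x) (fun y => (y ^ 2)⁻¹) (Ioi x)
    rw [← this]
    congr 2
    ext y; simp
  rw [h1, h2]
  have h3 := integral_Ioi_rpow_of_lt (a := -2) (by norm_num) hx
  have h4 : ∀ y ∈ Ioi x, (y ^ 2)⁻¹ = y ^ (-2 : ℝ) := fun y hy => by
    rw [Real.rpow_neg (hx.trans hy).le]; norm_cast
  rw [setIntegral_congr_fun measurableSet_Ioi h4, h3]
  norm_num
  rw [Real.rpow_neg_one]

/-- Split the plane into quadrants. Where both variables are negative the kernel vanishes; the two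
mixed quadrants agree by symmetry, and each reduces to u(x) w(x) ∫_{y<0} (x-y)⁻² dy = u(x) w(x)/x.
-/
lemma integral_bilinKernel_eq_add (h : IsTestPair u u' w w' A B) :
    ∫ p, bilinKernel u w p ∂(volume.prod volume) =
      ∫ p, bilinKernel u w p ∂(halfLine.prod halfLine) + 2 * ∫ x, u x * (w x / x) := by
  have hi := h.integrable_bilinKernel
  have hw0 : ∀ x, x ≤ 0 → w x = 0 := fun x hx =>
    h.test_eq_zero x fun hx' => absurd (h.pos.trans_le hx'.1) (not_lt.2 hx)
  set S : Set (ℝ × ℝ) := Ioi 0 ×ˢ Ioi 0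
  set T : Set (ℝ × ℝ) := Ioi 0 ×ˢ Iic 0
  have mS : MeasurableSet S := measurableSet_Ioi.prod measurableSet_Ioi
  have mT : MeasurableSet T := measurableSet_Ioi.prod measurableSet_Iic
  have hsymm : ∀ p : ℝ × ℝ, bilinKernel u w p.swap = bilinKernel u w p := fun p => by
    simp only [bilinKernel, Prod.fst_swap, Prod.snd_swap]
    congr 1 <;> ring
  have hpt : ∀ p, bilinKernel u w p = S.indicator (bilinKernel u w) p +
      T.indicator (bilinKernel u w) p + T.indicator (bilinKernel u w) p.swap := by
    rintro ⟨x, y⟩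
    rcases lt_or_ge 0 x with hx | hx <;> rcases lt_or_ge 0 y with hy | hy
    · simp [S, T, indicator, hx, hy, not_le.2 hx, not_le.2 hy]
    · simp [S, T, indicator, hx, hy, not_lt.2 hy]
    · have := hsymm (x, y)
      simp only [Prod.swap_prod_mk] at this
      simp [S, T, indicator, hx, hy, not_lt.2 hx, this]
    · simp [S, T, indicator, not_lt.2 hx, not_lt.2 hy, bilinKernel, h.eq_zero _ hx, h.eq_zero _ hy]
  have iS := hi.indicator mS
  have iT := hi.indicator mT
  have eT : ∫ p, T.indicator (bilinKernel u w) p ∂(volume.prod volume) = ∫ x, u x * (w x / x) := by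
    rw [integral_prod _ iT]
    refine integral_congr_ae (Eventually.of_forall fun x => ?_)
    simp only
    rcases lt_or_ge 0 x with hx | hx
    · have e : ∀ y, T.indicator (bilinKernel u w) (x, y) =
          (Iic (0 : ℝ)).indicator (fun y => u x * w x * ((x - y) ^ 2)⁻¹) y := by
        intro y
        rcases lt_or_ge 0 y with hy | hy
        · simp [T, indicator, not_le.2 hy]
        · simp [T, indicator, hx, hy, bilinKernel, h.eq_zero y hy, hw0 y hy, div_eq_mul_inv]
      simp only [e]
      rw [integral_indicator measurableSet_Iic, integral_const_mul, integral_Iic_inv_sq hx]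
      ring
    · have e : ∀ y, T.indicator (bilinKernel u w) (x, y) = 0 := fun y => by
        simp [T, indicator, not_lt.2 hx]
      simp [e, hw0 x hx]
  calc _ = ∫ p, (S.indicator (bilinKernel u w) p + T.indicator (bilinKernel u w) p +
        T.indicator (bilinKernel u w) p.swap) ∂(volume.prod volume) :=
        integral_congr_ae (Eventually.of_forall hpt)
    _ = _ := by
      have iST : Integrable (fun p => S.indicator (bilinKernel u w) p +
        T.indicator (bilinKernel u w) p) (volume.prod volume) := iS.add iT
      have iTs : Integrable (fun p : ℝ × ℝ => T.indicator (bilinKernel u w) p.swap)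
        (volume.prod volume) := iT.swap
      rw [integral_add iST iTs, integral_add iS iT,
        integral_prod_swap (T.indicator (bilinKernel u w)), eT, integral_indicator mS,
        halfLine, Measure.prod_restrict]
      ring

/-- Integrate along the lines y = x + z. For fixed z a translation collects both values of w at one
point, which turns the product of increments into w times a second difference of u. -/
lemma integral_bilinKernel_eq_secondDiff (h : IsTestPair u u' w w' A B) :
    ∫ p, bilinKernel u w p ∂(volume.prod volume) =
      2 * ∫ z in Ioi (0 : ℝ), (∫ x, w x * secondDiff u z x) / z ^ 2 := by
  have hi := h.integrable_bilinKernel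
  have mp := measurePreserving_prod_add (volume : Measure ℝ) (volume : Measure ℝ)
  have hi2 : Integrable (fun q : ℝ × ℝ => bilinKernel u w (q.1, q.1 + q.2))
      (volume.prod volume) := mp.integrable_comp_of_integrable hi
  have e1 : ∫ p, bilinKernel u w p ∂(volume.prod volume) =
      ∫ q : ℝ × ℝ, bilinKernel u w (q.1, q.1 + q.2) ∂(volume.prod volume) := by
    conv_lhs => rw [← mp.map_eq]
    exact integral_map mp.measurable.aemeasurable h.measurable_bilinKernel.aestronglyMeasurable
  rw [e1, integral_prod_symm _ hi2]
  have cu := h.prim.continuous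
  have cw := h.prim_test.continuous
  have e2 : ∀ z, ∫ y, bilinKernel u w (y, y + z) = (∫ x, w x * secondDiff u z x) / z ^ 2 := by
    intro z
    have i1 : Integrable fun y => w y * (u (y + z) - u y) :=
      (cw.mul (by fun_prop)).integrable_of_hasCompactSupport h.hasCompactSupport.mul_right
    have i2 : Integrable fun y => w y * (u y - u (y - z)) :=
      (cw.mul (by fun_prop)).integrable_of_hasCompactSupport h.hasCompactSupport.mul_right
    -- The first product is the translate by z of y ↦ w(y)(u(y) - u(y-z)), so its integral is
    -- unchanged when the shift is removed.
    have e3 : ∀ y, bilinKernel u w (y, y + z) =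
        (w (y + z) * (u (y + z) - u (y + z - z)) - w y * (u (y + z) - u y)) / z ^ 2 := by
      intro y
      simp only [bilinKernel, add_sub_cancel_right, sub_add_cancel_left]
      congr 1 <;> ring
    simp only [e3]
    rw [integral_div, integral_sub (i2.comp_add_right z) i1,
      integral_add_right_eq_self (fun y => w y * (u y - u (y - z))) z, ← integral_sub i2 i1]
    congr 2
    ext y
    unfold secondDiff; ring
  simp only [e2]
  -- The second difference is even in z, so the line integral is twice that over z > 0.
  have e4 := integral_comp_abs (f := fun z => (∫ x, w x * secondDiff u z x) / z ^ 2)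
  simp only [secondDiff_abs, sq_abs] at e4
  exact e4

end IsTestPair

/-- The angular coefficient `ν / (2 π)` of the nonlocal term. -/
noncomputable def coeff (ν : ℝ) : ℝ := ν / (2 * Real.pi)

lemma IsProfile.memLp_cos_mul {β ν : ℝ} {η θ a g : ℝ → ℝ} (h : IsProfile β ν η θ a g) :
    MemLp (fun x => Real.cos (a x) * g x) 2 volume := by
  refine h.memLp.of_le ((Real.continuous_cos.comp h.prim.continuous).aestronglyMeasurable.mul
    h.memLp.1) (Eventually.of_forall fun x => ?_)
  rw [norm_mul]
  exact mul_le_of_le_one_left (norm_nonneg _) (Real.abs_cos_le_one _)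

lemma IsProfile.isTestPair {β ν : ℝ} {η θ a g φ : ℝ → ℝ} (h : IsProfile β ν η θ a g)
    (hφ : IsTestFunction φ) :
    ∃ A B, IsTestPair (fun x => Real.sin (a x)) (fun x => Real.cos (a x) * g x)
      (fun x => Real.cos (a x) * φ x)
      (fun x => -Real.sin (a x) * g x * φ x + Real.cos (a x) * deriv φ x) A B := by
  obtain ⟨A, B, hA, hAB, h0⟩ := hφ.exists_Icc
  obtain ⟨M, hM0, hM⟩ := hφ.exists_bound
  have ca := h.prim.continuous
  refine ⟨A, B, h.prim.sin, h.memLp_cos_mul, fun x => Real.abs_sin_le_one _,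
    fun x hx => by simp [h.eq_zero x hx], h.prim.cos.mul hφ.isPrim, ?_, hA, hAB,
    fun x hx => by simp [h0 x hx]⟩
  refine MemLp.add ?_ ?_
  · refine (h.memLp.const_mul M).of_le ?_ (Eventually.of_forall fun x => ?_)
    · exact ((Real.continuous_sin.comp ca).neg.aestronglyMeasurable.mul h.memLp.1).mul
        hφ.continuous.aestronglyMeasurable
    · rw [norm_mul, norm_mul, norm_mul, norm_neg, Real.norm_of_nonneg hM0, mul_comm M]
      refine mul_le_mul (mul_le_of_le_one_left (norm_nonneg _) (Real.abs_sin_le_one _)) (hM x)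
        (norm_nonneg _) (norm_nonneg _)
  · exact ((Real.continuous_cos.comp ca).mul hφ.continuous_deriv).memLp_of_hasCompactSupport
      hφ.compact.deriv.mul_left

/-- The weak Euler-Lagrange equation with the nonlocal term expressed by second differences. -/
theorem IsProfile.weak_secondDiff {β ν : ℝ} {η θ a g φ : ℝ → ℝ} (hν : 0 < ν)
    (hη : IsCutoff β η) (hmin : IsMinimizer β ν η θ) (h : IsProfile β ν η θ a g)
    (hφ : IsTestFunction φ) :
    (∫ x, g x * deriv φ x) + (∫ x, Real.sin (a x + β) * Real.cos (a x + β) * φ x) +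
      coeff ν * ∫ z in Ioi (0 : ℝ),
        (∫ x, Real.cos (a x) * φ x * secondDiff (fun x => Real.sin (a x)) z x) / z ^ 2 = 0 := by
  obtain ⟨A, B, hp⟩ := h.isTestPair hφ
  have h1 := h.weak_eulerLagrange hν hη hmin hφ
  have h2 := hp.integral_bilinKernel_eq_add
  rw [hp.integral_bilinKernel_eq_secondDiff] at h2
  have ca := h.prim.continuous
  have i1 : Integrable fun x => g x * deriv φ x := by
    simpa using h.prim.locInt.integrable_smul_right_of_hasCompactSupport hφ.continuous_deriv
      hφ.compact.deriv
  have i2 : Integrable fun x => Real.sin (a x + β) * Real.cos (a x + β) * φ x :=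
    (Continuous.mul (by fun_prop) hφ.continuous).integrable_of_hasCompactSupport
      hφ.compact.mul_left
  have i12 : Integrable fun x => g x * deriv φ x +
    Real.sin (a x + β) * Real.cos (a x + β) * φ x := i1.add i2
  have i3 : Integrable fun x =>
      ν / (2 * Real.pi) * (Real.sin (a x) * Real.cos (a x) * (φ x / x)) := by
    have := (integrable_locVariation (β := β) (ν := ν) h.prim hφ).sub i12
    refine this.congr (Eventually.of_forall fun x => ?_)
    simp only [Pi.sub_apply, locVariation]; ring
  have e : ∫ x, locVariation β ν a g φ x = (∫ x, g x * deriv φ x) +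
      (∫ x, Real.sin (a x + β) * Real.cos (a x + β) * φ x) +
      coeff ν * ∫ x, Real.sin (a x) * (Real.cos (a x) * φ x / x) := by
    simp only [locVariation]
    rw [integral_add i12 i3, integral_add i1 i2, integral_const_mul, coeff]
    congr 3; ext x; ring
  have e4 : ν / (4 * Real.pi) = coeff ν / 2 := by rw [coeff]; field_simp; norm_num
  rw [e, e4] at h1
  -- Half of the coefficient times the quadrant identity trades the double integral over the
  -- quadrant and the 1/x term for the second-difference integral, with nothing left over.
  linear_combination h1 + coeff ν / 2 * h2

/-! ### Estimates for second differences; near and far fields -/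

lemma IsPrim.secondDiff_eq {f f' : ℝ → ℝ} (h : IsPrim f f') (z x : ℝ) :
    secondDiff f z x = ∫ s in (0 : ℝ)..z, (f' (x - s) - f' (x + s)) := by
  have i1 : IntervalIntegrable (fun s => f' (x - s)) volume 0 z := by
    simpa using (h.ii x (x - z)).comp_sub_left x
  have i2 : IntervalIntegrable (fun s => f' (x + s)) volume 0 z := by
    simpa using (h.ii x (x + z)).comp_add_left x
  rw [intervalIntegral.integral_sub i1 i2, intervalIntegral.integral_comp_sub_left,
    intervalIntegral.integral_comp_add_left, sub_zero, add_zero, ← h.eq, ← h.eq, secondDiff]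
  ring

lemma IsPrim.abs_secondDiff_le {f f' : ℝ → ℝ} (h : IsPrim f f') {z x c : ℝ} (hz : 0 ≤ z)
    (hb : ∀ s, 0 < s → s ≤ z → |f' (x - s) - f' (x + s)| ≤ c) : |secondDiff f z x| ≤ c * z := by
  rw [h.secondDiff_eq]
  have := intervalIntegral.norm_integral_le_of_norm_le_const (a := 0) (b := z) (C := c)
    (f := fun s => f' (x - s) - f' (x + s)) (fun s hs => by
      rw [uIoc_of_le hz] at hs; exact hb s hs.1 hs.2)
  rwa [sub_zero, abs_of_nonneg hz] at this

lemma abs_secondDiff_le_four {u : ℝ → ℝ} (hu : ∀ x, |u x| ≤ 1) (z x : ℝ) :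
    |secondDiff u z x| ≤ 4 := by
  unfold secondDiff
  have h1 := abs_le.1 (hu x)
  have h2 := abs_le.1 (hu (x + z))
  have h3 := abs_le.1 (hu (x - z))
  rw [abs_le]
  constructor <;> linarith [h1.1, h1.2, h2.1, h2.2, h3.1, h3.2]

lemma continuous_secondDiff {f : ℝ → ℝ} (hf : Continuous f) :
    Continuous fun q : ℝ × ℝ => secondDiff f q.1 q.2 := by
  unfold secondDiff; fun_prop

lemma measurable_secondDiff_div {f : ℝ → ℝ} (hf : Continuous f) :
    Measurable fun q : ℝ × ℝ => secondDiff f q.1 q.2 / q.1 ^ 2 :=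
  (continuous_secondDiff hf).measurable.div (by fun_prop)

/-- Fubini's theorem for a function tested with second differences. -/
lemma secondDiff_fubini_of_bound {f w b ρ : ℝ → ℝ} {S : Set ℝ} (hf : Continuous f)
    (hw : AEStronglyMeasurable w) (hS : MeasurableSet S) (hb : IntegrableOn b S)
    (hρ : Integrable ρ) (h : ∀ z ∈ S, ∀ x, |w x * (secondDiff f z x / z ^ 2)| ≤ b z * ρ x) :
    IntegrableOn (fun z => (∫ x, w x * secondDiff f z x) / z ^ 2) S ∧
      ∫ z in S, (∫ x, w x * secondDiff f z x) / z ^ 2 =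
        ∫ x, w x * ∫ z in S, secondDiff f z x / z ^ 2 := by
  have hi : Integrable (fun q : ℝ × ℝ => w q.2 * (secondDiff f q.1 q.2 / q.1 ^ 2))
      ((volume.restrict S).prod volume) := by
    refine (Integrable.mul_prod hb hρ).mono' ?_ ?_
    · exact hw.comp_snd.mul (measurable_secondDiff_div hf).aestronglyMeasurable
    · have h1 : ∀ᵐ q ∂((volume.restrict S).prod (volume : Measure ℝ)), q.1 ∈ S :=
        Measure.quasiMeasurePreserving_fst.ae (ae_restrict_mem hS)
      filter_upwards [h1] with q hq using h q.1 hq q.2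
  have e : ∀ z, (∫ x, w x * secondDiff f z x) / z ^ 2 =
      ∫ x, w x * (secondDiff f z x / z ^ 2) := fun z => by
    rw [← integral_div]; congr 1; ext x; ring
  simp only [e]
  refine ⟨hi.integral_prod_left, ?_⟩
  rw [integral_integral_swap hi]
  simp only [integral_const_mul]

lemma secondDiff_fubini {f w b : ℝ → ℝ} {S : Set ℝ} (hf : Continuous f) (hw : Integrable w)
    (hS : MeasurableSet S) (hb : IntegrableOn b S)
    (h : ∀ z ∈ S, ∀ x, w x ≠ 0 → |secondDiff f z x / z ^ 2| ≤ b z) :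
    IntegrableOn (fun z => (∫ x, w x * secondDiff f z x) / z ^ 2) S ∧
      ∫ z in S, (∫ x, w x * secondDiff f z x) / z ^ 2 =
        ∫ x, w x * ∫ z in S, secondDiff f z x / z ^ 2 :=
  secondDiff_fubini_of_bound hf hw.1 hS hb hw.norm fun z hz x => by
    by_cases hwx : w x = 0
    · simp [hwx]
    rw [abs_mul, mul_comm (b z)]
    exact mul_le_mul_of_nonneg_left (h z hz x hwx) (abs_nonneg _)

lemma integrableOn_rpow_neg_half : IntegrableOn (fun z : ℝ => z ^ (-(1 / 2) : ℝ)) (Ioc 0 1) :=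
  (intervalIntegrable_iff_integrableOn_Ioc_of_le zero_le_one).1
    (intervalIntegral.intervalIntegrable_rpow' (by norm_num))

lemma integral_rpow_neg_half : ∫ z in Ioc (0 : ℝ) 1, z ^ (-(1 / 2) : ℝ) = 2 := by
  rw [← intervalIntegral.integral_of_le zero_le_one, integral_rpow (Or.inl (by norm_num))]
  norm_num

lemma mul_sqrt_div_sq {z : ℝ} (hz : 0 < z) : z * √z / z ^ 2 = z ^ (-(1 / 2) : ℝ) := by
  rw [Real.rpow_neg hz.le, ← Real.sqrt_eq_rpow]
  have h1 := Real.mul_self_sqrt hz.le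
  have h2 := (Real.sqrt_pos.2 hz).ne'
  field_simp
  rw [pow_two, h1]

/-- A second difference of size z^(3/2) becomes z^(-1/2) after division by z², which is integrable
at 0. This is the common threshold for all near-field estimates. -/
lemma abs_div_sq_le_of_le_mul_sqrt {s c z : ℝ} (hz : 0 < z) (h : |s| ≤ c * (z * √z)) :
    |s / z ^ 2| ≤ c * z ^ (-(1 / 2) : ℝ) := by
  rw [abs_div, abs_of_nonneg (sq_nonneg z), ← mul_sqrt_div_sq hz, ← mul_div_assoc]
  exact div_le_div_of_nonneg_right h (sq_nonneg z)

lemma integrableOn_inv_sq : IntegrableOn (fun z : ℝ => z ^ (-2 : ℝ)) (Ioi 1) :=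
  integrableOn_Ioi_rpow_of_lt (by norm_num) one_pos

lemma integral_inv_sq : ∫ z in Ioi (1 : ℝ), z ^ (-2 : ℝ) = 1 := by
  rw [integral_Ioi_rpow_of_lt (by norm_num) one_pos]; norm_num

lemma abs_div_sq_le_of_le {s c z : ℝ} (hz : 0 < z) (h : |s| ≤ c) :
    |s / z ^ 2| ≤ c * z ^ (-2 : ℝ) := by
  rw [abs_div, abs_of_nonneg (sq_nonneg z), Real.rpow_neg hz.le, div_eq_mul_inv]
  norm_cast
  exact mul_le_mul_of_nonneg_right h (by positivity)

/-- The contribution of `|z| < 1` to the nonlocal operator applied to `f`. -/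
noncomputable def nearField (f : ℝ → ℝ) (x : ℝ) : ℝ :=
  ∫ z in Ioc (0 : ℝ) 1, secondDiff f z x / z ^ 2

/-- The contribution of `|z| > 1` to the nonlocal operator applied to `f`. -/
noncomputable def farField (f : ℝ → ℝ) (x : ℝ) : ℝ :=
  ∫ z in Ioi (1 : ℝ), secondDiff f z x / z ^ 2

lemma continuous_farField {u : ℝ → ℝ} (hc : Continuous u) (hu : ∀ x, |u x| ≤ 1) :
    Continuous (farField u) := by
  refine continuous_of_dominated (bound := fun z => 4 * z ^ (-2 : ℝ)) (fun x => ?_) (fun x => ?_)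
    (integrableOn_inv_sq.const_mul 4) (Eventually.of_forall fun z => ?_)
  · exact ((measurable_secondDiff_div hc).comp
      (by fun_prop : Measurable fun z : ℝ => (z, x))).aestronglyMeasurable
  · filter_upwards [ae_restrict_mem measurableSet_Ioi] with z hz
    exact abs_div_sq_le_of_le (one_pos.trans hz) (abs_secondDiff_le_four hu z x)
  · exact ((continuous_secondDiff hc).comp (by fun_prop : Continuous fun x : ℝ => (z, x))).div_const _

lemma abs_farField_le {u : ℝ → ℝ} (hu : ∀ x, |u x| ≤ 1) (x : ℝ) : |farField u x| ≤ 4 := by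
  have h := norm_integral_le_of_norm_le (μ := volume.restrict (Ioi (1 : ℝ)))
    (f := fun z => secondDiff u z x / z ^ 2) (integrableOn_inv_sq.const_mul 4)
    (by
      filter_upwards [ae_restrict_mem measurableSet_Ioi] with z hz
      exact abs_div_sq_le_of_le (one_pos.trans hz) (abs_secondDiff_le_four hu z x))
  rw [integral_const_mul, integral_inv_sq, mul_one] at h
  exact h

lemma continuous_nearField {f : ℝ → ℝ} {c : ℝ} (hc : Continuous f)
    (hf : ∀ z x, 0 < z → z ≤ 1 → |secondDiff f z x| ≤ c * (z * √z)) :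
    Continuous (nearField f) := by
  refine continuous_of_dominated (bound := fun z => c * z ^ (-(1 / 2) : ℝ)) (fun x => ?_)
    (fun x => ?_) (integrableOn_rpow_neg_half.const_mul c) (Eventually.of_forall fun z => ?_)
  · exact ((measurable_secondDiff_div hc).comp
      (by fun_prop : Measurable fun z : ℝ => (z, x))).aestronglyMeasurable
  · filter_upwards [ae_restrict_mem measurableSet_Ioc] with z hz
    exact abs_div_sq_le_of_le_mul_sqrt hz.1 (hf z x hz.1 hz.2)
  · exact ((continuous_secondDiff hc).comp (by fun_prop : Continuous fun x : ℝ => (z, x))).div_const _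

lemma abs_nearField_le {f : ℝ → ℝ} {c x : ℝ}
    (hf : ∀ z, 0 < z → z ≤ 1 → |secondDiff f z x| ≤ c * (z * √z)) :
    |nearField f x| ≤ 2 * c := by
  have h := norm_integral_le_of_norm_le (μ := volume.restrict (Ioc (0 : ℝ) 1))
    (f := fun z => secondDiff f z x / z ^ 2) (integrableOn_rpow_neg_half.const_mul c)
    (by
      filter_upwards [ae_restrict_mem measurableSet_Ioc] with z hz
      exact abs_div_sq_le_of_le_mul_sqrt hz.1 (hf z hz.1 hz.2))
  rw [integral_const_mul, integral_rpow_neg_half, mul_comm] at h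
  exact h

lemma integrableOn_secondDiff_near {f : ℝ → ℝ} {c x : ℝ} (hc : Continuous f)
    (hf : ∀ z, 0 < z → z ≤ 1 → |secondDiff f z x| ≤ c * (z * √z)) :
    IntegrableOn (fun z => secondDiff f z x / z ^ 2) (Ioc 0 1) := by
  refine (integrableOn_rpow_neg_half.const_mul c).mono' ?_ ?_
  · exact ((measurable_secondDiff_div hc).comp
      (by fun_prop : Measurable fun z : ℝ => (z, x))).aestronglyMeasurable
  · filter_upwards [ae_restrict_mem measurableSet_Ioc] with z hz
    exact abs_div_sq_le_of_le_mul_sqrt hz.1 (hf z hz.1 hz.2)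

/-- The primitive vanishing at the origin. -/
noncomputable def primitive (u : ℝ → ℝ) (x : ℝ) : ℝ := ∫ t in (0 : ℝ)..x, u t

lemma isPrim_primitive {u : ℝ → ℝ} (hu : LocallyIntegrable u) : IsPrim (primitive u) u :=
  ⟨hu, fun _ _ => intervalIntegral.integral_interval_sub_left
    (IsPrim.intervalIntegrable_of_locallyIntegrable hu _ _)
    (IsPrim.intervalIntegrable_of_locallyIntegrable hu _ _)⟩

/-- The second difference of a primitive is the integral over 0 < s < z of u(x-s) - u(x+s). Each
value is at most N√(2s) ≤ 2N√z, and the integration adds a factor z. -/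
lemma abs_secondDiff_primitive_le {u : ℝ → ℝ} {N : ℝ} (hc : Continuous u)
    (hu : ∀ x y, |u x - u y| ≤ N * √|x - y|) (z x : ℝ) (hz : 0 < z) :
    |secondDiff (primitive u) z x| ≤ 2 * N * (z * √z) := by
  have hN : 0 ≤ N := by
    have := (abs_nonneg _).trans (hu 1 0); simpa using this
  have := (isPrim_primitive hc.locallyIntegrable).abs_secondDiff_le (x := x) (c := 2 * N * √z)
    hz.le fun s hs hsz => by
      refine (hu _ _).trans ?_
      have e : |x - s - (x + s)| = 2 * s := by
        rw [show x - s - (x + s) = -(2 * s) by ring, abs_neg, abs_of_pos (by linarith)]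
      rw [e, mul_comm 2 N, mul_assoc]
      refine mul_le_mul_of_nonneg_left ?_ hN
      rw [Real.sqrt_le_left (by positivity), mul_pow, Real.sq_sqrt hz.le]
      linarith
  linarith

/-- Hölder continuity of exponent 1/2 only makes second differences of u of order √z, not integrable
against z⁻² at 0. For z ≤ 1 an integration by parts moves a derivative to w and replaces u by its
primitive, which gains a power of z; for z > 1 boundedness of u suffices. -/
lemma IsTestPair.near_add_far {u u' w w' : ℝ → ℝ} {A B N : ℝ} (h : IsTestPair u u' w w' A B)
    (hu : ∀ x y, |u x - u y| ≤ N * √|x - y|) :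
    ∫ z in Ioi (0 : ℝ), (∫ x, w x * secondDiff u z x) / z ^ 2 =
      -(∫ x, w' x * nearField (primitive u) x) + ∫ x, w x * farField u x := by
  have cu := h.prim.continuous
  have hP := isPrim_primitive cu.locallyIntegrable
  obtain ⟨f1, f2⟩ := secondDiff_fubini cu h.integrable_test measurableSet_Ioi
    (integrableOn_inv_sq.const_mul 4)
    (fun z hz x _ => abs_div_sq_le_of_le (one_pos.trans hz) (abs_secondDiff_le_four h.abs_le z x))
  have iw' : Integrable w' := by
    -- A weak derivative is determined only almost everywhere, so its vanishing outside [A, B] is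
    -- also only almost everywhere.
    have h1 : IntegrableOn w' (Icc A B) := h.prim_test.locInt.integrableOn_isCompact isCompact_Icc
    rw [← integrable_indicator_iff measurableSet_Icc] at h1
    refine h1.congr ?_
    filter_upwards [h.prim_test.ae_deriv_eq_zero isClosed_Icc.isOpen_compl h.test_eq_zero] with x hx
    by_cases hxI : x ∈ Icc A B
    · rw [indicator_of_mem hxI]
    · rw [indicator_of_notMem hxI, hx hxI]
  obtain ⟨n1, n2⟩ := secondDiff_fubini (f := primitive u) hP.continuous iw' measurableSet_Ioc
    (integrableOn_rpow_neg_half.const_mul (2 * N))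
    (fun z hz x _ => abs_div_sq_le_of_le_mul_sqrt hz.1
      (abs_secondDiff_primitive_le cu hu z x hz.1))
  have key : ∀ z, ∫ x, w x * secondDiff u z x = -∫ x, w' x * secondDiff (primitive u) z x := by
    intro z
    refine h.prim_test.integral_mul_deriv (g := secondDiff (primitive u) z) (g' := secondDiff u z)
      ?_ h.le h.test_eq_zero
    have hd : ∀ x, HasDerivAt (primitive u) (u x) x := fun x =>
      intervalIntegral.integral_hasDerivAt_right (cu.intervalIntegrable _ _)
        (cu.stronglyMeasurableAtFilter _ _) cu.continuousAt
    refine IsPrim.of_hasDerivAt (fun x => ?_) (by unfold secondDiff; fun_prop)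
    exact (((hd x).const_mul 2).sub ((hd (x + z)).comp_add_const x z)).sub
      ((hd (x - z)).comp_sub_const x z)
  have key2 : ∀ z, (∫ x, w x * secondDiff u z x) / z ^ 2 =
      -((∫ x, w' x * secondDiff (primitive u) z x) / z ^ 2) := fun z => by rw [key, neg_div]
  have n3 : IntegrableOn (fun z => (∫ x, w x * secondDiff u z x) / z ^ 2) (Ioc 0 1) := by
    simp only [key2]; exact n1.neg
  rw [← Ioc_union_Ioi_eq_Ioi (zero_le_one (α := ℝ)),
    setIntegral_union (Ioc_disjoint_Ioi le_rfl) measurableSet_Ioi n3 f1, f2]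
  congr 1
  simp only [key2]
  rw [integral_neg, n2]
  rfl

/-! ### Bootstrap to a bounded Hölder continuous derivative -/

/-- The primitive of the right hand side of the Euler-Lagrange equation is a representative of the
derivative. -/
lemma IsProfile.exists_continuous_deriv {β ν : ℝ} {η θ a g : ℝ → ℝ} (hν : 0 < ν)
    (hη : IsCutoff β η) (hmin : IsMinimizer β ν η θ) (h : IsProfile β ν η θ a g) :
    ∃ C, g =ᵐ[halfLine] fun x =>
      coeff ν * Real.cos (a x) * nearField (primitive fun x => Real.sin (a x)) x +
      (C + ∫ t in (0 : ℝ)..x, (Real.sin (a t + β) * Real.cos (a t + β) +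
        coeff ν * Real.cos (a t) * farField (fun x => Real.sin (a x)) t +
        coeff ν * Real.sin (a t) * nearField (primitive fun x => Real.sin (a x)) t * g t)) := by
  set u : ℝ → ℝ := fun x => Real.sin (a x) with hu
  have ca := h.prim.continuous
  have cu : Continuous u := Real.continuous_sin.comp ca
  set N := √(∫ t, g t ^ 2)
  have hN : ∀ x y, |u x - u y| ≤ N * √|x - y| := fun x y =>
    (Real.abs_sin_sub_sin_le _ _).trans (h.prim.abs_sub_le_sqrt h.memLp x y)
  set G := nearField (primitive u)
  set Φ := farField u
  have cG : Continuous G := continuous_nearField (isPrim_primitive cu.locallyIntegrable).continuous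
    fun z x hz _ => abs_secondDiff_primitive_le cu hN z x hz
  have cΦ : Continuous Φ := continuous_farField cu fun x => Real.abs_sin_le_one _
  set r₀ : ℝ → ℝ := fun t => Real.sin (a t + β) * Real.cos (a t + β) +
    coeff ν * Real.cos (a t) * Φ t
  set r₁ : ℝ → ℝ := fun t => coeff ν * Real.sin (a t) * G t
  have cr₀ : Continuous r₀ := by fun_prop
  have cr₁ : Continuous r₁ := by fun_prop
  have lr₁ : LocallyIntegrable fun t => r₁ t * g t := LocallyIntegrable.continuous_mul cr₁ h.prim.locInt
  have cH : Continuous fun x => coeff ν * Real.cos (a x) * G x := by fun_prop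
  -- The derivative of the test function w = cos(a) φ is -sin(a) g φ + cos(a) φ'. In the near field
  -- its φ' part is grouped with g, its φ part with the lower-order terms r.
  obtain ⟨C, hC⟩ := duBoisReymond (f := fun x => g x - coeff ν * Real.cos (a x) * G x)
    (r := fun t => r₀ t + r₁ t * g t) (h.prim.locInt.sub cH.locallyIntegrable)
    (cr₀.locallyIntegrable.add lr₁) (fun φ hφ => by
      have h1 := h.weak_secondDiff hν hη hmin hφ
      obtain ⟨A, B, hp⟩ := h.isTestPair hφ
      rw [hp.near_add_far hN] at h1
      have comp : ∀ f : ℝ → ℝ, Continuous f → Integrable fun x => f x * φ x := fun f hf =>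
        (hf.mul hφ.continuous).integrable_of_hasCompactSupport hφ.compact.mul_left
      have compd : ∀ f : ℝ → ℝ, Continuous f → Integrable fun x => f x * deriv φ x := fun f hf =>
        (hf.mul hφ.continuous_deriv).integrable_of_hasCompactSupport hφ.compact.deriv.mul_left
      have ig : Integrable fun x => g x * deriv φ x := by
        simpa using h.prim.locInt.integrable_smul_right_of_hasCompactSupport hφ.continuous_deriv
          hφ.compact.deriv
      have isg : Integrable fun x => Real.sin (a x) * G x * g x * φ x :=
        hφ.integrable_mul ((LocallyIntegrable.continuous_mul (cu.mul cG)
          h.prim.locInt).locallyIntegrableOn _)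
      have e1 : ∫ x, (-Real.sin (a x) * g x * φ x + Real.cos (a x) * deriv φ x) * G x =
          -(∫ x, Real.sin (a x) * G x * g x * φ x) + ∫ x, Real.cos (a x) * G x * deriv φ x := by
        have ids := compd (fun x => Real.cos (a x) * G x) (by fun_prop)
        rw [neg_add_eq_sub, ← integral_sub ids isg]
        congr 1; ext x; ring
      have e2 : ∫ x, (g x - coeff ν * Real.cos (a x) * G x) * deriv φ x =
          (∫ x, g x * deriv φ x) - coeff ν * ∫ x, Real.cos (a x) * G x * deriv φ x := by
        have ids := compd (fun x => Real.cos (a x) * G x) (by fun_prop)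
        rw [← integral_const_mul, ← integral_sub ig (ids.const_mul _)]
        congr 1; ext x; ring
      have e3 : ∫ x, (r₀ x + r₁ x * g x) * φ x =
          (∫ x, Real.sin (a x + β) * Real.cos (a x + β) * φ x) +
          coeff ν * (∫ x, Real.cos (a x) * φ x * Φ x) +
          coeff ν * ∫ x, Real.sin (a x) * G x * g x * φ x := by
        have ic : Integrable fun x => Real.cos (a x) * φ x * Φ x :=
          (comp (fun x => Real.cos (a x) * Φ x) (by fun_prop)).congr
            (Eventually.of_forall fun x => by ring)
        have is := comp (fun x => Real.sin (a x + β) * Real.cos (a x + β)) (by fun_prop)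
        have isc : Integrable fun x => Real.sin (a x + β) * Real.cos (a x + β) * φ x +
          coeff ν * (Real.cos (a x) * φ x * Φ x) := is.add (ic.const_mul _)
        rw [← integral_const_mul, ← integral_const_mul, ← integral_add is (ic.const_mul _),
          ← integral_add isc (isg.const_mul _)]
        congr 1; ext x; simp only [r₀, r₁]; ring
      rw [e2, e3]
      rw [e1] at h1
      linear_combination h1)
  refine ⟨C, ?_⟩
  filter_upwards [hC] with x hx
  simp only [r₀, r₁] at hx
  linarith

/-- By linearity and translation invariance, increments of the near field are near fields of
increments. -/
lemma nearField_sub {f : ℝ → ℝ} {c x y : ℝ} (hc : Continuous f)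
    (hx : ∀ z, 0 < z → z ≤ 1 → |secondDiff f z x| ≤ c * (z * √z))
    (hy : ∀ z, 0 < z → z ≤ 1 → |secondDiff f z y| ≤ c * (z * √z)) :
    nearField f x - nearField f y = nearField (fun t => f t - f (t + (y - x))) x := by
  unfold nearField
  rw [← integral_sub (integrableOn_secondDiff_near hc hx) (integrableOn_secondDiff_near hc hy)]
  congr 1; ext z
  unfold secondDiff
  rw [← sub_div]
  congr 1
  beta_reduce
  rw [show x + (y - x) = y by ring, show x + z + (y - x) = y + z by ring,
    show x - z + (y - x) = y - z by ring]
  ring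

lemma hasDerivAt_primitive {u : ℝ → ℝ} (hu : Continuous u) (x : ℝ) :
    HasDerivAt (primitive u) (u x) x :=
  intervalIntegral.integral_hasDerivAt_right (hu.intervalIntegrable _ _)
    (hu.stronglyMeasurableAtFilter _ _) hu.continuousAt

/-- Bounding a minimum by the geometric mean is how two competing estimates are interpolated into a
Hölder bound. -/
lemma min_le_sqrt_mul_sqrt {s d : ℝ} (hs : 0 ≤ s) (hd : 0 ≤ d) : min s d ≤ √s * √d := by
  rw [← Real.sqrt_mul hs]
  refine Real.le_sqrt_of_sq_le ?_
  rw [pow_two]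
  exact mul_le_mul (min_le_left _ _) (min_le_right _ _) (le_min hs hd) hs

/-- The near field of the primitive of a Lipschitz function is Hölder continuous. -/
lemma abs_nearField_primitive_sub_le {u : ℝ → ℝ} {M N : ℝ} (hc : Continuous u)
    (hN : ∀ x y, |u x - u y| ≤ N * √|x - y|) (hM : ∀ x y, |u x - u y| ≤ M * |x - y|) (x y : ℝ) :
    |nearField (primitive u) x - nearField (primitive u) y| ≤ 8 * M * √|x - y| := by
  have hM0 : 0 ≤ M := by
    have := (abs_nonneg _).trans (hM 1 0); simpa using this
  have cP := (isPrim_primitive hc.locallyIntegrable).continuous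
  rw [nearField_sub cP (fun z hz _ => abs_secondDiff_primitive_le hc hN z x hz)
    (fun z hz _ => abs_secondDiff_primitive_le hc hN z y hz)]
  have hQ : IsPrim (fun t => primitive u t - primitive u (t + (y - x)))
      (fun t => u t - u (t + (y - x))) :=
    IsPrim.of_hasDerivAt (fun t => (hasDerivAt_primitive hc t).sub
      ((hasDerivAt_primitive hc (t + (y - x))).comp_add_const t (y - x))) (by fun_prop)
  set d := |x - y| with hd
  refine (abs_nearField_le (c := 4 * M * √d) fun z hz _ => ?_).trans (le_of_eq (by ring))
  have := hQ.abs_secondDiff_le (x := x) (c := 4 * M * (√z * √d)) hz.le fun s hs hsz => by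
    have e1 : u (x - s) - u (x - s + (y - x)) - (u (x + s) - u (x + s + (y - x))) =
        (u (x - s) - u (y - s)) - (u (x + s) - u (y + s)) := by
      rw [show x - s + (y - x) = y - s by ring, show x + s + (y - x) = y + s by ring]
    have b1 := hM (x - s) (y - s)
    have b2 := hM (x + s) (y + s)
    have b3 := hM (x - s) (x + s)
    have b4 := hM (y - s) (y + s)
    rw [show x - s - (y - s) = x - y by ring] at b1
    rw [show x + s - (y + s) = x - y by ring] at b2
    rw [show x - s - (x + s) = -(2 * s) by ring, abs_neg, abs_of_pos (by linarith : 0 < 2 * s)] at b3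
    rw [show y - s - (y + s) = -(2 * s) by ring, abs_neg, abs_of_pos (by linarith : 0 < 2 * s)] at b4
    -- The quantity is a mixed double difference of u. Pairing points at distance d bounds it by a
    -- multiple of M d, pairing points x±s and y±s by a multiple of M z; interpolation gives 4M √z
    -- √d.
    have h1 : |u (x - s) - u (x - s + (y - x)) - (u (x + s) - u (x + s + (y - x)))| ≤
        4 * M * d := by
      rw [e1]
      refine (abs_sub _ _).trans ?_
      nlinarith [mul_nonneg hM0 (abs_nonneg (x - y))]
    have h2 : |u (x - s) - u (x - s + (y - x)) - (u (x + s) - u (x + s + (y - x)))| ≤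
        4 * M * z := by
      rw [e1, sub_sub_sub_comm]
      refine (abs_sub _ _).trans ?_
      nlinarith [mul_le_mul_of_nonneg_left hsz hM0]
    have h3 := le_min h2 h1
    rw [← mul_min_of_nonneg _ _ (by positivity)] at h3
    exact h3.trans (mul_le_mul_of_nonneg_left (min_le_sqrt_mul_sqrt hz.le (abs_nonneg _))
      (by positivity))
  linarith

/-- A square integrable function which is, up to a bounded error, of bounded oscillation on unit
intervals, is bounded. -/
lemma abs_le_of_oscillation {f F g : ℝ → ℝ} {P Q : ℝ} (hf : Continuous f)
    (hg : MemLp g 2 volume) (hfg : g =ᵐ[halfLine] f)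
    (hQ : ∀ x, |f x - F x| ≤ Q) (hP : ∀ x y, 0 ≤ x → x ≤ y → y ≤ x + 1 → |F y - F x| ≤ P)
    {x : ℝ} (hx : 0 ≤ x) : |f x| ≤ 1 + P + 2 * Q + ∫ t, g t ^ 2 := by
  have h2 := hg.integrable_sq
  -- Use |t| ≤ t² + 1 and average over y in a unit interval: the square is then paid for by the L²
  -- norm.
  have hpt : ∀ y ∈ Icc x (x + 1), |f x| ≤ f y ^ 2 + (1 + P + 2 * Q) := by
    intro y hy
    have h1 := hP x y hx hy.1 hy.2
    have e : f x = (f x - F x) - (F y - F x) - (f y - F y) + f y := by ring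
    have h3 : |f x| ≤ Q + P + Q + |f y| := by
      rw [e]
      refine (abs_add_le _ _).trans (add_le_add_left ?_ _)
      refine (abs_sub _ _).trans (add_le_add ((abs_sub _ _).trans (add_le_add (hQ x) h1)) (hQ y))
    nlinarith [sq_nonneg (|f y| - 1), sq_abs (f y)]
  have h3 : ∫ y in x..(x + 1), |f x| ≤ ∫ y in x..(x + 1), (f y ^ 2 + (1 + P + 2 * Q)) :=
    intervalIntegral.integral_mono_on (by linarith) (by simp)
      ((by fun_prop : Continuous fun y => f y ^ 2 + (1 + P + 2 * Q)).intervalIntegrable _ _) hpt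
  rw [intervalIntegral.integral_add
    ((by fun_prop : Continuous fun y => f y ^ 2).intervalIntegrable _ _) (by simp)] at h3
  simp only [intervalIntegral.integral_const, add_sub_cancel_left, one_smul] at h3
  have h4 : ∫ y in x..(x + 1), f y ^ 2 ≤ ∫ t, g t ^ 2 := by
    rw [intervalIntegral.integral_of_le (by linarith)]
    have h5 : ∫ y in Ioc x (x + 1), f y ^ 2 = ∫ y in Ioc x (x + 1), g y ^ 2 := by
      refine setIntegral_congr_ae measurableSet_Ioc ?_
      filter_upwards [(ae_restrict_iff' measurableSet_Ioi).1 hfg] with y hy hy'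
      rw [hy (hx.trans_lt hy'.1)]
    rw [h5]
    exact setIntegral_le_integral h2 (Eventually.of_forall fun t => sq_nonneg _)
  linarith

lemma IsPrim.abs_sub_le_of_bound {f f' : ℝ → ℝ} {M : ℝ} (h : IsPrim f f') (hM : ∀ x, |f' x| ≤ M)
    (x y : ℝ) : |f x - f y| ≤ M * |x - y| := by
  rw [h.eq y x]
  rw [← Real.norm_eq_abs]
  exact intervalIntegral.norm_integral_le_of_norm_le_const fun t _ => hM t

/-- A profile whose derivative is represented by a bounded Hölder continuous function. -/
structure IsRegularProfile (β ν : ℝ) (η θ a f : ℝ → ℝ) (M H : ℝ) : Prop where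
  profile : IsProfile β ν η θ a ((Ioi 0).indicator f)
  continuous : Continuous f
  abs_le : ∀ x, 0 ≤ x → |f x| ≤ M
  holder : ∀ x y, 0 ≤ x → 0 ≤ y → |f x - f y| ≤ H * √|x - y|

lemma IsProfile.congr_deriv {β ν : ℝ} {η θ a g g' : ℝ → ℝ} (h : IsProfile β ν η θ a g)
    (hg : g =ᵐ[volume] g') (h0 : ∀ x, x ≤ 0 → g' x = 0) : IsProfile β ν η θ a g' := by
  refine ⟨h.prim.congr_deriv hg, h.memLp.ae_eq hg, h.eq_zero, h0, h.eq_add,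
    h.integrable_loc.congr ?_, h.integrable_quad⟩
  filter_upwards [ae_restrict_of_ae hg] with x hx
  rw [locDensity, locDensity, hx]

/-- The representation of the derivative is used twice. Boundedness of the near field and g ∈ L²
first give a bounded derivative. Then u is Lipschitz, its near field becomes Hölder continuous, and
the remaining primitive has a bounded integrand, hence is Lipschitz. -/
theorem IsProfile.exists_isRegularProfile {β ν : ℝ} {η θ a g : ℝ → ℝ} (hν : 0 < ν)
    (hη : IsCutoff β η) (hmin : IsMinimizer β ν η θ) (h : IsProfile β ν η θ a g) :
    ∃ f M H, IsRegularProfile β ν η θ a f M H := by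
  obtain ⟨C, hC⟩ := h.exists_continuous_deriv hν hη hmin
  set κ := coeff ν with hκ
  have hκ0 : 0 ≤ κ := by rw [hκ, coeff]; positivity
  set u : ℝ → ℝ := fun x => Real.sin (a x) with hu
  have ca := h.prim.continuous
  have cu : Continuous u := Real.continuous_sin.comp ca
  set N := √(∫ t, g t ^ 2)
  have hN : ∀ x y, |u x - u y| ≤ N * √|x - y| := fun x y =>
    (Real.abs_sin_sub_sin_le _ _).trans (h.prim.abs_sub_le_sqrt h.memLp x y)
  set G := nearField (primitive u) with hGdef
  set Φ := farField u
  have cG : Continuous G := continuous_nearField (isPrim_primitive cu.locallyIntegrable).continuous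
    fun z x hz _ => abs_secondDiff_primitive_le cu hN z x hz
  have cΦ : Continuous Φ := continuous_farField cu fun x => Real.abs_sin_le_one _
  have bΦ : ∀ x, |Φ x| ≤ 4 := abs_farField_le fun x => Real.abs_sin_le_one _
  set Q := 2 * (2 * N)
  have bG : ∀ x, |G x| ≤ Q := fun x => abs_nearField_le fun z hz _ =>
    abs_secondDiff_primitive_le cu hN z x hz
  have hQ0 : 0 ≤ Q := (abs_nonneg _).trans (bG 0)
  set r : ℝ → ℝ := fun t => Real.sin (a t + β) * Real.cos (a t + β) +
        κ * Real.cos (a t) * Φ t + κ * Real.sin (a t) * G t * g t with hr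
  have lr : LocallyIntegrable r := by
    refine LocallyIntegrable.add (Continuous.locallyIntegrable (by fun_prop)) ?_
    exact LocallyIntegrable.continuous_mul (f := g) (by fun_prop) h.prim.locInt
  have br : ∀ t, |r t| ≤ 1 + κ * 4 + κ * Q * |g t| := by
    intro t
    refine (abs_add_le _ _).trans (add_le_add ((abs_add_le _ _).trans (add_le_add ?_ ?_)) ?_)
    · rw [abs_mul]
      exact mul_le_one₀ (Real.abs_sin_le_one _) (abs_nonneg _) (Real.abs_cos_le_one _)
    · rw [abs_mul, abs_mul, abs_of_nonneg hκ0]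
      have := mul_le_mul (Real.abs_cos_le_one (a t)) (bΦ t) (abs_nonneg _) zero_le_one
      nlinarith
    · rw [abs_mul, abs_mul, abs_mul, abs_of_nonneg hκ0]
      refine mul_le_mul_of_nonneg_right ?_ (abs_nonneg _)
      have := mul_le_mul (Real.abs_sin_le_one (a t)) (bG t) (abs_nonneg _) zero_le_one
      nlinarith
  set F : ℝ → ℝ := fun x => C + ∫ t in (0 : ℝ)..x, r t with hF
  have pF : IsPrim F r := ⟨lr, fun x y => by
    rw [← (isPrim_primitive lr).eq]; simp only [hF, primitive]; ring⟩
  set f : ℝ → ℝ := fun x => κ * Real.cos (a x) * G x + F x with hf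
  have cf : Continuous f := by have := pF.continuous; fun_prop
  have hfF : ∀ x, |f x - F x| ≤ κ * Q := fun x => by
    simp only [hf, add_sub_cancel_right]
    rw [abs_mul, abs_mul, abs_of_nonneg hκ0]
    have := mul_le_mul (Real.abs_cos_le_one (a x)) (bG x) (abs_nonneg _) zero_le_one
    nlinarith
  set N2 := ∫ t, g t ^ 2
  have hP : ∀ x y, 0 ≤ x → x ≤ y → y ≤ x + 1 → |F y - F x| ≤
      1 + κ * 4 + κ * Q * (1 + N2) := by
    intro x y _ hxy hy
    have i2 := h.memLp.integrable_sq
    rw [pF.eq x y]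
    have ib : IntervalIntegrable (fun t => 1 + κ * 4 + κ * Q * (1 + g t ^ 2)) volume x y :=
      (by simp : IntervalIntegrable (fun _ => 1 + κ * 4) volume x y).add
        (((by simp : IntervalIntegrable (fun _ => (1 : ℝ)) volume x y).add
          i2.intervalIntegrable).const_mul _)
    rw [← Real.norm_eq_abs]
    refine (intervalIntegral.norm_integral_le_of_norm_le (g := fun t => 1 + κ * 4 +
      κ * Q * (1 + g t ^ 2)) hxy (Eventually.of_forall fun t _ => (br t).trans ?_) ib).trans ?_
    · have : |g t| ≤ 1 + g t ^ 2 := by nlinarith [sq_nonneg (|g t| - 1), sq_abs (g t), abs_nonneg (g t)]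
      have := mul_le_mul_of_nonneg_left this (mul_nonneg hκ0 hQ0)
      linarith
    · have e1 : ∫ t in x..y, (1 + κ * 4 + κ * Q * (1 + g t ^ 2)) =
          (y - x) * (1 + κ * 4 + κ * Q) + κ * Q * ∫ t in x..y, g t ^ 2 := by
        have e2 : ∀ t, 1 + κ * 4 + κ * Q * (1 + g t ^ 2) =
          (1 + κ * 4 + κ * Q) + κ * Q * g t ^ 2 := fun t => by ring
        simp only [e2]
        rw [intervalIntegral.integral_add (by simp) (i2.intervalIntegrable.const_mul _),
          intervalIntegral.integral_const_mul, intervalIntegral.integral_const, smul_eq_mul]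
      rw [e1]
      have h4 : ∫ t in x..y, g t ^ 2 ≤ N2 := by
        rw [intervalIntegral.integral_of_le hxy]
        exact setIntegral_le_integral i2 (Eventually.of_forall fun t => sq_nonneg _)
      have hκQ := mul_nonneg hκ0 hQ0
      nlinarith [mul_le_mul_of_nonneg_left h4 hκQ, mul_nonneg (by linarith : 0 ≤ x + 1 - y)
        (by linarith : 0 ≤ 1 + κ * 4 + κ * Q)]
  obtain ⟨M, hM⟩ : ∃ M, ∀ x, 0 ≤ x → |f x| ≤ M :=
    ⟨_, fun x hx => abs_le_of_oscillation cf h.memLp hC hfF hP hx⟩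
  have hM0 : 0 ≤ M := (abs_nonneg _).trans (hM 0 le_rfl)
  -- From here on g is replaced by its continuous representative f on x > 0, still extended by zero.
  have hgf : g =ᵐ[volume] (Ioi 0).indicator f := by
    filter_upwards [(ae_restrict_iff' measurableSet_Ioi).1 hC] with x hx
    rcases lt_or_ge 0 x with hx0 | hx0
    · rw [indicator_of_mem (by exact hx0), hx hx0]
    · rw [indicator_of_notMem (by exact not_lt.2 hx0), h.deriv_eq_zero x hx0]
  have hp := h.congr_deriv hgf fun x hx => indicator_of_notMem (by exact not_lt.2 hx) _
  have hMi : ∀ x, |(Ioi (0 : ℝ)).indicator f x| ≤ M := fun x => by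
    rcases lt_or_ge 0 x with hx0 | hx0
    · rw [indicator_of_mem (by exact hx0)]; exact hM x hx0.le
    · rw [indicator_of_notMem (by exact not_lt.2 hx0), abs_zero]; exact hM0
  have hLa := hp.prim.abs_sub_le_of_bound hMi
  have hLu : ∀ x y, |u x - u y| ≤ M * |x - y| := fun x y =>
    (Real.abs_sin_sub_sin_le _ _).trans (hLa x y)
  have hHG := abs_nearField_primitive_sub_le cu hN hLu
  set R := 1 + κ * 4 + κ * Q * M
  have hR0 : 0 ≤ R := by positivity
  have hLF : ∀ x y, |F x - F y| ≤ R * |x - y| := by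
    intro x y
    rw [pF.eq y x, ← Real.norm_eq_abs]
    refine intervalIntegral.norm_integral_le_of_norm_le_const_ae ?_
    filter_upwards [hgf] with t ht _
    refine (br t).trans ?_
    have h1 := hMi t
    rw [← ht] at h1
    have := mul_le_mul_of_nonneg_left h1 (mul_nonneg hκ0 hQ0)
    linarith
  -- For |x - y| ≤ 1 the terms come from the product cos(a) G (bounds Q for G, M for the slope of a,
  -- 8M for the Hölder constant of G) and from the Lipschitz constant R. The summand 2M handles |x -
  -- y| > 1.
  refine ⟨f, M, κ * (M * Q + 8 * M) + R + 2 * M, hp, cf, hM, fun x y hx hy => ?_⟩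
  set d := |x - y| with hd
  have hd0 : 0 ≤ d := abs_nonneg _
  have hsd : 0 ≤ √d := Real.sqrt_nonneg _
  rcases le_or_gt d 1 with h1 | h1
  · have hds : d ≤ √d := by
      refine Real.le_sqrt_of_sq_le ?_
      nlinarith
    have e : f x - f y = κ * ((Real.cos (a x) - Real.cos (a y)) * G x +
        Real.cos (a y) * (G x - G y)) + (F x - F y) := by
      simp only [hf]; ring
    have b1 : |(Real.cos (a x) - Real.cos (a y)) * G x| ≤ M * d * Q := by
      rw [abs_mul]
      exact mul_le_mul ((Real.abs_cos_sub_cos_le _ _).trans (hLa x y)) (bG x) (abs_nonneg _)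
        (by positivity)
    have b2 : |Real.cos (a y) * (G x - G y)| ≤ 8 * M * √d := by
      rw [abs_mul]
      exact (mul_le_of_le_one_left (abs_nonneg _) (Real.abs_cos_le_one _)).trans (hHG x y)
    rw [e]
    refine (abs_add_le _ _).trans ?_
    rw [abs_mul, abs_of_nonneg hκ0]
    have b3 := mul_le_mul_of_nonneg_left ((abs_add_le _ _).trans (add_le_add b1 b2)) hκ0
    have b4 := hLF x y
    have b5 : κ * (M * d * Q) ≤ κ * (M * √d * Q) := by gcongr
    have b6 : R * d ≤ R * √d := by gcongr
    have b7 : 0 ≤ 2 * M * √d := by positivity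
    linarith
  · have h1s : 1 ≤ √d := Real.one_le_sqrt.2 h1.le
    have h2 : |f x - f y| ≤ 2 * M := (abs_sub _ _).trans (by linarith [hM x hx, hM y hy])
    have h3 : 0 ≤ (κ * (M * Q + 8 * M) + R) * √d := by positivity
    nlinarith

/-! ### The nonlocal operator pointwise and its principal value -/

/-- A bounded function vanishing on the negative half-line, whose derivative `v` on the positive
half-line is bounded and Hölder continuous. -/
structure IsHolderEdge (u v : ℝ → ℝ) (M H : ℝ) : Prop where
  prim : IsPrim u ((Ioi 0).indicator v)
  abs_le_one : ∀ x, |u x| ≤ 1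
  eq_zero : ∀ x, x ≤ 0 → u x = 0
  continuous_deriv : Continuous v
  abs_le : ∀ x, 0 ≤ x → |v x| ≤ M
  holder : ∀ x y, 0 ≤ x → 0 ≤ y → |v x - v y| ≤ H * √|x - y|

/-- The half-Laplacian (up to a factor), in terms of second differences. -/
noncomputable def nonlocalOp (u : ℝ → ℝ) (x : ℝ) : ℝ :=
  ∫ z in Ioi (0 : ℝ), secondDiff u z x / z ^ 2

/-- The integrable majorant of `secondDiff u z x / z ^ 2`. -/
noncomputable def opBound (K z : ℝ) : ℝ :=
  (Ioc (0 : ℝ) 1).indicator (fun z => K * z ^ (-(1 / 2) : ℝ)) z +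
    (Ioi (1 : ℝ)).indicator (fun z => 4 * z ^ (-2 : ℝ)) z

lemma integrable_opBound (K : ℝ) : Integrable (opBound K) := by
  refine Integrable.add ?_ ?_
  · exact (integrable_indicator_iff measurableSet_Ioc).2 (integrableOn_rpow_neg_half.const_mul K)
  · exact (integrable_indicator_iff measurableSet_Ioi).2 (integrableOn_inv_sq.const_mul 4)

lemma integral_opBound (K : ℝ) : ∫ z in Ioi (0 : ℝ), opBound K z = 2 * K + 4 := by
  have h1 := (integrable_indicator_iff (measurableSet_Ioc (a := (0 : ℝ)) (b := 1))).2
    (integrableOn_rpow_neg_half.const_mul K)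
  have h2 := (integrable_indicator_iff (measurableSet_Ioi (a := (1 : ℝ)))).2
    (integrableOn_inv_sq.const_mul 4)
  have h3 : ∫ z in Ioi (0 : ℝ), opBound K z = ∫ z, opBound K z := by
    refine setIntegral_eq_integral_of_forall_compl_eq_zero fun z hz => ?_
    have hz0 : z ≤ 0 := not_lt.1 hz
    rw [opBound, indicator_of_notMem (fun h => not_lt.2 hz0 h.1),
      indicator_of_notMem (by simp; linarith), add_zero]
  rw [h3]
  unfold opBound
  rw [integral_add h1 h2, integral_indicator measurableSet_Ioc, integral_indicator measurableSet_Ioi,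
    integral_const_mul, integral_const_mul, integral_rpow_neg_half, integral_inv_sq]
  ring

namespace IsHolderEdge

variable {u v : ℝ → ℝ} {M H : ℝ}

lemma bound_nonneg (h : IsHolderEdge u v M H) : 0 ≤ M := (abs_nonneg _).trans (h.abs_le 0 le_rfl)

lemma holder_nonneg (h : IsHolderEdge u v M H) : 0 ≤ H := by
  have := (abs_nonneg _).trans (h.holder 1 0 zero_le_one le_rfl); simpa using this

lemma continuous (h : IsHolderEdge u v M H) : Continuous u := h.prim.continuous

lemma lipschitz (h : IsHolderEdge u v M H) (x y : ℝ) : |u x - u y| ≤ M * |x - y| := by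
  refine h.prim.abs_sub_le_of_bound (fun x => ?_) x y
  rcases lt_or_ge 0 x with hx0 | hx0
  · rw [indicator_of_mem (by exact hx0)]; exact h.abs_le x hx0.le
  · rw [indicator_of_notMem (by exact not_lt.2 hx0), abs_zero]; exact h.bound_nonneg

lemma abs_secondDiff_le (h : IsHolderEdge u v M H) {x z : ℝ} (hz : 0 < z) :
    |secondDiff u z x| ≤ 2 * M * z := by
  have e : secondDiff u z x = (u x - u (x + z)) + (u x - u (x - z)) := by unfold secondDiff; ring
  have h1 := h.lipschitz x (x + z)
  have h2 := h.lipschitz x (x - z)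
  rw [sub_add_cancel_left, abs_neg, abs_of_pos hz] at h1
  rw [sub_sub_cancel, abs_of_pos hz] at h2
  rw [e]
  exact (abs_add_le _ _).trans (by linarith)

/-- For z < x all points stay on the side where the derivative is Hölder. For z ≥ x the corner at 0
may be seen and only the Lipschitz bound 2Mz remains; the factor √(z/x) ≥ 1 converts it, at the
price of 1/√x in the constant. -/
lemma abs_secondDiff_le_mul_sqrt (h : IsHolderEdge u v M H) {x z : ℝ} (hx : 0 < x) (hz : 0 < z) :
    |secondDiff u z x| ≤ (2 * H + 2 * M / √x) * (z * √z) := by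
  have hM := h.bound_nonneg
  have hH := h.holder_nonneg
  have hsx := Real.sqrt_pos.2 hx
  have hsz := Real.sqrt_pos.2 hz
  rcases lt_or_ge z x with hzx | hzx
  · have := h.prim.abs_secondDiff_le (x := x) (c := 2 * H * √z) hz.le fun s hs hsz => by
      rw [indicator_of_mem (by simp; linarith), indicator_of_mem (by simp; linarith)]
      refine (h.holder _ _ (by linarith) (by linarith)).trans ?_
      rw [show x - s - (x + s) = -(2 * s) by ring, abs_neg, abs_of_pos (by linarith : 0 < 2 * s),
        mul_comm 2 H, mul_assoc]
      refine mul_le_mul_of_nonneg_left ?_ hH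
      rw [Real.sqrt_le_left (by positivity), mul_pow, Real.sq_sqrt hz.le]
      linarith
    have h2 : 0 ≤ 2 * M / √x * (z * √z) := by positivity
    linarith
  · refine (h.abs_secondDiff_le hz).trans ?_
    have h1 : 1 ≤ √z / √x := (one_le_div hsx).2 (Real.sqrt_le_sqrt hzx)
    have h2 : 2 * M * z * 1 ≤ 2 * M * z * (√z / √x) :=
      mul_le_mul_of_nonneg_left h1 (by positivity)
    have h3 : 0 ≤ 2 * H * (z * √z) := by positivity
    have e : 2 * M / √x * (z * √z) = 2 * M * z * (√z / √x) := by ring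
    linarith

lemma abs_secondDiff_div_le (h : IsHolderEdge u v M H) {x x₀ z : ℝ} (hx₀ : 0 < x₀) (hx : x₀ ≤ x)
    (hz : 0 < z) : |secondDiff u z x / z ^ 2| ≤ opBound (2 * H + 2 * M / √x₀) z := by
  have hM := h.bound_nonneg
  rw [opBound]
  rcases le_or_gt z 1 with h1 | h1
  · rw [indicator_of_mem (by exact ⟨hz, h1⟩), indicator_of_notMem (by simpa using h1), add_zero]
    refine abs_div_sq_le_of_le_mul_sqrt hz
      ((h.abs_secondDiff_le_mul_sqrt (hx₀.trans_le hx) hz).trans ?_)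
    have h2 := Real.sqrt_pos.2 hx₀
    have h3 := Real.sqrt_le_sqrt hx
    refine mul_le_mul_of_nonneg_right ?_ (by positivity)
    gcongr
  · rw [indicator_of_notMem (by simp [h1]), indicator_of_mem (by exact h1), zero_add]
    exact abs_div_sq_le_of_le hz (abs_secondDiff_le_four h.abs_le_one z x)

lemma aestronglyMeasurable_secondDiff (h : IsHolderEdge u v M H) (x : ℝ) (μ : Measure ℝ) :
    AEStronglyMeasurable (fun z => secondDiff u z x / z ^ 2) μ :=
  ((measurable_secondDiff_div h.continuous).comp
    (by fun_prop : Measurable fun z : ℝ => (z, x))).aestronglyMeasurable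

lemma integrableOn_secondDiff (h : IsHolderEdge u v M H) {x : ℝ} (hx : 0 < x) :
    IntegrableOn (fun z => secondDiff u z x / z ^ 2) (Ioi 0) := by
  refine (integrable_opBound (2 * H + 2 * M / √x)).integrableOn.mono'
    (h.aestronglyMeasurable_secondDiff x _) ?_
  filter_upwards [ae_restrict_mem measurableSet_Ioi] with z hz
  exact h.abs_secondDiff_div_le hx le_rfl hz

/-- A crude bound: the growth at the edge is in fact at most logarithmic, but integrability at 0 is
all that the integrated equation needs. -/
lemma abs_nonlocalOp_le (h : IsHolderEdge u v M H) {x : ℝ} (hx : 0 < x) :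
    |nonlocalOp u x| ≤ 4 * H + 4 + 4 * M / √x := by
  have h1 := norm_integral_le_of_norm_le (μ := volume.restrict (Ioi (0 : ℝ)))
    (f := fun z => secondDiff u z x / z ^ 2)
    (integrable_opBound (2 * H + 2 * M / √x)).integrableOn (by
      filter_upwards [ae_restrict_mem measurableSet_Ioi] with z hz
      exact h.abs_secondDiff_div_le hx le_rfl hz)
  rw [integral_opBound] at h1
  exact h1.trans (le_of_eq (by ring))

lemma continuousOn_nonlocalOp (h : IsHolderEdge u v M H) : ContinuousOn (nonlocalOp u) (Ioi 0) := by
  intro x hx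
  have hx0 : (0 : ℝ) < x := hx
  refine ContinuousAt.continuousWithinAt ?_
  refine continuousAt_of_dominated (bound := opBound (2 * H + 2 * M / √(x / 2)))
    (Eventually.of_forall fun y => h.aestronglyMeasurable_secondDiff y _) ?_
    (integrable_opBound _).integrableOn (Eventually.of_forall fun z => ?_)
  · filter_upwards [Ioi_mem_nhds (half_lt_self hx0)] with y hy
    filter_upwards [ae_restrict_mem measurableSet_Ioi] with z hz
    exact h.abs_secondDiff_div_le (half_pos hx0) (le_of_lt hy) hz
  · exact (((continuous_secondDiff h.continuous).comp
      (by fun_prop : Continuous fun x : ℝ => (z, x))).div_const _).continuousAt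

lemma integral_secondDiff_test (h : IsHolderEdge u v M H) {w : ℝ → ℝ} {A B : ℝ} (hA : 0 < A)
    (hw : Integrable w) (h0 : ∀ x, x ∉ Icc A B → w x = 0) :
    ∫ z in Ioi (0 : ℝ), (∫ x, w x * secondDiff u z x) / z ^ 2 = ∫ x, w x * nonlocalOp u x := by
  refine (secondDiff_fubini h.continuous hw measurableSet_Ioi
    (integrable_opBound (2 * H + 2 * M / √A)).integrableOn fun z hz x hwx => ?_).2
  have : x ∈ Icc A B := by by_contra hx; exact hwx (h0 x hx)
  exact h.abs_secondDiff_div_le hA this.1 hz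

/-- The quotient whose principal value is taken is integrable away from the singularity. -/
lemma integrableOn_quotient (h : IsHolderEdge u v M H) (x : ℝ) {ε : ℝ} (hε : 0 < ε) :
    IntegrableOn (fun y => (u x - u y) / (x - y) ^ 2) {y | ε < |y - x|} := by
  have hi : Integrable fun y : ℝ => 2 * (1 + (ε ^ 2)⁻¹) * (1 + (y - x) ^ 2)⁻¹ :=
    (integrable_inv_one_add_sq.comp_sub_right x).const_mul _
  have hc := h.continuous.measurable
  refine hi.integrableOn.mono' (Measurable.aestronglyMeasurable (by fun_prop)) ?_
  filter_upwards [ae_restrict_mem (measurableSet_lt measurable_const (by fun_prop))] with y hy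
  have hy' : ε ^ 2 < (y - x) ^ 2 := by
    rw [← sq_abs (y - x)]
    exact pow_lt_pow_left₀ hy hε.le (by norm_num)
  have h1 : |u x - u y| ≤ 2 := (abs_sub _ _).trans (by linarith [h.abs_le_one x, h.abs_le_one y])
  have e : (x - y) ^ 2 = (y - x) ^ 2 := by ring
  rw [norm_div, Real.norm_of_nonneg (sq_nonneg _), e, Real.norm_eq_abs, mul_assoc]
  have hpos : 0 < (y - x) ^ 2 := (by positivity : 0 < ε ^ 2).trans hy'
  rw [div_le_iff₀ hpos, mul_assoc]
  have h2 : 1 ≤ (1 + (ε ^ 2)⁻¹) * (1 + (y - x) ^ 2)⁻¹ * (y - x) ^ 2 := by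
    rw [mul_assoc, inv_mul_eq_div, ← mul_div_assoc, le_div_iff₀ (by positivity)]
    have : 1 ≤ (ε ^ 2)⁻¹ * (y - x) ^ 2 := by
      rw [inv_mul_eq_div, le_div_iff₀ (by positivity)]; linarith
    nlinarith
  linarith

/-- Folding the two sides of x onto each other turns the quotient into a second difference. As ε <
x, the excised region contains no y ≤ 0, and those y, where u vanishes, account exactly for u(x)/x.
-/
lemma integral_quotient (h : IsHolderEdge u v M H) {x ε : ℝ} (hε : 0 < ε) (hεx : ε < x) :
    ∫ y in {y | 0 < y ∧ ε < |y - x|}, (u x - u y) / (x - y) ^ 2 =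
      (∫ z in Ioi ε, secondDiff u z x / z ^ 2) - u x / x := by
  set p : ℝ → ℝ := fun y => (u x - u y) / (x - y) ^ 2 with hp
  have hx : 0 < x := hε.trans hεx
  have hD := h.integrableOn_quotient x hε
  have e1 : {y : ℝ | ε < |y - x|} = {y | 0 < y ∧ ε < |y - x|} ∪ Iic 0 := by
    ext y
    simp only [mem_ofPred_eq, mem_union, mem_Iic]
    constructor
    · intro hy
      rcases lt_or_ge 0 y with h0 | h0
      · exact Or.inl ⟨h0, hy⟩
      · exact Or.inr h0
    · rintro (hy | hy)
      · exact hy.2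
      · rw [abs_of_neg (by linarith)]; linarith
  have e2 : {y : ℝ | ε < |y - x|} = Iio (x - ε) ∪ Ioi (x + ε) := by
    ext y
    simp only [mem_ofPred_eq, mem_union, mem_Iio, mem_Ioi, lt_abs]
    constructor <;> rintro (hy | hy)
    · right; linarith
    · left; linarith
    · right; linarith
    · left; linarith
  have s1 : ∫ y in {y | ε < |y - x|}, p y =
      (∫ y in {y | 0 < y ∧ ε < |y - x|}, p y) + ∫ y in Iic 0, p y := by
    rw [e1, setIntegral_union ?_ measurableSet_Iic]
    · exact hD.mono_set (by rw [e1]; exact subset_union_left)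
    · exact hD.mono_set (by rw [e1]; exact subset_union_right)
    · exact disjoint_left.2 fun y hy hy' => absurd hy.1 (not_lt.2 hy')
  have iL : IntegrableOn p (Iio (x - ε)) := hD.mono_set (by rw [e2]; exact subset_union_left)
  have iR : IntegrableOn p (Ioi (x + ε)) := hD.mono_set (by rw [e2]; exact subset_union_right)
  have s2 : ∫ y in {y | ε < |y - x|}, p y = (∫ y in Iio (x - ε), p y) + ∫ y in Ioi (x + ε), p y := by
    rw [e2, setIntegral_union ?_ measurableSet_Ioi iL iR]
    exact disjoint_left.2 fun y hy hy' => by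
      simp only [mem_Iio, mem_Ioi] at hy hy'; linarith
  have mR := (measurePreserving_add_left (volume : Measure ℝ) x)
  have mL := (Measure.measurePreserving_sub_left (volume : Measure ℝ) x)
  have pR : (fun z => x + z) ⁻¹' Ioi (x + ε) = Ioi ε := by ext z; simp
  have pL : (fun z => x - z) ⁻¹' Iio (x - ε) = Ioi ε := by ext z; simp
  have embL : MeasurableEmbedding fun z : ℝ => x - z := (MeasurableEquiv.subLeft x).measurableEmbedding
  have eR : ∫ y in Ioi (x + ε), p y = ∫ z in Ioi ε, p (x + z) := by
    rw [← mR.setIntegral_preimage_emb (measurableEmbedding_addLeft x), pR]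
  have eL : ∫ y in Iio (x - ε), p y = ∫ z in Ioi ε, p (x - z) := by
    rw [← mL.setIntegral_preimage_emb embL, pL]
  have iR' : IntegrableOn (fun z => p (x + z)) (Ioi ε) := by
    have := (mR.integrableOn_comp_preimage (measurableEmbedding_addLeft x)).2 iR
    rwa [pR] at this
  have iL' : IntegrableOn (fun z => p (x - z)) (Ioi ε) := by
    have := (mL.integrableOn_comp_preimage embL).2 iL
    rwa [pL] at this
  have s3 : ∫ z in Ioi ε, secondDiff u z x / z ^ 2 =
      (∫ z in Ioi ε, p (x - z)) + ∫ z in Ioi ε, p (x + z) := by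
    rw [← integral_add iL' iR']
    congr 1; ext z
    simp only [hp, secondDiff, sub_sub_cancel, sub_add_cancel_left, neg_sq]
    rw [← add_div]; congr 1; ring
  have s4 : ∫ y in Iic 0, p y = u x / x := by
    have : ∀ y ∈ Iic (0 : ℝ), p y = u x * ((x - y) ^ 2)⁻¹ := fun y hy => by
      simp only [hp, h.eq_zero y hy, sub_zero, div_eq_mul_inv]
    rw [setIntegral_congr_fun measurableSet_Iic this, integral_const_mul,
      IsTestPair.integral_Iic_inv_sq hx, div_eq_mul_inv]
  change ∫ y in {y | 0 < y ∧ ε < |y - x|}, p y = _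
  rw [s3]
  linarith

/-- Existence and value of the principal value integral. -/
lemma hasPrincipalValue (h : IsHolderEdge u v M H) {x : ℝ} (hx : 0 < x) :
    HasPrincipalValue (fun y => (u x - u y) / (x - y) ^ 2) x (nonlocalOp u x - u x / x) := by
  refine ⟨fun ε hε => (h.integrableOn_quotient x hε).mono_set fun y hy => hy.2, ?_⟩
  set F : ℝ → ℝ := (Ioi (0 : ℝ)).indicator fun z => secondDiff u z x / z ^ 2
  have hF : Integrable F :=
    (integrable_indicator_iff measurableSet_Ioi).2 (h.integrableOn_secondDiff hx)
  have hc := intervalIntegral.continuous_primitive (μ := volume) (f := F)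
    (fun a b => hF.intervalIntegrable) 0
  have h1 : Tendsto (fun ε => ∫ z in (0 : ℝ)..ε, F z) (𝓝[>] 0) (𝓝 0) := by
    have := hc.tendsto 0
    rw [intervalIntegral.integral_same] at this
    exact this.mono_left nhdsWithin_le_nhds
  have h2 : Tendsto (fun ε => nonlocalOp u x - (∫ z in (0 : ℝ)..ε, F z) - u x / x) (𝓝[>] 0)
      (𝓝 (nonlocalOp u x - 0 - u x / x)) := (tendsto_const_nhds.sub h1).sub_const _
  rw [sub_zero] at h2
  refine h2.congr' ?_
  filter_upwards [self_mem_nhdsWithin, nhdsWithin_le_nhds (Iio_mem_nhds hx)] with ε hε hεx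
  have hε0 : (0 : ℝ) < ε := hε
  rw [h.integral_quotient hε0 hεx]
  congr 1
  have hi := h.integrableOn_secondDiff hx
  have e1 : ∫ z in (0 : ℝ)..ε, F z = ∫ z in Ioc 0 ε, secondDiff u z x / z ^ 2 := by
    rw [intervalIntegral.integral_of_le hε0.le]
    exact setIntegral_congr_fun measurableSet_Ioc fun z hz => indicator_of_mem (by exact hz.1) _
  rw [e1, nonlocalOp, ← Ioc_union_Ioi_eq_Ioi hε0.le, setIntegral_union (Ioc_disjoint_Ioi le_rfl)
    measurableSet_Ioi (hi.mono_set Ioc_subset_Ioi_self) (hi.mono_set (Ioi_subset_Ioi hε0.le))]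
  ring

end IsHolderEdge

/-! ### The pointwise Euler-Lagrange equation -/

namespace IsRegularProfile

variable {β ν M H : ℝ} {η θ a f : ℝ → ℝ}

lemma bound_nonneg (h : IsRegularProfile β ν η θ a f M H) : 0 ≤ M :=
  (abs_nonneg _).trans (h.abs_le 0 le_rfl)

lemma abs_indicator_le (h : IsRegularProfile β ν η θ a f M H) (x : ℝ) :
    |(Ioi (0 : ℝ)).indicator f x| ≤ M := by
  rcases lt_or_ge 0 x with hx0 | hx0
  · rw [indicator_of_mem (by exact hx0)]; exact h.abs_le x hx0.le
  · rw [indicator_of_notMem (by exact not_lt.2 hx0), abs_zero]; exact h.bound_nonneg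

lemma lipschitz (h : IsRegularProfile β ν η θ a f M H) (x y : ℝ) : |a x - a y| ≤ M * |x - y| :=
  h.profile.prim.abs_sub_le_of_bound h.abs_indicator_le x y

lemma isHolderEdge (h : IsRegularProfile β ν η θ a f M H) :
    IsHolderEdge (fun x => Real.sin (a x)) (fun x => Real.cos (a x) * f x) M
      (H + M * (2 + M)) := by
  have hM := h.bound_nonneg
  have ca := h.profile.prim.continuous
  have cf := h.continuous
  refine ⟨?_, fun x => Real.abs_sin_le_one _, fun x hx => by simp [h.profile.eq_zero x hx],
    by fun_prop, fun x hx => ?_, fun x y hx hy => ?_⟩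
  · convert h.profile.prim.sin using 1
    ext x
    by_cases hx : x ∈ Ioi (0 : ℝ) <;> simp [indicator, hx]
  · rw [abs_mul]
    exact (mul_le_of_le_one_left (abs_nonneg _) (Real.abs_cos_le_one _)).trans (h.abs_le x hx)
  · have e : Real.cos (a x) * f x - Real.cos (a y) * f y =
        Real.cos (a x) * (f x - f y) + f y * (Real.cos (a x) - Real.cos (a y)) := by ring
    have b1 : |Real.cos (a x) * (f x - f y)| ≤ H * √|x - y| := by
      rw [abs_mul]
      exact (mul_le_of_le_one_left (abs_nonneg _) (Real.abs_cos_le_one _)).trans (h.holder x y hx hy)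
    -- The difference is at most 2 and at most M|x - y|; with the common constant 2 + M the two
    -- bounds interpolate.
    have b2 : |Real.cos (a x) - Real.cos (a y)| ≤ (2 + M) * √|x - y| := by
      have h1 : |Real.cos (a x) - Real.cos (a y)| ≤ (2 + M) * 1 := by
        refine (abs_sub _ _).trans ?_
        linarith [Real.abs_cos_le_one (a x), Real.abs_cos_le_one (a y)]
      have h2 : |Real.cos (a x) - Real.cos (a y)| ≤ (2 + M) * |x - y| := by
        refine (Real.abs_cos_sub_cos_le _ _).trans ((h.lipschitz x y).trans ?_)
        exact mul_le_mul_of_nonneg_right (by linarith) (abs_nonneg _)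
      have h3 := le_min h1 h2
      rw [← mul_min_of_nonneg _ _ (by positivity)] at h3
      refine h3.trans (mul_le_mul_of_nonneg_left ?_ (by positivity))
      simpa using min_le_sqrt_mul_sqrt zero_le_one (abs_nonneg (x - y))
    have b3 : |f y * (Real.cos (a x) - Real.cos (a y))| ≤ M * ((2 + M) * √|x - y|) := by
      rw [abs_mul]
      exact mul_le_mul (h.abs_le y hy) b2 (abs_nonneg _) hM
    rw [e]
    exact (abs_add_le _ _).trans ((add_le_add b1 b3).trans (le_of_eq (by ring)))

/-- The right hand side of the Euler-Lagrange equation. -/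
noncomputable def rhs (β ν : ℝ) (a : ℝ → ℝ) (x : ℝ) : ℝ :=
  Real.sin (a x + β) * Real.cos (a x + β) +
    coeff ν * Real.cos (a x) * nonlocalOp (fun x => Real.sin (a x)) x

lemma continuousOn_rhs (h : IsRegularProfile β ν η θ a f M H) :
    ContinuousOn (rhs β ν a) (Ioi 0) := by
  have ca := h.profile.prim.continuous
  unfold rhs
  exact (Continuous.continuousOn (by fun_prop)).add
    ((Continuous.continuousOn (by fun_prop)).mul h.isHolderEdge.continuousOn_nonlocalOp)

lemma exists_abs_rhs_le (h : IsRegularProfile β ν η θ a f M H) :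
    ∃ c₀ c₁, ∀ x, 0 < x → |rhs β ν a x| ≤ c₀ + c₁ * x ^ (-(1 / 2) : ℝ) := by
  set H' := H + M * (2 + M)
  refine ⟨1 + |coeff ν| * (4 * H' + 4), |coeff ν| * (4 * M), fun x hx => ?_⟩
  have h1 := h.isHolderEdge.abs_nonlocalOp_le hx
  rw [Real.rpow_neg hx.le, ← Real.sqrt_eq_rpow]
  refine (abs_add_le _ _).trans ?_
  have h2 : |Real.sin (a x + β) * Real.cos (a x + β)| ≤ 1 := by
    rw [abs_mul]
    exact mul_le_one₀ (Real.abs_sin_le_one _) (abs_nonneg _) (Real.abs_cos_le_one _)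
  have h3 := mul_le_mul_of_nonneg_left
    ((mul_le_of_le_one_left (abs_nonneg _) (Real.abs_cos_le_one (a x))).trans h1)
    (abs_nonneg (coeff ν))
  rw [mul_assoc (coeff ν), abs_mul (coeff ν), abs_mul (Real.cos _)]
  refine (add_le_add h2 h3).trans (le_of_eq ?_)
  ring

lemma locallyIntegrable_rhs (h : IsRegularProfile β ν η θ a f M H) :
    LocallyIntegrable ((Ioi 0).indicator (rhs β ν a)) := by
  obtain ⟨c₀, c₁, hb⟩ := h.exists_abs_rhs_le
  have h1 : LocallyIntegrable fun x : ℝ => c₀ + c₁ * x ^ (-(1 / 2) : ℝ) := by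
    intro x
    refine ⟨Ioc (x - 1) (x + 1), Ioc_mem_nhds (by linarith) (by linarith), ?_⟩
    refine (intervalIntegrable_iff_integrableOn_Ioc_of_le (by linarith)).1 ?_
    exact (by simp : IntervalIntegrable (fun _ => c₀) volume (x - 1) (x + 1)).add
      ((intervalIntegral.intervalIntegrable_rpow' (by norm_num)).const_mul _)
  have h2 := h1.indicator (measurableSet_Ioi (a := (0 : ℝ)))
  refine h2.mono ?_ (Eventually.of_forall fun x => ?_)
  · exact (aestronglyMeasurable_indicator_iff measurableSet_Ioi).2
      (h.continuousOn_rhs.aestronglyMeasurable measurableSet_Ioi)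
  · by_cases hx : x ∈ Ioi (0 : ℝ)
    · rw [indicator_of_mem hx, indicator_of_mem hx]
      exact (hb x hx).trans (le_abs_self _)
    · rw [indicator_of_notMem hx, indicator_of_notMem hx]

/-- The integrated Euler-Lagrange equation. -/
theorem deriv_eq_primitive (hν : 0 < ν) (hη : IsCutoff β η) (hmin : IsMinimizer β ν η θ)
    (h : IsRegularProfile β ν η θ a f M H) {x : ℝ} (hx : 0 ≤ x) :
    f x = f 0 + primitive ((Ioi 0).indicator (rhs β ν a)) x := by
  have he := h.isHolderEdge
  have ca := h.profile.prim.continuous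
  set r := (Ioi (0 : ℝ)).indicator (rhs β ν a) with hr
  have lr := h.locallyIntegrable_rhs
  -- The integration by parts is no longer needed: the second differences have an integrable
  -- majorant uniform on the support of a test function, so Fubini yields the operator itself.
  obtain ⟨C, hC⟩ := duBoisReymond (f := (Ioi 0).indicator f) (r := r) h.profile.prim.locInt lr
    (fun φ hφ => by
      have h1 := h.profile.weak_secondDiff hν hη hmin hφ
      obtain ⟨A, B, hA, hAB, h0⟩ := hφ.exists_Icc
      have ic : Integrable fun x => Real.cos (a x) * φ x :=
        ((Real.continuous_cos.comp ca).mul hφ.continuous).integrable_of_hasCompactSupport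
          hφ.compact.mul_left
      rw [he.integral_secondDiff_test hA ic (fun x hx => by rw [h0 x hx, mul_zero])] at h1
      have is : Integrable fun x => Real.sin (a x + β) * Real.cos (a x + β) * φ x :=
        (Continuous.mul (by fun_prop) hφ.continuous).integrable_of_hasCompactSupport
          hφ.compact.mul_left
      have in' : Integrable fun x =>
          Real.cos (a x) * φ x * nonlocalOp (fun x => Real.sin (a x)) x := by
        have := hφ.integrable_mul (f := fun x => Real.cos (a x) *
          nonlocalOp (fun x => Real.sin (a x)) x)
          (((Real.continuous_cos.comp ca).continuousOn.mul
            he.continuousOn_nonlocalOp).locallyIntegrableOn measurableSet_Ioi)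
        refine this.congr (Eventually.of_forall fun x => by ring)
      have e : ∫ x, r x * φ x = (∫ x, Real.sin (a x + β) * Real.cos (a x + β) * φ x) +
          coeff ν * ∫ x, Real.cos (a x) * φ x * nonlocalOp (fun x => Real.sin (a x)) x := by
        rw [← integral_const_mul, ← integral_add is (in'.const_mul _)]
        congr 1; ext x
        by_cases hx : x ∈ Ioi (0 : ℝ)
        · rw [hr, indicator_of_mem hx, rhs]; ring
        · rw [hr, indicator_of_notMem hx, hφ.eq_zero (not_lt.1 hx)]; ring
      rw [e]
      linarith)
  have pr := isPrim_primitive lr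
  have h2 : f =ᵐ[volume.restrict (Ioi 0)] fun x => C + primitive r x := by
    filter_upwards [hC, ae_restrict_mem measurableSet_Ioi] with x hx hx0
    rw [indicator_of_mem hx0] at hx
    exact hx
  have h3 : EqOn f (fun x => C + primitive r x) (Ioi 0) :=
    Measure.eqOn_open_of_ae_eq h2 isOpen_Ioi h.continuous.continuousOn
      (continuous_const.add pr.continuous).continuousOn
  -- Passing to the closure includes the edge x = 0, where the equation identifies C with f(0).
  have h4 : EqOn f (fun x => C + primitive r x) (closure (Ioi 0)) :=
    h3.closure h.continuous (continuous_const.add pr.continuous)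
  rw [closure_Ioi] at h4
  have h5 : f 0 = C := by
    have := h4 (mem_Ici.2 le_rfl)
    simpa [primitive] using this
  rw [h5]
  exact h4 hx

lemma hasDerivAt_deriv (hν : 0 < ν) (hη : IsCutoff β η) (hmin : IsMinimizer β ν η θ)
    (h : IsRegularProfile β ν η θ a f M H) {x : ℝ} (hx : 0 < x) :
    HasDerivAt f (rhs β ν a x) x := by
  have lr := h.locallyIntegrable_rhs
  have hmem := Ioi_mem_nhds hx
  have hc : ContinuousAt (rhs β ν a) x := h.continuousOn_rhs.continuousAt hmem
  have hee : (Ioi (0 : ℝ)).indicator (rhs β ν a) =ᶠ[𝓝 x] rhs β ν a := by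
    filter_upwards [hmem] with y hy using indicator_of_mem hy _
  have h1 : HasDerivAt (primitive ((Ioi 0).indicator (rhs β ν a)))
      ((Ioi (0 : ℝ)).indicator (rhs β ν a) x) x :=
    intervalIntegral.integral_hasDerivAt_right
      (IsPrim.intervalIntegrable_of_locallyIntegrable lr _ _)
      (lr.aestronglyMeasurable.stronglyMeasurableAtFilter) (hc.congr hee.symm)
  rw [indicator_of_mem (by exact hx)] at h1
  refine (h1.const_add (f 0)).congr_of_eventuallyEq ?_
  filter_upwards [hmem] with y hy
  exact h.deriv_eq_primitive hν hη hmin (le_of_lt hy)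

end IsRegularProfile

/-! ### Hilbert's inequality and the vanishing of the pairing of u' with the nonlocal operator -/

/-- This is the Schur test for the kernel 1/(r+t) with weight √(t/r). Replacing r + t by t for r ≤ t
and by r for r > t gives 2 on each piece; the exact value π is not needed. -/
lemma lintegral_hilbertKernel_le {t : ℝ} (ht : 0 < t) :
    ∫⁻ r in Ioi (0 : ℝ), ENNReal.ofReal (√t / √r * (r + t)⁻¹) ≤ ENNReal.ofReal 4 := by
  have hst := Real.sqrt_pos.2 ht
  have hst2 := Real.mul_self_sqrt ht.le
  have i1 : IntegrableOn (fun r : ℝ => (√t)⁻¹ * r ^ (-(1 / 2) : ℝ)) (Ioc 0 t) :=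
    ((intervalIntegrable_iff_integrableOn_Ioc_of_le ht.le).1
      (intervalIntegral.intervalIntegrable_rpow' (by norm_num))).const_mul _
  have i2 : IntegrableOn (fun r : ℝ => √t * r ^ (-(3 / 2) : ℝ)) (Ioi t) :=
    (integrableOn_Ioi_rpow_of_lt (by norm_num) ht).const_mul _
  have e1 : ∫ r in Ioc 0 t, (√t)⁻¹ * r ^ (-(1 / 2) : ℝ) = 2 := by
    rw [integral_const_mul, ← intervalIntegral.integral_of_le ht.le,
      integral_rpow (Or.inl (by norm_num))]
    have : (-(1 / 2) + 1 : ℝ) = 1 / 2 := by norm_num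
    rw [this, ← Real.sqrt_eq_rpow, Real.zero_rpow (by norm_num)]
    field_simp; norm_num
  have e2 : ∫ r in Ioi t, √t * r ^ (-(3 / 2) : ℝ) = 2 := by
    rw [integral_const_mul, integral_Ioi_rpow_of_lt (by norm_num) ht]
    have : (-(3 / 2) + 1 : ℝ) = -(1 / 2) := by norm_num
    rw [this, Real.rpow_neg ht.le, ← Real.sqrt_eq_rpow]
    field_simp
  rw [← Ioc_union_Ioi_eq_Ioi ht.le, lintegral_union measurableSet_Ioi (Ioc_disjoint_Ioi le_rfl)]
  have b1 : ∫⁻ r in Ioc 0 t, ENNReal.ofReal (√t / √r * (r + t)⁻¹) ≤ ENNReal.ofReal 2 := by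
    rw [← e1, ofReal_integral_eq_lintegral_ofReal i1]
    · refine setLIntegral_mono' measurableSet_Ioc fun r hr => ENNReal.ofReal_le_ofReal ?_
      have hr0 := hr.1
      rw [Real.rpow_neg hr0.le, ← Real.sqrt_eq_rpow]
      have h1 : (r + t)⁻¹ ≤ t⁻¹ := inv_anti₀ ht (by linarith)
      have h2 : √t / √r * (r + t)⁻¹ ≤ √t / √r * t⁻¹ :=
        mul_le_mul_of_nonneg_left h1 (by positivity)
      refine h2.trans (le_of_eq ?_)
      nth_rewrite 2 [← hst2]
      field_simp
    · filter_upwards [ae_restrict_mem measurableSet_Ioc] with r hr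
      have := hr.1
      simp only [Pi.zero_apply]; positivity
  have b2 : ∫⁻ r in Ioi t, ENNReal.ofReal (√t / √r * (r + t)⁻¹) ≤ ENNReal.ofReal 2 := by
    rw [← e2, ofReal_integral_eq_lintegral_ofReal i2]
    · refine setLIntegral_mono' measurableSet_Ioi fun r hr => ENNReal.ofReal_le_ofReal ?_
      have hr0 : 0 < r := ht.trans hr
      have e3 : r ^ (-(3 / 2) : ℝ) = (√r)⁻¹ * r⁻¹ := by
        rw [Real.sqrt_eq_rpow, ← Real.rpow_neg hr0.le, ← Real.rpow_neg_one r,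
          ← Real.rpow_add hr0]
        norm_num
      rw [e3, div_eq_mul_inv, mul_assoc]
      have h1 : (r + t)⁻¹ ≤ r⁻¹ := inv_anti₀ hr0 (by linarith)
      gcongr
    · filter_upwards [ae_restrict_mem measurableSet_Ioi] with r hr
      have : 0 < r := ht.trans hr
      simp only [Pi.zero_apply]; positivity
  refine (add_le_add b1 b2).trans (le_of_eq ?_)
  rw [← ENNReal.ofReal_add (by norm_num) (by norm_num)]; norm_num

/-- Hilbert's inequality for the kernel `1 / (r + t)` on the half-line. -/
lemma hilbert_inequality {f h : ℝ → ℝ} (hf : Measurable f) (hh : Measurable h) {ε : ℝ}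
    (hε : 0 < ε) :
    ∫⁻ t in Ioi (0 : ℝ), ∫⁻ r in Ioi (0 : ℝ), ENNReal.ofReal (|f t| * |h r| * (r + t)⁻¹) ≤
      ENNReal.ofReal (2 * ε) * (∫⁻ t in Ioi (0 : ℝ), ENNReal.ofReal (f t ^ 2)) +
      ENNReal.ofReal (2 * ε⁻¹) * ∫⁻ r in Ioi (0 : ℝ), ENNReal.ofReal (h r ^ 2) := by
  -- Weighted AM-GM splits |f(t)||h(r)| into a part with f² and weight √(t/r) and a part with h² and
  -- the reciprocal weight. Each is integrated first in the variable absent from the square, where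
  -- the Schur bound 4 turns ε/2 and ε⁻¹/2 into 2ε and 2ε⁻¹.
  set k : ℝ → ℝ → ℝ := fun t r => √t / √r * (r + t)⁻¹ with hk
  have mk : Measurable (Function.uncurry k) := by
    have : Function.uncurry k = fun q : ℝ × ℝ => √q.1 / √q.2 * (q.2 + q.1)⁻¹ := by ext ⟨t, r⟩; rfl
    rw [this]; fun_prop
  set F : ℝ → ℝ → ℝ≥0∞ := fun t r => ENNReal.ofReal (ε / 2) * ENNReal.ofReal (f t ^ 2) *
    ENNReal.ofReal (k t r)
  set G : ℝ → ℝ → ℝ≥0∞ := fun t r => ENNReal.ofReal (ε⁻¹ / 2) * ENNReal.ofReal (h r ^ 2) *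
    ENNReal.ofReal (k r t)
  have mF : Measurable (Function.uncurry F) := by
    refine Measurable.mul (f := fun q : ℝ × ℝ => ENNReal.ofReal (ε / 2) * ENNReal.ofReal (f q.1 ^ 2))
      (by fun_prop) mk.ennreal_ofReal
  have mG : Measurable (Function.uncurry G) := by
    refine Measurable.mul (f := fun q : ℝ × ℝ => ENNReal.ofReal (ε⁻¹ / 2) * ENNReal.ofReal (h q.2 ^ 2))
      (by fun_prop) (mk.comp measurable_swap).ennreal_ofReal
  have hpt : ∀ t ∈ Ioi (0 : ℝ), ∀ r ∈ Ioi (0 : ℝ),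
      ENNReal.ofReal (|f t| * |h r| * (r + t)⁻¹) ≤ F t r + G t r := by
    intro t ht r hr
    have ht0 : (0 : ℝ) < t := ht
    have hr0 : (0 : ℝ) < r := hr
    have hst := Real.sqrt_pos.2 ht0
    have hsr := Real.sqrt_pos.2 hr0
    simp only [F, G]
    have k1 : 0 ≤ k t r := by simp only [hk]; positivity
    have k2 : 0 ≤ k r t := by simp only [hk]; positivity
    rw [← ENNReal.ofReal_mul (by positivity), ← ENNReal.ofReal_mul (by positivity),
      ← ENNReal.ofReal_mul (by positivity), ← ENNReal.ofReal_mul (by positivity),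
      ← ENNReal.ofReal_add (by positivity) (by positivity)]
    refine ENNReal.ofReal_le_ofReal ?_
    have hi : 0 < (r + t)⁻¹ := by positivity
    have e : ε / 2 * f t ^ 2 * k t r + ε⁻¹ / 2 * h r ^ 2 * k r t =
        (ε / 2 * |f t| ^ 2 * (√t / √r) + ε⁻¹ / 2 * |h r| ^ 2 * (√r / √t)) * (r + t)⁻¹ := by
      simp only [hk, sq_abs]
      rw [add_comm t r]; ring
    rw [e]
    refine mul_le_mul_of_nonneg_right ?_ hi.le
    have e2 : ε / 2 * |f t| ^ 2 * (√t / √r) + ε⁻¹ / 2 * |h r| ^ 2 * (√r / √t) - |f t| * |h r| =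
        (ε * √t * |f t| - √r * |h r|) ^ 2 / (2 * ε * √t * √r) := by
      field_simp; ring
    have e3 : 0 ≤ (ε * √t * |f t| - √r * |h r|) ^ 2 / (2 * ε * √t * √r) := by positivity
    linarith
  have hF : ∫⁻ t in Ioi (0 : ℝ), ∫⁻ r in Ioi (0 : ℝ), F t r ≤
      ENNReal.ofReal (2 * ε) * ∫⁻ t in Ioi (0 : ℝ), ENNReal.ofReal (f t ^ 2) := by
    rw [← lintegral_const_mul' _ _ ENNReal.ofReal_ne_top]
    refine setLIntegral_mono' measurableSet_Ioi fun t ht => ?_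
    simp only [F]
    rw [lintegral_const_mul' _ _ (ENNReal.mul_ne_top ENNReal.ofReal_ne_top ENNReal.ofReal_ne_top)]
    refine (mul_le_mul_right (lintegral_hilbertKernel_le ht) _).trans (le_of_eq ?_)
    rw [mul_right_comm, ← ENNReal.ofReal_mul (by positivity)]
    congr 2; ring
  have hG : ∫⁻ t in Ioi (0 : ℝ), ∫⁻ r in Ioi (0 : ℝ), G t r ≤
      ENNReal.ofReal (2 * ε⁻¹) * ∫⁻ r in Ioi (0 : ℝ), ENNReal.ofReal (h r ^ 2) := by
    rw [lintegral_lintegral_swap mG.aemeasurable, ← lintegral_const_mul' _ _ ENNReal.ofReal_ne_top]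
    refine setLIntegral_mono' measurableSet_Ioi fun r hr => ?_
    simp only [G]
    rw [lintegral_const_mul' _ _ (ENNReal.mul_ne_top ENNReal.ofReal_ne_top ENNReal.ofReal_ne_top)]
    refine (mul_le_mul_right (lintegral_hilbertKernel_le hr) _).trans (le_of_eq ?_)
    rw [mul_right_comm, ← ENNReal.ofReal_mul (by positivity)]
    congr 2; ring
  have mF1 : Measurable fun t => ∫⁻ r in Ioi (0 : ℝ), F t r := Measurable.lintegral_prod_right mF
  calc _ ≤ ∫⁻ t in Ioi (0 : ℝ), ∫⁻ r in Ioi (0 : ℝ), (F t r + G t r) :=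
        setLIntegral_mono' measurableSet_Ioi fun t ht =>
          setLIntegral_mono' measurableSet_Ioi fun r hr => hpt t ht r hr
    _ = ∫⁻ t in Ioi (0 : ℝ), ((∫⁻ r in Ioi (0 : ℝ), F t r) + ∫⁻ r in Ioi (0 : ℝ), G t r) := by
        refine lintegral_congr fun t => ?_
        exact lintegral_add_left (mF.comp (by fun_prop : Measurable fun r : ℝ => (t, r))) _
    _ = _ := lintegral_add_left mF1 _
    _ ≤ _ := add_le_add hF hG

lemma lintegral_Ioi_inv_sq {c : ℝ} (hc : 0 < c) :
    ∫⁻ s in Ioi c, ENNReal.ofReal ((s ^ 2)⁻¹) = ENNReal.ofReal c⁻¹ := by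
  have e : ∀ s ∈ Ioi c, ENNReal.ofReal ((s ^ 2)⁻¹) = ENNReal.ofReal (s ^ (-2 : ℝ)) := fun s hs => by
    rw [Real.rpow_neg (hc.trans hs).le]; norm_cast
  rw [setLIntegral_congr_fun measurableSet_Ioi e, ← ofReal_integral_eq_lintegral_ofReal
    (integrableOn_Ioi_rpow_of_lt (by norm_num) hc), integral_Ioi_rpow_of_lt (by norm_num) hc]
  · norm_num
    rw [Real.rpow_neg_one]
  · filter_upwards [ae_restrict_mem measurableSet_Ioi] with s hs
    have : 0 < s := hc.trans hs
    simp only [Pi.zero_apply]; positivity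

/-- A triple integral that reduces to the Hilbert kernel. -/
lemma lintegral_triple_eq {f h : ℝ → ℝ} (hf : Measurable f) (hh : Measurable h) :
    ∫⁻ z in Ioi (0 : ℝ), ∫⁻ s in Ioi (0 : ℝ), (Iio z).indicator (fun s =>
      ENNReal.ofReal ((z ^ 2)⁻¹) * (ENNReal.ofReal |f (z - s)| *
        ∫⁻ r in Ioi (0 : ℝ), (Iio s).indicator (fun r => ENNReal.ofReal |h r|) r)) s =
      ∫⁻ t in Ioi (0 : ℝ), ∫⁻ r in Ioi (0 : ℝ), ENNReal.ofReal (|f t| * |h r| * (r + t)⁻¹) := by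
  set D : ℝ → ℝ≥0∞ := fun s => ∫⁻ r in Ioi (0 : ℝ), (Iio s).indicator
    (fun r => ENNReal.ofReal |h r|) r with hD
  have mI : MeasurableSet {q : ℝ × ℝ | q.2 < q.1} := measurableSet_lt measurable_snd measurable_fst
  have mD : Measurable D := by
    refine Measurable.lintegral_prod_right' (f := fun q : ℝ × ℝ =>
      (Iio q.1).indicator (fun r => ENNReal.ofReal |h r|) q.2) ?_
    have : (fun q : ℝ × ℝ => (Iio q.1).indicator (fun r => ENNReal.ofReal |h r|) q.2) =
        {q : ℝ × ℝ | q.2 < q.1}.indicator fun q => ENNReal.ofReal |h q.2| := by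
      ext q; simp [indicator]
    rw [this]
    exact Measurable.indicator (by fun_prop) mI
  have m1 : Measurable (Function.uncurry fun z s : ℝ => (Iio z).indicator (fun s =>
      ENNReal.ofReal ((z ^ 2)⁻¹) * (ENNReal.ofReal |f (z - s)| * D s)) s) := by
    have : (Function.uncurry fun z s : ℝ => (Iio z).indicator (fun s =>
        ENNReal.ofReal ((z ^ 2)⁻¹) * (ENNReal.ofReal |f (z - s)| * D s)) s) =
        {q : ℝ × ℝ | q.2 < q.1}.indicator fun q =>
          ENNReal.ofReal ((q.1 ^ 2)⁻¹) * (ENNReal.ofReal |f (q.1 - q.2)| * D q.2) := by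
      ext ⟨z, s⟩; simp [indicator, Function.uncurry]
    rw [this]
    exact Measurable.indicator (by fun_prop) mI
  rw [lintegral_lintegral_swap m1.aemeasurable]
  -- Substitute z = t + s, so that the argument of f becomes an independent variable t > 0.
  have e1 : ∀ s ∈ Ioi (0 : ℝ), ∫⁻ z in Ioi (0 : ℝ), (Iio z).indicator (fun s =>
      ENNReal.ofReal ((z ^ 2)⁻¹) * (ENNReal.ofReal |f (z - s)| * D s)) s =
      ∫⁻ t in Ioi (0 : ℝ), ENNReal.ofReal (((t + s) ^ 2)⁻¹) * (ENNReal.ofReal |f t| * D s) := by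
    intro s hs
    have hs0 : (0 : ℝ) < s := hs
    rw [← lintegral_indicator measurableSet_Ioi, ← lintegral_indicator measurableSet_Ioi,
      ← lintegral_add_right_eq_self _ s]
    refine lintegral_congr fun t => ?_
    by_cases ht : 0 < t
    · have : 0 < t + s := by linarith
      simp [indicator, ht, this]
    · simp [indicator, ht]
  rw [setLIntegral_congr_fun measurableSet_Ioi e1, lintegral_lintegral_swap (by fun_prop)]
  refine setLIntegral_congr_fun measurableSet_Ioi fun t ht => ?_
  have ht0 : (0 : ℝ) < t := ht
  have e2 : ∀ s, ENNReal.ofReal (((t + s) ^ 2)⁻¹) * (ENNReal.ofReal |f t| * D s) =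
      ∫⁻ r in Ioi (0 : ℝ), ENNReal.ofReal |f t| * (ENNReal.ofReal (((t + s) ^ 2)⁻¹) *
        (Iio s).indicator (fun r => ENNReal.ofReal |h r|) r) := by
    intro s
    rw [lintegral_const_mul' _ _ ENNReal.ofReal_ne_top,
      lintegral_const_mul' _ _ ENNReal.ofReal_ne_top]
    ring
  simp only [e2]
  have m2 : Measurable (Function.uncurry fun s r : ℝ => ENNReal.ofReal |f t| *
      (ENNReal.ofReal (((t + s) ^ 2)⁻¹) *
        (Iio s).indicator (fun r => ENNReal.ofReal |h r|) r)) := by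
    have : (Function.uncurry fun s r : ℝ => ENNReal.ofReal |f t| *
      (ENNReal.ofReal (((t + s) ^ 2)⁻¹) *
        (Iio s).indicator (fun r => ENNReal.ofReal |h r|) r)) = fun q : ℝ × ℝ =>
        ENNReal.ofReal |f t| * (ENNReal.ofReal (((t + q.1) ^ 2)⁻¹) *
        {q : ℝ × ℝ | q.2 < q.1}.indicator (fun q => ENNReal.ofReal |h q.2|) q) := by
      ext ⟨s, r⟩; simp [indicator, Function.uncurry]
    rw [this]
    have := Measurable.indicator (f := fun q : ℝ × ℝ => ENNReal.ofReal |h q.2|) (by fun_prop) mI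
    fun_prop
  rw [lintegral_lintegral_swap m2.aemeasurable]
  refine setLIntegral_congr_fun measurableSet_Ioi fun r hr => ?_
  have hr0 : (0 : ℝ) < r := hr
  have e3 : ∀ s, (Ioi (0 : ℝ)).indicator (fun s => ENNReal.ofReal |f t| *
      (ENNReal.ofReal (((t + s) ^ 2)⁻¹) *
        (Iio s).indicator (fun r => ENNReal.ofReal |h r|) r)) s =
      ENNReal.ofReal (|f t| * |h r|) *
        (Ioi (r + t)).indicator (fun y => ENNReal.ofReal ((y ^ 2)⁻¹)) (s + t) := by
    intro s
    simp only [ENNReal.ofReal_mul (abs_nonneg (f t)), add_comm t]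
    by_cases hs : r < s
    · have : 0 < s := hr0.trans hs
      simp only [indicator, mem_Ioi, mem_Iio, hs, this, if_true, add_lt_add_iff_right]
      ring
    · simp [indicator, hs]
  rw [← lintegral_indicator measurableSet_Ioi]
  simp only [e3]
  -- The last integration, over s > r, is ∫ (t+s)⁻² ds = (r+t)⁻¹.
  rw [lintegral_const_mul' _ _ ENNReal.ofReal_ne_top, lintegral_add_right_eq_self
    (fun y => (Ioi (r + t)).indicator (fun y => ENNReal.ofReal ((y ^ 2)⁻¹)) y) t,
    lintegral_indicator measurableSet_Ioi, lintegral_Ioi_inv_sq (by linarith),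
    ← ENNReal.ofReal_mul (by positivity)]

namespace IsHolderEdge

variable {u v : ℝ → ℝ} {M H : ℝ}

lemma measurable_indicator (h : IsHolderEdge u v M H) : Measurable ((Ioi 0).indicator v) :=
  h.continuous_deriv.measurable.indicator measurableSet_Ioi

lemma abs_indicator_le (h : IsHolderEdge u v M H) (x : ℝ) : |(Ioi (0 : ℝ)).indicator v x| ≤ M := by
  rcases lt_or_ge 0 x with hx0 | hx0
  · rw [indicator_of_mem (by exact hx0)]; exact h.abs_le x hx0.le
  · rw [indicator_of_notMem (by exact not_lt.2 hx0), abs_zero]; exact h.bound_nonneg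

/-- The antisymmetry of the pairing of `u'` with the second differences of `u`: only a boundary
contribution remains. -/
lemma integral_deriv_mul_secondDiff (h : IsHolderEdge u v M H) {b z : ℝ}
    (hz : 0 ≤ z) :
    ∫ x in (0 : ℝ)..b, (Ioi (0 : ℝ)).indicator v x * secondDiff u z x =
      ∫ s in (0 : ℝ)..z, (Ioi (0 : ℝ)).indicator v (b + s - z) * (u b - u (b + s)) := by
  set g := (Ioi (0 : ℝ)).indicator v with hg
  have hp : IsPrim u g := h.prim
  have cu := h.continuous
  have hg0 : ∀ x, x ≤ 0 → g x = 0 := fun x hx => indicator_of_notMem (by exact not_lt.2 hx) _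
  have hpz : IsPrim (fun x => u (x - z)) fun x => g (x - z) := by
    refine ⟨?_, fun x y => ?_⟩
    · refine LocallyIntegrable.mono (locallyIntegrable_const M) ?_
        (Eventually.of_forall fun x => (h.abs_indicator_le _).trans (le_abs_self _))
      exact (h.measurable_indicator.comp (by fun_prop)).aestronglyMeasurable
    · rw [intervalIntegral.integral_comp_sub_right (fun x => g x), hp.eq]
  have imul : ∀ (f' k : ℝ → ℝ) (x y : ℝ), IntervalIntegrable f' volume x y → Continuous k →
      IntervalIntegrable (fun t => f' t * k t) volume x y :=
    fun f' k x y hf hk => hf.mul_continuousOn hk.continuousOn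
  have e1 : ∫ x in (0 : ℝ)..b, g x * secondDiff u z x = (∫ x in (0 : ℝ)..b, (g x * u x + u x * g x)) -
      (∫ x in (0 : ℝ)..b, g x * u (x + z)) - ∫ x in (0 : ℝ)..b, g x * u (x - z) := by
    have i1 : IntervalIntegrable (fun x => g x * u x + u x * g x) volume 0 b :=
      (imul _ _ _ _ (hp.ii 0 b) cu).add ((hp.ii 0 b).continuousOn_mul cu.continuousOn)
    have i2 := imul _ (fun x => u (x + z)) _ _ (hp.ii 0 b) (by fun_prop)
    have i3 := imul _ (fun x => u (x - z)) _ _ (hp.ii 0 b) (by fun_prop)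
    rw [← intervalIntegral.integral_sub i1 i2, ← intervalIntegral.integral_sub (i1.sub i2) i3]
    congr 1; ext x; unfold secondDiff; ring
  have e2 := (hp.mul hp).eq 0 b
  have e3 := (hp.mul hpz).eq 0 b
  rw [intervalIntegral.integral_add (imul _ _ _ _ (hp.ii 0 b) (by fun_prop))
    ((hpz.ii 0 b).continuousOn_mul cu.continuousOn)] at e3
  have iz : ∀ x y, IntervalIntegrable (fun x => u x * g (x - z)) volume x y := fun x y =>
    (hpz.ii x y).continuousOn_mul cu.continuousOn
  -- Shifting by z makes this the same integrand as in the product rule for u(x) u(x-z), except on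
  -- [b, b+z]. The integrals over (0, b) thus cancel and only the interval beyond b is left; there
  -- is no contribution at 0 because u and g vanish to its left.
  have e4 : ∫ x in (0 : ℝ)..b, g x * u (x + z) =
      (∫ x in (0 : ℝ)..b, u x * g (x - z)) + ∫ x in b..(b + z), u x * g (x - z) := by
    rw [intervalIntegral.integral_add_adjacent_intervals (iz _ _) (iz _ _),
      ← intervalIntegral.integral_add_adjacent_intervals (iz 0 z) (iz z (b + z))]
    have z1 : ∫ x in (0 : ℝ)..z, u x * g (x - z) = 0 := by
      refine intervalIntegral.integral_zero_ae (Eventually.of_forall fun x hx => ?_)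
      rw [uIoc_of_le hz] at hx
      rw [hg0 _ (by linarith [hx.2]), mul_zero]
    have z2 := intervalIntegral.integral_comp_add_right (a := 0) (b := b)
      (fun x => u x * g (x - z)) z
    simp only [add_sub_cancel_right, zero_add] at z2
    rw [z1, zero_add, ← z2]
    congr 1; ext x; ring
  have e5 : ∫ s in (0 : ℝ)..z, g (b + s - z) * (u b - u (b + s)) =
      ∫ x in b..(b + z), g (x - z) * (u b - u x) := by
    have := intervalIntegral.integral_comp_add_left (a := 0) (b := z)
      (fun x => g (x - z) * (u b - u x)) b
    rwa [add_zero] at this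
  have e6 : ∫ x in b..(b + z), g (x - z) * (u b - u x) =
      (∫ x in b..(b + z), g (x - z)) * u b - ∫ x in b..(b + z), u x * g (x - z) := by
    rw [← intervalIntegral.integral_mul_const, ← intervalIntegral.integral_sub
      ((hpz.ii _ _).mul_const _) (iz _ _)]
    congr 1; ext x; ring
  have e7 := hpz.eq b (b + z)
  have u0 : u 0 = 0 := h.eq_zero 0 le_rfl
  simp only [u0, add_sub_cancel_right, zero_mul, sub_zero] at e2 e3 e7
  rw [e1, ← e2, e4, e5, e6, ← e7]
  linarith

/-- The pairing of `u'` with the nonlocal operator on `(0, b)` is controlled by the tail. -/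
lemma ofReal_abs_pairing_le (h : IsHolderEdge u v M H) {b ε : ℝ} (hb : 0 ≤ b) (hε : 0 < ε) :
    ENNReal.ofReal |∫ x in (0 : ℝ)..b, (Ioi (0 : ℝ)).indicator v x * nonlocalOp u x| ≤
      ENNReal.ofReal (2 * ε) * (∫⁻ x, ENNReal.ofReal ((Ioi (0 : ℝ)).indicator v x ^ 2)) +
      ENNReal.ofReal (2 * ε⁻¹) * ∫⁻ x in Ioi b, ENNReal.ofReal ((Ioi (0 : ℝ)).indicator v x ^ 2) := by
  set g := (Ioi (0 : ℝ)).indicator v with hg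
  have hp : IsPrim u g := h.prim
  have mg : Measurable g := h.measurable_indicator
  have hM := h.bound_nonneg
  have hH := h.holder_nonneg
  set w := (Ioc (0 : ℝ) b).indicator g with hw
  -- The pointwise majorant blows up like x^(-1/2) at the edge, which is still integrable on (0, b].
  set ρ : ℝ → ℝ := (Ioc (0 : ℝ) b).indicator fun x => M * (1 + 2 * H + 2 * M * x ^ (-(1 / 2) : ℝ)) with hρ
  have iρ : Integrable ρ := by
    rw [hρ, integrable_indicator_iff measurableSet_Ioc]
    refine Integrable.const_mul ?_ M
    have i1 : IntegrableOn (fun x : ℝ => 2 * M * x ^ (-(1 / 2) : ℝ)) (Ioc 0 b) :=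
      ((intervalIntegrable_iff_integrableOn_Ioc_of_le hb).1
        (intervalIntegral.intervalIntegrable_rpow' (by norm_num))).const_mul _
    exact (integrableOn_const (by simp) : IntegrableOn (fun _ : ℝ => 1 + 2 * H) (Ioc 0 b)).add i1
  obtain ⟨-, fub⟩ := secondDiff_fubini_of_bound (f := u) (w := w) (b := opBound 1) (ρ := ρ)
    h.continuous (mg.indicator measurableSet_Ioc).aestronglyMeasurable (measurableSet_Ioi (a := 0))
    (integrable_opBound 1).integrableOn iρ (fun z hz x => by
      have hz0 : (0 : ℝ) < z := hz
      by_cases hx : x ∈ Ioc 0 b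
      · rw [hw, hρ, indicator_of_mem hx, indicator_of_mem hx, abs_mul]
        have hx0 := hx.1
        have b1 := h.abs_secondDiff_div_le hx0 le_rfl hz0
        set K := 2 * H + 2 * M / √x with hK
        have hK0 : 0 ≤ K := by positivity
        -- Fubini is applied with a majorant in product form, so the dependence on x through K is
        -- separated from z.
        have b2 : opBound K z ≤ opBound 1 z * (1 + K) := by
          have n1 : 0 ≤ (Ioc (0 : ℝ) 1).indicator (fun z => z ^ (-(1 / 2) : ℝ)) z :=
            indicator_nonneg (fun y hy => by have := hy.1; positivity) _
          have n2 : 0 ≤ (Ioi (1 : ℝ)).indicator (fun z => 4 * z ^ (-2 : ℝ)) z :=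
            indicator_nonneg (fun y hy => by have : (0 : ℝ) < y := one_pos.trans hy; positivity) _
          have e : ∀ K, opBound K z = K * (Ioc (0 : ℝ) 1).indicator (fun z => z ^ (-(1 / 2) : ℝ)) z +
              (Ioi (1 : ℝ)).indicator (fun z => 4 * z ^ (-2 : ℝ)) z := fun K => by
            rw [opBound, indicator_const_mul]
          rw [e K, e 1]
          nlinarith [mul_nonneg hK0 n2]
        have b3 := mul_le_mul (h.abs_indicator_le x) (b1.trans b2) (abs_nonneg _) hM
        refine b3.trans (le_of_eq ?_)
        rw [hK, Real.rpow_neg hx0.le, ← Real.sqrt_eq_rpow]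
        ring
      · rw [hw, hρ, indicator_of_notMem hx, indicator_of_notMem hx]; simp)
  have e1 : ∫ x in (0 : ℝ)..b, g x * nonlocalOp u x = ∫ x, w x * nonlocalOp u x := by
    rw [intervalIntegral.integral_of_le hb, ← integral_indicator measurableSet_Ioc]
    congr 1; ext x
    by_cases hx : x ∈ Ioc 0 b
    · rw [hw, indicator_of_mem hx, indicator_of_mem hx]
    · rw [hw, indicator_of_notMem hx, indicator_of_notMem hx, zero_mul]
  have e2 : ∀ z, ∫ x, w x * secondDiff u z x = ∫ x in (0 : ℝ)..b, g x * secondDiff u z x := by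
    intro z
    rw [intervalIntegral.integral_of_le hb, ← integral_indicator measurableSet_Ioc]
    congr 1; ext x
    by_cases hx : x ∈ Ioc 0 b
    · rw [hw, indicator_of_mem hx, indicator_of_mem hx]
    · rw [hw, indicator_of_notMem hx, indicator_of_notMem hx, zero_mul]
  rw [e1]
  unfold nonlocalOp
  rw [← fub]
  -- The difference u(b) - u(b+s) is bounded by the integral of |g| over (b, b+s). Only products of
  -- a value of g at distance z - s to the left of b with a value at distance r < s to the right
  -- remain.
  have b1 : ∀ z ∈ Ioi (0 : ℝ), ENNReal.ofReal ‖(∫ x, w x * secondDiff u z x) / z ^ 2‖ ≤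
      ∫⁻ s in Ioi (0 : ℝ), (Iio z).indicator (fun s =>
        ENNReal.ofReal ((z ^ 2)⁻¹) * (ENNReal.ofReal |g (b - (z - s))| *
        ∫⁻ r in Ioi (0 : ℝ), (Iio s).indicator (fun r => ENNReal.ofReal |g (b + r)|) r)) s := by
    intro z hz
    have hz0 : (0 : ℝ) < z := hz
    rw [e2, h.integral_deriv_mul_secondDiff hz0.le, norm_div, Real.norm_of_nonneg (sq_nonneg z),
      div_eq_inv_mul, ENNReal.ofReal_mul (by positivity)]
    have b2 : ENNReal.ofReal ‖∫ s in (0 : ℝ)..z, g (b + s - z) * (u b - u (b + s))‖ ≤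
        ∫⁻ s in Ioc 0 z, ENNReal.ofReal ‖g (b + s - z) * (u b - u (b + s))‖ := by
      rw [intervalIntegral.integral_of_le hz0.le]
      refine ENNReal.ofReal_le_of_le_toReal ?_
      exact norm_integral_le_lintegral_norm _
    refine (mul_le_mul_right b2 _).trans ?_
    rw [← lintegral_const_mul' _ _ ENNReal.ofReal_ne_top, ← restrict_Ioo_eq_restrict_Ioc,
      ← lintegral_indicator measurableSet_Ioo, ← lintegral_indicator measurableSet_Ioi]
    refine lintegral_mono fun s => ?_
    by_cases hs : s ∈ Ioo 0 z
    · have hs0 := hs.1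
      rw [indicator_of_mem hs, indicator_of_mem (by exact hs.1), indicator_of_mem (by exact hs.2),
        norm_mul, ENNReal.ofReal_mul (norm_nonneg _), show b - (z - s) = b + s - z by ring]
      refine mul_le_mul_right (mul_le_mul_right ?_ _) _
      have b3 : u (b + s) - u b = ∫ r in Ioc 0 s, g (b + r) := by
        rw [← intervalIntegral.integral_of_le hs0.le, intervalIntegral.integral_comp_add_left,
          add_zero, hp.eq]
      rw [← norm_neg, neg_sub, b3]
      refine (ENNReal.ofReal_le_of_le_toReal (norm_integral_le_lintegral_norm _)).trans ?_
      rw [← restrict_Ioo_eq_restrict_Ioc, ← lintegral_indicator measurableSet_Ioo,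
        ← lintegral_indicator measurableSet_Ioi]
      refine lintegral_mono fun r => ?_
      by_cases hr : r ∈ Ioo 0 s
      · rw [indicator_of_mem hr, indicator_of_mem (by exact hr.1), indicator_of_mem (by exact hr.2)]
        exact le_rfl
      · rw [indicator_of_notMem hr]; exact zero_le
    · rw [indicator_of_notMem hs]; exact zero_le
  have mf : Measurable fun t => g (b - t) := mg.comp (by fun_prop)
  have mh : Measurable fun r => g (b + r) := mg.comp (by fun_prop)
  have b4 : ENNReal.ofReal |∫ z in Ioi (0 : ℝ), (∫ x, w x * secondDiff u z x) / z ^ 2| ≤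
      ∫⁻ z in Ioi (0 : ℝ), ENNReal.ofReal ‖(∫ x, w x * secondDiff u z x) / z ^ 2‖ :=
    by
      rw [← Real.norm_eq_abs]
      exact ENNReal.ofReal_le_of_le_toReal (norm_integral_le_lintegral_norm _)
  refine b4.trans ((setLIntegral_mono' measurableSet_Ioi b1).trans ?_)
  -- Hilbert's inequality is applied to g reflected about b and g translated by b; the first
  -- function is bounded by the full L² norm, the second is the tail beyond b.
  rw [lintegral_triple_eq mf mh]
  refine (hilbert_inequality mf mh hε).trans (add_le_add ?_ (le_of_eq ?_))
  · refine mul_le_mul_right ((setLIntegral_le_lintegral _ _).trans (le_of_eq ?_)) _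
    exact lintegral_sub_left_eq_self (fun x => ENNReal.ofReal (g x ^ 2)) b
  · congr 1
    rw [← lintegral_indicator measurableSet_Ioi, ← lintegral_indicator measurableSet_Ioi]
    conv_rhs => rw [← lintegral_add_left_eq_self _ b]
    refine lintegral_congr fun r => ?_
    by_cases hr : 0 < r
    · rw [indicator_of_mem (by exact hr), indicator_of_mem (by simpa using hr)]
    · rw [indicator_of_notMem (by exact hr), indicator_of_notMem (by simpa using hr)]

/-- The pairing of `u'` with the nonlocal operator vanishes. -/
lemma tendsto_pairing (h : IsHolderEdge u v M H) (h2 : MemLp ((Ioi 0).indicator v) 2 volume) :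
    Tendsto (fun b => ∫ x in (0 : ℝ)..b, (Ioi (0 : ℝ)).indicator v x * nonlocalOp u x) atTop
      (𝓝 0) := by
  set g := (Ioi (0 : ℝ)).indicator v with hg
  have hi := h2.integrable_sq
  set N := ∫ x, g x ^ 2
  have hN : 0 ≤ N := integral_nonneg fun x => sq_nonneg _
  have hbd : ∀ ε, 0 < ε → ∀ b, 0 ≤ b → |∫ x in (0 : ℝ)..b, g x * nonlocalOp u x| ≤
      2 * ε * N + 2 * ε⁻¹ * ∫ x in Ioi b, g x ^ 2 := by
    intro ε hε b hb
    have h1 := h.ofReal_abs_pairing_le hb hε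
    have hτ : 0 ≤ ∫ x in Ioi b, g x ^ 2 := integral_nonneg fun x => sq_nonneg _
    rw [← ofReal_integral_eq_lintegral_ofReal hi (Eventually.of_forall fun x => sq_nonneg _),
      ← ofReal_integral_eq_lintegral_ofReal hi.integrableOn (Eventually.of_forall fun x => sq_nonneg _),
      ← ENNReal.ofReal_mul (by positivity), ← ENNReal.ofReal_mul (by positivity),
      ← ENNReal.ofReal_add (by positivity) (by positivity)] at h1
    exact (ENNReal.ofReal_le_ofReal_iff (by positivity)).1 h1
  have hτ : Tendsto (fun b => ∫ x in Ioi b, g x ^ 2) atTop (𝓝 0) := by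
    have h3 := intervalIntegral_tendsto_integral_Ioi (0 : ℝ) hi.integrableOn tendsto_id
    have h4 : Tendsto (fun b => (∫ x in Ioi (0 : ℝ), g x ^ 2) - ∫ x in (0 : ℝ)..b, g x ^ 2) atTop
        (𝓝 ((∫ x in Ioi (0 : ℝ), g x ^ 2) - ∫ x in Ioi (0 : ℝ), g x ^ 2)) :=
      tendsto_const_nhds.sub h3
    rw [sub_self] at h4
    refine h4.congr' ?_
    filter_upwards [eventually_ge_atTop 0] with b hb
    rw [intervalIntegral.integral_of_le hb, ← Ioc_union_Ioi_eq_Ioi hb,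
      setIntegral_union (Ioc_disjoint_Ioi le_rfl) measurableSet_Ioi hi.integrableOn hi.integrableOn]
    ring
  rw [Metric.tendsto_atTop]
  intro δ hδ
  -- First ε makes the full-norm term less than δ/2, then large b makes the tail term small for this
  -- fixed ε.
  set ε := δ / (4 * (N + 1)) with hε
  have hε0 : 0 < ε := by positivity
  have hsmall : ∀ᶠ b in atTop, ∫ x in Ioi b, g x ^ 2 < ε * δ / 4 :=
    hτ.eventually_lt_const (by positivity)
  obtain ⟨B, hB⟩ := eventually_atTop.1 (hsmall.and (eventually_ge_atTop 0))
  refine ⟨B, fun b hb => ?_⟩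
  obtain ⟨k1, k2⟩ := hB b hb
  rw [Real.dist_eq, sub_zero]
  refine (hbd ε hε0 b k2).trans_lt ?_
  have e1 : 2 * ε * N < δ / 2 := by
    have : ε * (4 * (N + 1)) = δ := by rw [hε]; field_simp
    nlinarith
  have e2 : 2 * ε⁻¹ * (∫ x in Ioi b, g x ^ 2) < 2 * ε⁻¹ * (ε * δ / 4) :=
    mul_lt_mul_of_pos_left k1 (by positivity)
  have e3 : 2 * ε⁻¹ * (ε * δ / 4) = δ / 2 := by field_simp; norm_num
  linarith

end IsHolderEdge

/-! ### Behaviour at infinity and the slope at the edge -/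

/-- A square-integrable Hölder continuous function on the half-line tends to zero at infinity. -/
lemma tendsto_zero_of_sq_integrable {f : ℝ → ℝ} {K : ℝ} (hc : Continuous f)
    (hi : IntegrableOn (fun x => f x ^ 2) (Ioi 0))
    (hK : ∀ x y, 0 ≤ x → 0 ≤ y → |f x - f y| ≤ K * √|x - y|) : Tendsto f atTop (𝓝 0) := by
  have hK0 : 0 ≤ K := by
    have := (abs_nonneg _).trans (hK 1 0 zero_le_one le_rfl); simpa using this
  rw [Metric.tendsto_atTop]
  intro ε hε
  -- With δ = s² the function varies by at most Ks ≤ ε/2 on an interval of length δ. A value of size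
  -- ε would then give this interval an integral of at least δε²/4, against the convergence of the
  -- integral.
  set s := ε / (2 * (K + 1)) with hs
  have hs0 : 0 < s := by positivity
  have hKs : K * s ≤ ε / 2 := by
    have : s * (2 * (K + 1)) = ε := by rw [hs]; field_simp
    nlinarith
  set δ := s ^ 2 with hδ
  have hδ0 : 0 < δ := by positivity
  have hP := intervalIntegral_tendsto_integral_Ioi (0 : ℝ) hi tendsto_id
  have hP' := intervalIntegral_tendsto_integral_Ioi (0 : ℝ) hi
    (tendsto_atTop_add_const_right atTop δ tendsto_id)
  have hD := hP'.sub hP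
  rw [sub_self] at hD
  obtain ⟨X, hX⟩ := eventually_atTop.1 ((hD.eventually_lt_const
    (by positivity : 0 < δ * (ε ^ 2 / 4))).and (eventually_ge_atTop 0))
  refine ⟨X, fun x hx => ?_⟩
  obtain ⟨h1, hx0⟩ := hX x hx
  rw [Real.dist_eq, sub_zero]
  by_contra! hcon
  simp only [id] at h1
  have cf2 : Continuous fun x => f x ^ 2 := by fun_prop
  rw [intervalIntegral.integral_interval_sub_left (cf2.intervalIntegrable _ _)
    (cf2.intervalIntegrable _ _)] at h1
  have h2 : ∫ _ in x..(x + δ), ε ^ 2 / 4 ≤ ∫ y in x..(x + δ), f y ^ 2 := by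
    refine intervalIntegral.integral_mono_on (by linarith) (by simp)
      (cf2.intervalIntegrable _ _) fun y hy => ?_
    have h3 := hK x y hx0 (hx0.trans hy.1)
    have h4 : √|x - y| ≤ s := by
      rw [← Real.sqrt_sq hs0.le]
      refine Real.sqrt_le_sqrt ?_
      rw [abs_sub_comm, abs_of_nonneg (by linarith [hy.1])]; linarith [hy.2]
    have h5 : |f x - f y| ≤ ε / 2 := (h3.trans (mul_le_mul_of_nonneg_left h4 hK0)).trans hKs
    have h6 : |f x| - |f y| ≤ |f x - f y| := abs_sub_abs_le_abs_sub _ _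
    have h7 : ε / 2 ≤ |f y| := by linarith
    rw [← sq_abs (f y)]
    nlinarith
  rw [intervalIntegral.integral_const, smul_eq_mul, add_sub_cancel_left] at h2
  linarith

/-- An interval of length greater than `π` contains a point where `sin` has modulus one. -/
lemma exists_abs_sin_eq_one {p q : ℝ} (h : p + Real.pi ≤ q) : ∃ t ∈ Icc p q, |Real.sin t| = 1 := by
  have hpi := Real.pi_pos
  set k := ⌈(p - Real.pi / 2) / Real.pi⌉
  have h1 : (p - Real.pi / 2) / Real.pi ≤ k := Int.le_ceil _
  have h2 : (k : ℝ) < (p - Real.pi / 2) / Real.pi + 1 := Int.ceil_lt_add_one _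
  rw [div_le_iff₀ hpi] at h1
  rw [← sub_lt_iff_lt_add, lt_div_iff₀ hpi] at h2
  refine ⟨k * Real.pi + Real.pi / 2, ⟨by linarith, by nlinarith⟩, ?_⟩
  rw [Real.sin_add_pi_div_two, Real.abs_cos_int_mul_pi]

/-- Once |sin a| < 1, a continuous a cannot move by more than π, for it would cross a point where
the sine has modulus one. This gives boundedness, which a square-integrable derivative alone does
not. -/
lemma exists_bound_of_tendsto_sin {a : ℝ → ℝ} (ha : Continuous a)
    (h : Tendsto (fun x => Real.sin (a x)) atTop (𝓝 0)) : ∃ B, ∀ x, 0 ≤ x → |a x| ≤ B := by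
  obtain ⟨X, hX⟩ := Metric.tendsto_atTop.1 h 1 one_pos
  set Y := max X 0
  obtain ⟨B, hB⟩ := (isCompact_Icc (a := (0 : ℝ)) (b := Y)).exists_bound_of_continuousOn
    ha.continuousOn
  refine ⟨B + Real.pi, fun x hx => ?_⟩
  have hpi := Real.pi_pos
  rcases le_total x Y with hxY | hxY
  · have := hB x ⟨hx, hxY⟩
    rw [Real.norm_eq_abs] at this; linarith
  have hBY := hB Y ⟨le_max_right _ _, le_rfl⟩
  rw [Real.norm_eq_abs] at hBY
  have key : |a x - a Y| ≤ Real.pi := by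
    by_contra! hcon
    have himg := intermediate_value_uIcc (a := Y) (b := x) ha.continuousOn
    have hex : ∃ t ∈ uIcc (a Y) (a x), |Real.sin t| = 1 := by
      refine exists_abs_sin_eq_one ?_
      have := max_sub_min_eq_abs (a Y) (a x)
      have e : a Y ⊔ a x - a Y ⊓ a x = |a x - a Y| := by rw [← this]
      linarith
    obtain ⟨t, ht, ht1⟩ := hex
    obtain ⟨y, hy, rfl⟩ := himg ht
    rw [uIcc_of_le hxY] at hy
    have := hX y ((le_max_left _ _).trans hy.1)
    rw [Real.dist_eq, sub_zero, ht1] at this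
    exact lt_irrefl _ this
  have : |a x| ≤ |a x - a Y| + |a Y| := by
    have := abs_add_le (a x - a Y) (a Y); rwa [sub_add_cancel] at this
  linarith

namespace IsProfile

variable {β ν : ℝ} {η θ a g : ℝ → ℝ}

lemma tendsto_sin (hν : 0 < ν) (hη : IsCutoff β η) (h : IsProfile β ν η θ a g) :
    Tendsto (fun x => Real.sin (a x + β)) atTop (𝓝 0) := by
  have ca := h.prim.continuous
  refine tendsto_zero_of_sq_integrable (K := √(∫ t, g t ^ 2)) (by fun_prop)
    (integrable_sin_sq_of_locDensity hν hη ca h.integrable_loc) fun x y _ _ => ?_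
  refine (Real.abs_sin_sub_sin_le _ _).trans ?_
  rw [add_sub_add_right_eq_sub]
  exact h.prim.abs_sub_le_sqrt h.memLp x y

lemma exists_bound (hν : 0 < ν) (hη : IsCutoff β η) (h : IsProfile β ν η θ a g) :
    ∃ B, ∀ x, 0 ≤ x → |a x + β| ≤ B := by
  have ca := h.prim.continuous
  exact exists_bound_of_tendsto_sin (a := fun x => a x + β) (by fun_prop) (h.tendsto_sin hν hη)

end IsProfile

namespace IsRegularProfile

variable {β ν M H : ℝ} {η θ a f : ℝ → ℝ}

lemma tendsto_deriv (h : IsRegularProfile β ν η θ a f M H) : Tendsto f atTop (𝓝 0) := by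
  refine tendsto_zero_of_sq_integrable h.continuous ?_ h.holder
  refine h.profile.memLp.integrable_sq.integrableOn.congr_fun (fun x hx => ?_) measurableSet_Ioi
  simp only [indicator_of_mem hx]

/-- The Pohozaev-type identity. -/
lemma sq_deriv_sub_sq_sin (hν : 0 < ν) (hη : IsCutoff β η) (hmin : IsMinimizer β ν η θ)
    (h : IsRegularProfile β ν η θ a f M H) {b : ℝ} (hb : 0 ≤ b) :
    f b ^ 2 - Real.sin (a b + β) ^ 2 - (f 0 ^ 2 - Real.sin β ^ 2) =
      2 * coeff ν * ∫ x in (0 : ℝ)..b, (Ioi (0 : ℝ)).indicator (fun x => Real.cos (a x) * f x) x *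
        nonlocalOp (fun x => Real.sin (a x)) x := by
  set r := (Ioi (0 : ℝ)).indicator (rhs β ν a) with hr
  -- The values of f on the negative axis are unrelated to the equation; F agrees with f for x ≥ 0
  -- and is a primitive on the whole line.
  set F : ℝ → ℝ := fun x => f 0 + primitive r x with hF
  have hFf : ∀ x, 0 ≤ x → F x = f x := fun x hx => (h.deriv_eq_primitive hν hη hmin hx).symm
  have hpF : IsPrim F r := by
    refine ⟨h.locallyIntegrable_rhs, fun x y => ?_⟩
    rw [← (isPrim_primitive h.locallyIntegrable_rhs).eq x y]; simp only [hF]; ring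
  have hpa : IsPrim (fun x => a x + β) ((Ioi (0 : ℝ)).indicator f) :=
    ⟨h.profile.prim.locInt, fun x y => by rw [← h.profile.prim.eq x y]; ring⟩
  have hS := hpa.sin
  have e1 := (hpF.mul hpF).eq 0 b
  have e2 := (hS.mul hS).eq 0 b
  simp only [h.profile.eq_zero 0 le_rfl, zero_add, hFf b hb, hFf 0 le_rfl] at e1 e2
  rw [← intervalIntegral.integral_const_mul]
  have e3 := congrArg₂ (· - ·) e1 e2
  rw [← intervalIntegral.integral_sub ((hpF.mul hpF).ii 0 b) ((hS.mul hS).ii 0 b)] at e3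
  calc _ = f b * f b - f 0 * f 0 -
        (Real.sin (a b + β) * Real.sin (a b + β) - Real.sin β * Real.sin β) := by ring
    _ = _ := e3
    _ = _ := by
      -- The derivative of sin² θ cancels the local term of the right-hand side, leaving only the
      -- nonlocal one.
      refine intervalIntegral.integral_congr_ae (Eventually.of_forall fun x hx => ?_)
      rw [uIoc_of_le hb] at hx
      have hx' : x ∈ Ioi (0 : ℝ) := hx.1
      rw [hr, indicator_of_mem hx', indicator_of_mem hx', indicator_of_mem hx', hFf x hx.1.le, rhs]
      ring

/-- Let b tend to infinity in the Pohozaev identity: θ' and sin θ vanish there and the pairing tends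
to 0, so θ'(0)² = sin² β. The range of β makes its sine nonnegative. -/
theorem abs_deriv_zero (hβ : 0 < β) (hβ' : β ≤ Real.pi / 2) (hν : 0 < ν) (hη : IsCutoff β η)
    (hmin : IsMinimizer β ν η θ) (h : IsRegularProfile β ν η θ a f M H) :
    |f 0| = Real.sin β := by
  have hm : MemLp ((Ioi (0 : ℝ)).indicator fun x => Real.cos (a x) * f x) 2 volume := by
    refine h.profile.memLp_cos_mul.ae_eq (Eventually.of_forall fun x => ?_)
    simp only [indicator]; split_ifs <;> simp
  have h1 := (h.isHolderEdge.tendsto_pairing hm).const_mul (2 * coeff ν)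
  have h2 := ((h.tendsto_deriv.pow 2).sub ((h.profile.tendsto_sin hν hη).pow 2)).sub_const
    (f 0 ^ 2 - Real.sin β ^ 2)
  have h3 := tendsto_nhds_unique_of_eventuallyEq h2 h1 (by
    filter_upwards [eventually_ge_atTop 0] with b hb
    exact h.sq_deriv_sub_sq_sin hν hη hmin hb)
  have h4 : 0 ≤ Real.sin β := Real.sin_nonneg_of_nonneg_of_le_pi hβ.le (by linarith [Real.pi_pos])
  rw [← abs_of_nonneg h4, ← sq_eq_sq_iff_abs_eq_abs]
  linarith

end IsRegularProfile

/-! ### The logarithmic singularity at the edge -/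

namespace IsHolderEdge

variable {u v : ℝ → ℝ} {M H : ℝ}

lemma abs_sub_linear_le (h : IsHolderEdge u v M H) {y : ℝ} (hy : 0 ≤ y) :
    |u y - v 0 * y| ≤ H * (y * √y) := by
  have hH := h.holder_nonneg
  have e : u y - v 0 * y = ∫ t in (0 : ℝ)..y, ((Ioi 0).indicator v t - v 0) := by
    rw [intervalIntegral.integral_sub (h.prim.ii _ _) (by simp), ← h.prim.eq, h.eq_zero 0 le_rfl]
    simp; ring
  rw [e, ← Real.norm_eq_abs]
  refine (intervalIntegral.norm_integral_le_of_norm_le_const (C := H * √y) fun t ht => ?_).trans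
    (le_of_eq (by rw [sub_zero, abs_of_nonneg hy]; ring))
  rw [uIoc_of_le hy] at ht
  rw [indicator_of_mem (by exact ht.1), Real.norm_eq_abs]
  refine (h.holder t 0 ht.1.le le_rfl).trans (mul_le_mul_of_nonneg_left ?_ hH)
  rw [sub_zero, abs_of_pos ht.1]
  exact Real.sqrt_le_sqrt ht.2

/-- For z ≥ x the point x - z lies where u is zero, so to first order 2u(x) - u(x+z) is v(0)(2x -
(x+z)) = v(0)(x - z). The missing third value is the source of the logarithm. -/
lemma abs_secondDiff_sub_linear_le (h : IsHolderEdge u v M H) {x z : ℝ} (hx : 0 < x) (hxz : x ≤ z) :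
    |secondDiff u z x - v 0 * (x - z)| ≤ 6 * H * (z * √z) := by
  have hH := h.holder_nonneg
  have hz : 0 < z := hx.trans_le hxz
  have h1 := h.abs_sub_linear_le hx.le
  have h2 := h.abs_sub_linear_le (y := x + z) (by linarith)
  have h3 : x * √x ≤ z * √z := mul_le_mul hxz (Real.sqrt_le_sqrt hxz) (Real.sqrt_nonneg _) hz.le
  have h4 : (x + z) * √(x + z) ≤ 4 * (z * √z) := by
    have h5 : √(x + z) ≤ 2 * √z := by
      rw [Real.sqrt_le_left (by positivity), mul_pow, Real.sq_sqrt hz.le]; linarith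
    calc _ ≤ (2 * z) * (2 * √z) := mul_le_mul (by linarith) h5 (Real.sqrt_nonneg _) (by linarith)
      _ = _ := by ring
  have e : secondDiff u z x - v 0 * (x - z) =
      2 * (u x - v 0 * x) - (u (x + z) - v 0 * (x + z)) := by
    rw [secondDiff, h.eq_zero (x - z) (by linarith)]; ring
  rw [e]
  have h6 := mul_le_mul_of_nonneg_left h3 hH
  have h7 := mul_le_mul_of_nonneg_left h4 hH
  rw [_root_.abs_le] at h1 h2 ⊢
  constructor <;> linarith [h1.1, h1.2, h2.1, h2.2]

lemma integral_linear_div_sq {x : ℝ} (hx : 0 < x) (hx1 : x ≤ 1) (m : ℝ) :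
    IntegrableOn (fun z => m * (x - z) / z ^ 2) (Ioc x 1) ∧
      ∫ z in Ioc x 1, m * (x - z) / z ^ 2 = m * (1 - x + Real.log x) := by
  have hc : ContinuousOn (fun z => m * (x - z) / z ^ 2) (Icc x 1) := by
    refine ContinuousOn.div (by fun_prop) (by fun_prop) fun z hz => ?_
    have : 0 < z := hx.trans_le hz.1
    positivity
  refine ⟨hc.integrableOn_Icc.mono_set Ioc_subset_Icc_self, ?_⟩
  rw [← intervalIntegral.integral_of_le hx1, intervalIntegral.integral_eq_sub_of_hasDerivAt
    (f := fun z => m * (-x * z⁻¹ - Real.log z))]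
  · rw [inv_one, Real.log_one, neg_mul x x⁻¹, mul_inv_cancel₀ hx.ne']; ring
  · intro z hz
    rw [uIcc_of_le hx1] at hz
    have hz0 : z ≠ 0 := (hx.trans_le hz.1).ne'
    refine ((((hasDerivAt_inv hz0).const_mul (-x)).sub (Real.hasDerivAt_log hz0)).const_mul
      m).congr_deriv ?_
    field_simp
  · rw [← uIcc_of_le hx1] at hc
    exact hc.intervalIntegrable

/-- The nonlocal operator has a logarithmic singularity at the edge. -/
lemma abs_nonlocalOp_sub_log_le (h : IsHolderEdge u v M H) {x : ℝ} (hx : 0 < x) (hx1 : x ≤ 1) :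
    |nonlocalOp u x - v 0 * Real.log x| ≤ 16 * H + 5 * M + 4 := by
  have hM := h.bound_nonneg
  have hH := h.holder_nonneg
  have hsx := Real.sqrt_pos.2 hx
  have hsx1 : √x ≤ 1 := by exact Real.sqrt_le_one.2 hx1
  -- Three ranges are compared. For z ≤ x the bound with this K integrates to 2K√x, bounded in x
  -- since √x cancels the 1/√x; for x < z ≤ 1 the linear model is subtracted; for z > 1 the bound
  -- |u| ≤ 1 suffices.
  set K := 2 * H + 2 * M / √x with hK
  set l : ℝ → ℝ := (Ioc x 1).indicator fun z => v 0 * (x - z) / z ^ 2 with hl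
  set k : ℝ → ℝ := (Ioc 0 x).indicator fun z => K * z ^ (-(1 / 2) : ℝ) with hk
  obtain ⟨i1, e1⟩ := integral_linear_div_sq hx hx1 (v 0)
  have il : Integrable l := (integrable_indicator_iff measurableSet_Ioc).2 i1
  have el : ∫ z in Ioi (0 : ℝ), l z = v 0 * (1 - x + Real.log x) := by
    rw [← e1, hl, setIntegral_indicator measurableSet_Ioc,
      inter_eq_self_of_subset_right (show Ioc x 1 ⊆ Ioi 0 from fun z hz => hx.trans hz.1)]
  have ik : Integrable k := (integrable_indicator_iff measurableSet_Ioc).2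
    (((intervalIntegrable_iff_integrableOn_Ioc_of_le hx.le).1
      (intervalIntegral.intervalIntegrable_rpow' (by norm_num))).const_mul _)
  have ek : ∫ z in Ioi (0 : ℝ), k z = K * (2 * √x) := by
    rw [hk, setIntegral_indicator measurableSet_Ioc,
      inter_eq_self_of_subset_right (show Ioc 0 x ⊆ Ioi 0 from fun z hz => hz.1), integral_const_mul,
      ← intervalIntegral.integral_of_le hx.le, integral_rpow (Or.inl (by norm_num))]
    have : (-(1 / 2) + 1 : ℝ) = 1 / 2 := by norm_num
    rw [this, ← Real.sqrt_eq_rpow, Real.zero_rpow (by norm_num)]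
    ring
  have hb : ∀ z ∈ Ioi (0 : ℝ), ‖secondDiff u z x / z ^ 2 - l z‖ ≤ opBound (6 * H) z + k z := by
    intro z hz
    have hz0 : (0 : ℝ) < z := hz
    rw [Real.norm_eq_abs, opBound]
    rcases le_or_gt z 1 with hz1 | hz1
    · rw [indicator_of_mem (a := z) (s := Ioc (0 : ℝ) 1) ⟨hz0, hz1⟩,
        indicator_of_notMem (a := z) (s := Ioi (1 : ℝ)) (by simpa using hz1)]
      rcases le_or_gt z x with hzx | hzx
      · rw [hl, hk, indicator_of_notMem (s := Ioc x 1) (fun h' => not_lt.2 hzx h'.1),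
          indicator_of_mem (s := Ioc 0 x) ⟨hz0, hzx⟩]
        have b1 := abs_div_sq_le_of_le_mul_sqrt hz0 (h.abs_secondDiff_le_mul_sqrt hx hz0)
        have b2 : 0 ≤ 6 * H * z ^ (-(1 / 2) : ℝ) := by positivity
        rw [sub_zero]; linarith
      · rw [hl, hk, indicator_of_mem (s := Ioc x 1) ⟨hzx, hz1⟩,
          indicator_of_notMem (s := Ioc 0 x) (fun h' => not_lt.2 h'.2 hzx),
          ← sub_div]
        have b1 := abs_div_sq_le_of_le_mul_sqrt hz0 (h.abs_secondDiff_sub_linear_le hx hzx.le)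
        linarith
    · rw [hl, hk, indicator_of_notMem (s := Ioc x 1) (fun h' => not_lt.2 h'.2 hz1),
        indicator_of_notMem (s := Ioc 0 x) (fun h' => not_lt.2 (h'.2.trans hx1) hz1),
        indicator_of_notMem (s := Ioc (0 : ℝ) 1) (fun h' => not_lt.2 h'.2 hz1),
        indicator_of_mem (s := Ioi (1 : ℝ)) hz1]
      have b1 := abs_div_sq_le_of_le hz0 (abs_secondDiff_le_four h.abs_le_one z x)
      rw [sub_zero]; linarith
  have key := norm_integral_le_of_norm_le (μ := volume.restrict (Ioi (0 : ℝ)))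
    ((integrable_opBound (6 * H)).integrableOn.add ik.integrableOn)
    ((ae_restrict_mem measurableSet_Ioi).mono hb)
  rw [integral_sub (h.integrableOn_secondDiff hx) il.integrableOn, el, Real.norm_eq_abs] at key
  have e2 : ∫ z in Ioi (0 : ℝ), (opBound (6 * H) + k) z = 2 * (6 * H) + 4 + K * (2 * √x) := by
    rw [← ek, ← integral_opBound, ← integral_add (integrable_opBound _).integrableOn ik.integrableOn]
    rfl
  have e3 : K * (2 * √x) ≤ 4 * H + 4 * M := by
    have : K * (2 * √x) = 4 * H * √x + 4 * M := by rw [hK]; field_simp; ring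
    rw [this]; nlinarith
  have key' : |nonlocalOp u x - v 0 * (1 - x + Real.log x)| ≤ 2 * (6 * H) + 4 + K * (2 * √x) :=
    key.trans e2.le
  have e4 : |v 0 * (1 - x)| ≤ M := by
    rw [abs_mul, abs_of_nonneg (by linarith : 0 ≤ 1 - x)]
    exact (mul_le_of_le_one_right (abs_nonneg _) (by linarith)).trans (h.abs_le 0 le_rfl)
  have e5 : nonlocalOp u x - v 0 * Real.log x =
      (nonlocalOp u x - v 0 * (1 - x + Real.log x)) + v 0 * (1 - x) := by ring
  rw [e5]
  refine (abs_add_le _ _).trans ?_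
  linarith

lemma tendsto_abs_nonlocalOp (h : IsHolderEdge u v M H) (h0 : v 0 ≠ 0) :
    Tendsto (fun x => |nonlocalOp u x|) (𝓝[>] 0) atTop := by
  have h1 : Tendsto (fun x => |v 0| * |Real.log x|) (𝓝[>] 0) atTop :=
    (tendsto_abs_atBot_atTop.comp Real.tendsto_log_nhdsGT_zero).const_mul_atTop (abs_pos.2 h0)
  refine tendsto_atTop_mono' _ ?_ (tendsto_atTop_add_const_right _ (-(16 * H + 5 * M + 4)) h1)
  filter_upwards [Ioc_mem_nhdsGT one_pos] with x hx
  have h2 := h.abs_nonlocalOp_sub_log_le hx.1 hx.2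
  have h3 := abs_sub_abs_le_abs_sub (v 0 * Real.log x) (nonlocalOp u x)
  rw [abs_sub_comm, abs_mul] at h3
  linarith

end IsHolderEdge

/-- At the edge cos(a) tends to cos 0 = 1, so the coefficient of the operator stays away from zero
and u has the same slope there as θ; the local term is bounded by 1. -/
theorem IsRegularProfile.tendsto_abs_rhs {β ν M H : ℝ} {η θ a f : ℝ → ℝ} (hν : 0 < ν)
    (h : IsRegularProfile β ν η θ a f M H) (h0 : f 0 ≠ 0) :
    Tendsto (fun x => |rhs β ν a x|) (𝓝[>] 0) atTop := by
  have ca := h.profile.prim.continuous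
  have hκ : 0 < coeff ν := by unfold coeff; positivity
  have a0 := h.profile.eq_zero 0 le_rfl
  have h1 := h.isHolderEdge.tendsto_abs_nonlocalOp (by simpa [a0] using h0)
  have hc : Continuous fun x => coeff ν * |Real.cos (a x)| := by fun_prop
  have h2 : Tendsto (fun x => coeff ν * |Real.cos (a x)|) (𝓝[>] 0) (𝓝 (coeff ν)) := by
    have := (hc.tendsto 0).mono_left (nhdsWithin_le_nhds (s := Ioi (0 : ℝ)))
    simpa [a0] using this
  refine tendsto_atTop_mono (fun x => ?_) (tendsto_atTop_add_const_right _ (-1)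
    (h2.pos_mul_atTop hκ h1))
  have h3 : |Real.sin (a x + β) * Real.cos (a x + β)| ≤ 1 := by
    rw [abs_mul]
    exact mul_le_one₀ (Real.abs_sin_le_one _) (abs_nonneg _) (Real.abs_cos_le_one _)
  have h4 := abs_sub_abs_le_abs_sub (coeff ν * Real.cos (a x) *
    nonlocalOp (fun x => Real.sin (a x)) x) (-(Real.sin (a x + β) * Real.cos (a x + β)))
  rw [abs_neg, sub_neg_eq_add, abs_mul, abs_mul, abs_of_pos hκ, add_comm (_ * _ * _)] at h4
  unfold rhs
  linarith

/-! ### Transfer of the results to θ -/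

namespace IsRegularProfile

variable {β ν M H : ℝ} {η θ a f : ℝ → ℝ}

/-- On [0, ∞) this exhibits θ as the restriction of a C¹ function on the line, so regularity up to 0
and the one-sided derivative do not depend on the values of θ for x < 0. -/
lemma eqOn_primitive (h : IsRegularProfile β ν η θ a f M H) :
    EqOn θ (fun x => β + primitive f x) (Ici 0) := by
  intro x hx
  have hx0 : 0 ≤ x := hx
  have h1 := h.profile.prim.eq 0 x
  rw [h.profile.eq_zero 0 le_rfl, sub_zero] at h1
  simp only [h.profile.eq_add x hx0, h1, primitive]
  congr 1
  refine intervalIntegral.integral_congr_ae (Eventually.of_forall fun t ht => ?_)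
  rw [uIoc_of_le hx0] at ht
  exact indicator_of_mem (by exact ht.1) _

lemma hasDerivAt (h : IsRegularProfile β ν η θ a f M H) {x : ℝ} (hx : 0 < x) :
    HasDerivAt θ (f x) x := by
  refine ((hasDerivAt_primitive h.continuous x).const_add β).congr_of_eventuallyEq ?_
  filter_upwards [Ioi_mem_nhds hx] with y hy using h.eqOn_primitive (Ioi_subset_Ici_self hy)

lemma derivWithin_zero (h : IsRegularProfile β ν η θ a f M H) : derivWithin θ (Ici 0) 0 = f 0 := by
  have h1 := ((hasDerivAt_primitive h.continuous 0).const_add β).hasDerivWithinAt (s := Ici 0)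
  exact (h1.congr h.eqOn_primitive (h.eqOn_primitive self_mem_Ici)).derivWithin
    (uniqueDiffOn_Ici 0 0 self_mem_Ici)

lemma contDiffOn_one (h : IsRegularProfile β ν η θ a f M H) : ContDiffOn ℝ 1 θ (Ici 0) := by
  refine ContDiffOn.congr (ContDiff.contDiffOn ?_) h.eqOn_primitive
  refine contDiff_const.add (contDiff_one_iff_deriv.2
    ⟨fun x => (hasDerivAt_primitive h.continuous x).differentiableAt, ?_⟩)
  rw [funext fun x => (hasDerivAt_primitive h.continuous x).deriv]
  exact h.continuous

lemma deriv_deriv (hν : 0 < ν) (hη : IsCutoff β η) (hmin : IsMinimizer β ν η θ)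
    (h : IsRegularProfile β ν η θ a f M H) {x : ℝ} (hx : 0 < x) :
    deriv (deriv θ) x = rhs β ν a x := by
  refine ((h.hasDerivAt_deriv hν hη hmin hx).congr_of_eventuallyEq ?_).deriv
  filter_upwards [Ioi_mem_nhds hx] with y hy using (h.hasDerivAt hy).deriv

lemma contDiffOn_two (hν : 0 < ν) (hη : IsCutoff β η) (hmin : IsMinimizer β ν η θ)
    (h : IsRegularProfile β ν η θ a f M H) : ContDiffOn ℝ 2 θ (Ioi 0) := by
  have e1 : EqOn (deriv θ) f (Ioi 0) := fun x hx => (h.hasDerivAt hx).deriv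
  have e2 : EqOn (deriv f) (rhs β ν a) (Ioi 0) := fun x hx =>
    (h.hasDerivAt_deriv hν hη hmin hx).deriv
  have h1 : ContDiffOn ℝ (0 + 1) f (Ioi 0) :=
    (contDiffOn_succ_iff_deriv_of_isOpen isOpen_Ioi).2
      ⟨fun x hx => (h.hasDerivAt_deriv hν hη hmin hx).differentiableAt.differentiableWithinAt,
        by simp, contDiffOn_zero.2 (h.continuousOn_rhs.congr e2)⟩
  rw [zero_add] at h1
  rw [show (2 : WithTop ℕ∞) = 1 + 1 by norm_num, contDiffOn_succ_iff_deriv_of_isOpen isOpen_Ioi]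
  exact ⟨fun x hx => (h.hasDerivAt hx).differentiableAt.differentiableWithinAt, by simp,
    h1.congr e1⟩

lemma memW1Infty (hν : 0 < ν) (hη : IsCutoff β η) (h : IsRegularProfile β ν η θ a f M H) :
    MemW1Infty θ := by
  obtain ⟨B, hB⟩ := h.profile.exists_bound hν hη
  have ca := h.profile.prim.continuous
  have hpa : IsPrim (fun x => a x + β) ((Ioi (0 : ℝ)).indicator f) :=
    ⟨h.profile.prim.locInt, fun x y => by rw [← h.profile.prim.eq x y]; ring⟩
  have he : ∀ x, 0 < x → θ x = a x + β := fun x hx => by rw [h.profile.eq_add x hx.le, add_comm]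
  refine ⟨?_, (Ioi (0 : ℝ)).indicator f, hpa.hasWeakDeriv he, ?_⟩
  · have h1 : MemLp (fun x => a x + β) ∞ halfLine :=
      memLp_top_of_bound (Continuous.aestronglyMeasurable (by fun_prop)) B
        ((ae_restrict_mem measurableSet_Ioi).mono fun x hx => hB x (le_of_lt hx))
    exact h1.ae_eq ((ae_restrict_mem measurableSet_Ioi).mono fun x hx => (he x hx).symm)
  · exact memLp_top_of_bound (h.continuous.measurable.indicator
      measurableSet_Ioi).aestronglyMeasurable M (Eventually.of_forall h.abs_indicator_le)

lemma hasPrincipalValue (h : IsRegularProfile β ν η θ a f M H) {x : ℝ} (hx : 0 < x) :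
    HasPrincipalValue (fun y => (Real.sin (θ x - β) - Real.sin (θ y - β)) / (x - y) ^ 2) x
      (nonlocalOp (fun x => Real.sin (a x)) x - Real.sin (a x) / x) := by
  obtain ⟨h1, h2⟩ := h.isHolderEdge.hasPrincipalValue hx
  have hm : ∀ ε : ℝ, MeasurableSet {y : ℝ | 0 < y ∧ ε < |y - x|} := fun ε =>
    (measurableSet_lt measurable_const measurable_id).inter (measurableSet_lt
      (f := fun _ : ℝ => ε) (g := fun y : ℝ => |y - x|) (by fun_prop) (by fun_prop))
  have he : ∀ ε : ℝ, EqOn (fun y => (Real.sin (a x) - Real.sin (a y)) / (x - y) ^ 2)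
      (fun y => (Real.sin (θ x - β) - Real.sin (θ y - β)) / (x - y) ^ 2)
      {y : ℝ | 0 < y ∧ ε < |y - x|} := fun ε y hy => by
    simp only [h.profile.eq_add x hx.le, h.profile.eq_add y hy.1.le, add_sub_cancel_left]
  refine ⟨fun ε hε => (h1 ε hε).congr_fun (he ε) (hm ε), h2.congr fun ε => ?_⟩
  exact setIntegral_congr_fun (hm ε) (he ε)

end IsRegularProfile

end EdgeWall

theorem theorem2 (β ν : ℝ) (hβ : 0 < β) (hβ' : β ≤ Real.pi / 2) (hν : 0 < ν)
    (η : ℝ → ℝ) (hη : EdgeWall.IsCutoff β η)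
    (θ : ℝ → ℝ) (hθ : EdgeWall.IsMinimizer β ν η θ) :
    ContDiffOn ℝ 2 θ (Set.Ioi 0) ∧
    ContDiffOn ℝ 1 θ (Set.Ici 0) ∧
    EdgeWall.MemW1Infty θ ∧
    (∀ x : ℝ, 0 < x → ∃ I : ℝ,
      EdgeWall.HasPrincipalValue
        (fun y => (Real.sin (θ x - β) - Real.sin (θ y - β)) / (x - y) ^ 2) x I ∧
      deriv (deriv θ) x =
        Real.sin (θ x) * Real.cos (θ x)
          + ν / (2 * Real.pi) * (Real.sin (θ x - β) * Real.cos (θ x - β) / x)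
          + ν / (2 * Real.pi) * Real.cos (θ x - β) * I) ∧
    |derivWithin θ (Set.Ici 0) 0| = Real.sin β ∧
    Filter.Tendsto (fun x => |deriv (deriv θ) x|) (nhdsWithin 0 (Set.Ioi 0)) Filter.atTop := by
  obtain ⟨a, g, hp⟩ := hθ.exists_isProfile hν hη
  obtain ⟨f, M, H, h⟩ := hp.exists_isRegularProfile hν hη hθ
  have h0 := h.abs_deriv_zero hβ hβ' hν hη hθ
  refine ⟨h.contDiffOn_two hν hη hθ, h.contDiffOn_one, h.memW1Infty hν hη, fun x hx =>
    ⟨_, h.hasPrincipalValue hx, ?_⟩, by rw [h.derivWithin_zero, h0], ?_⟩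
  -- The principal value is the operator minus u(x)/x, so the two 1/x terms of the stated equation
  -- cancel and the right-hand side in terms of the operator remains.
  · rw [h.deriv_deriv hν hη hθ hx, EdgeWall.IsRegularProfile.rhs, EdgeWall.coeff,
      h.profile.eq_add x hx.le, add_sub_cancel_left, add_comm (a x)]
    ring
  · have hs : 0 < Real.sin β := Real.sin_pos_of_pos_of_lt_pi hβ (by linarith [Real.pi_pos])
    -- The slope at the edge is nonzero because its modulus is sin β > 0.
    refine (h.tendsto_abs_rhs hν (abs_pos.1 (h0 ▸ hs))).congr' ?_
    filter_upwards [self_mem_nhdsWithin] with x hx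
    rw [h.deriv_deriv hν hη hθ hx]
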